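/- **Proposition (DGGS and MSDGGS oracles).** Let $\Gamma=(V,E)$ be a finite digraph (loops allowed). Let $V_T$ be the set of its terminal positions (out-degree zero), let the remaining positions be partitioned into $V_A$ and $V_B$, controlled by Alice and Bob, and let an initial position $v_0\in V_A\cup V_B$ be fixed. A strategy $x\in X$ of Alice (respectively, $y\in Y$ of Bob) assigns to each $v\in V_A$ (respectively, $v\in V_B$) an arc leaving $v$. A pair $(x,y)$ defines a unique play, the walk from $v_0$ that follows $x$ and $y$; it either ends in $V_T$ or is infinite and eventually repeats a directed cycle. Consider two game forms $g:X\times Y\to\Omega$: * DGGS: $\Omega=V_T\cup\{c\}$, and $g(x,y)$ is the terminal in which the play ends, or $c$ if the play is infinite. * MSDGGS (multi-stage DGGS): $\Omega$ is the set of all strongly connected components of $\Gamma$ that are terminals or contain a directed cycle (a loop is one), and $g(x,y)$ is the component that contains the terminal in which the play ends, or the directed cycle that it repeats. Then in both cases the following holds. * (I) The set $\Omega$ of outcomes can be generated explicitly from $\Gamma$ in time $O(|V|+|E|)$. * (II) The game form $g$ is tight: for all maps $\varphi:X\to Y$ and $\psi:Y\to X$ the sets $\{g(x,\varphi(x)):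 x\in X\}$ and $\{g(\psi(y),y): y\in Y\}$ intersect. * (III) Every $\pm1$ game on $g$, given by a partition $\Omega=\Omega_A\cup\Omega_B$, can be solved in time $O(|V|+|E|)$: one algorithm, given $\Gamma$ and the partition, determines whether there is an $x\in X$ with $g(x,y)\in\Omega_A$ for all $y\in Y$ (Alice wins) or a $y\in Y$ with $g(x,y)\in\Omega_B$ for all $x\in X$ (Bob wins), one of which is always the case, and outputs such a winning strategy. Here time is the number of elementary operations of a random access machine with unit cost, indirect addressing, comparisons, and $\pm1$ as its only arithmetic. Its input is the list of positions with their owners and the list of arcs in any order. For MSDGGS the partition is given by telling for each position whether it lies in an outcome of $\Omega_A$; for DGGS it is given by telling which terminals lie in $\Omega_A$ and whether $c$ does. -/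

import Mathlib

universe u

/-! ### Game forms -/

/-- A game form `g : X × Y → Ω` is tight if `g(gr φ) ∩ g(gr ψ) ≠ ∅` for all response strategies
`φ : X → Y` and `ψ : Y → X`. -/
def IsTight {X Y Ω : Type*} (g : X → Y → Ω) : Prop :=
  ∀ (φ : X → Y) (ψ : Y → X),
    (Set.range (fun x => g x (φ x)) ∩ Set.range (fun y => g (ψ y) y)).Nonempty

/-- `x` wins for Alice in the `±1` game `(g; ΩA, ΩAᶜ)`: `g(x) ⊆ ΩA`. -/
def WinsAlice {X Y Ω : Type*} (g : X → Y → Ω) (ΩA : Set Ω) (x : X) : Prop :=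
  ∀ y, g x y ∈ ΩA

/-- `y` wins for Bob in the `±1` game `(g; ΩA, ΩAᶜ)`: `g(y) ⊆ ΩAᶜ`. -/
def WinsBob {X Y Ω : Type*} (g : X → Y → Ω) (ΩA : Set Ω) (y : Y) : Prop :=
  ∀ x, g x y ∈ ΩAᶜ

/-! ### Graphical game structures -/

inductive Player where
  | alice
  | bob

/-- A digraph on `V` (loops allowed) whose vertices are positions and whose arcs are moves, with the
player who controls each position and an initial position of positive out-degree.
(The value of `owner` at positions of out-degree zero is irrelevant.) -/
structure GameStructure (V : Type u) extends Digraph V where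
  owner : V → Player
  init : V
  init_move : ∃ w, Adj init w

namespace GameStructure

variable {V : Type u} (Γ : GameStructure V)

/-- Terminal positions `V_T`: out-degree zero. -/
def VT : Set V := {v | ∀ w, ¬ Γ.Adj v w}

/-- Positions `V_A` of positive out-degree controlled by Alice. -/
def VA : Set V := {v | (∃ w, Γ.Adj v w) ∧ Γ.owner v = Player.alice}

/-- Positions `V_B` of positive out-degree controlled by Bob. -/
def VB : Set V := {v | (∃ w, Γ.Adj v w) ∧ Γ.owner v = Player.bob}

/-- Strategies of Alice: a move from each position of `V_A`. -/
abbrev StratA : Type u := (v : Γ.VA) → {w : V // Γ.Adj v w}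

/-- Strategies of Bob: a move from each position of `V_B`. -/
abbrev StratB : Type u := (v : Γ.VB) → {w : V // Γ.Adj v w}

open Classical in
/-- One step of the play. By convention a play that has come to a terminal position stays there. -/
noncomputable def step (x : Γ.StratA) (y : Γ.StratB) (v : V) : V :=
  if hA : v ∈ Γ.VA then x ⟨v, hA⟩ else if hB : v ∈ Γ.VB then y ⟨v, hB⟩ else v

/-- The position of the play `P(x, y)` after `k` steps. -/
noncomputable def play (x : Γ.StratA) (y : Γ.StratB) (k : ℕ) : V :=
  (Γ.step x y)^[k] Γ.init

/-! ### DGGS: outcomes are the terminals and one outcome for all infinite plays -/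

/-- `V_T ∪ {c}`; the outcome `c` of infinite plays is `none`. -/
abbrev DggsOutcome : Type u := Option Γ.VT

open Classical in
/-- The game form of the deterministic graphical game structure `Γ`. -/
noncomputable def dggsForm (x : Γ.StratA) (y : Γ.StratB) : Γ.DggsOutcome :=
  if h : ∃ k, Γ.play x y k ∈ Γ.VT then some ⟨Γ.play x y (Nat.find h), Nat.find_spec h⟩ else none

/-! ### Multi-stage DGGS: outcomes are the non-transient strongly connected components -/

/-- Arcs of the subgraph induced by `S`. -/
def AdjOn (S : Set V) (v w : V) : Prop := v ∈ S ∧ w ∈ S ∧ Γ.Adj v w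

/-- The subgraph induced by `S` is strongly connected. -/
def StronglyConnectedOn (S : Set V) : Prop :=
  ∀ v ∈ S, ∀ w ∈ S, Relation.ReflTransGen (Γ.AdjOn S) v w

/-- `S` is the vertex set of a strongly connected component. -/
def IsSCC (S : Set V) : Prop :=
  Maximal (fun S : Set V => S.Nonempty ∧ Γ.StronglyConnectedOn S) S

/-- The subgraph induced by `S` contains a dicycle, that is, a closed directed walk of positive
length; a loop is a dicycle. -/
def HasDicycle (S : Set V) : Prop := ∃ v ∈ S, Relation.TransGen (Γ.AdjOn S) v v

/-- Transient: not a terminal, and without dicycles. -/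
def IsTransient (S : Set V) : Prop := (¬ ∃ v ∈ Γ.VT, S = {v}) ∧ ¬ Γ.HasDicycle S

/-- The outcomes of the multi-stage structure: all non-transient SCCs. -/
abbrev MsOutcome : Type u := {S : Set V // Γ.IsSCC S ∧ ¬ Γ.IsTransient S}

/-- Mutual reachability class of a vertex. -/
def scc (v : V) : Set V :=
  {w | Relation.ReflTransGen Γ.Adj v w ∧ Relation.ReflTransGen Γ.Adj w v}

theorem reach_of_reachOn {S : Set V} {v w : V} (h : Relation.ReflTransGen (Γ.AdjOn S) v w) :
    Relation.ReflTransGen Γ.Adj v w :=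
  Relation.ReflTransGen.mono (fun _ _ h => h.2.2) _ _ h

theorem isSCC_scc (v : V) : Γ.IsSCC (Γ.scc v) := by
  have key : ∀ a b, a ∈ Γ.scc v → b ∈ Γ.scc v → Relation.ReflTransGen Γ.Adj a b →
      Relation.ReflTransGen (Γ.AdjOn (Γ.scc v)) a b := by
    intro a b ha hb hab
    induction hab using Relation.ReflTransGen.head_induction_on with
    | refl => exact .refl
    | head hac hcb ih =>
      rename_i a c
      have hc : c ∈ Γ.scc v := ⟨ha.1.tail hac, hcb.trans hb.2⟩
      exact .head ⟨ha, hc, hac⟩ (ih hc)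
  refine ⟨⟨⟨v, .refl, .refl⟩, fun a ha b hb => key a b ha hb (ha.2.trans hb.1)⟩, ?_⟩
  rintro T ⟨-, hT⟩ hle w hw
  have hv : v ∈ T := hle ⟨.refl, .refl⟩
  exact ⟨Γ.reach_of_reachOn (hT v hv w hw),
    Γ.reach_of_reachOn (hT w hw v hv)⟩

theorem IsSCC.eq_scc {Γ : GameStructure V} {S : Set V} (h : Γ.IsSCC S) {v : V} (hv : v ∈ S) :
    S = Γ.scc v := by
  have hle : S ≤ Γ.scc v := fun w hw =>
    ⟨Γ.reach_of_reachOn (h.1.2 v hv w hw),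
      Γ.reach_of_reachOn (h.1.2 w hw v hv)⟩
  exact le_antisymm hle (h.2 (Γ.isSCC_scc v).1 hle)

theorem step_of_mem_VT {x : Γ.StratA} {y : Γ.StratB} {v : V} (hv : v ∈ Γ.VT) :
    Γ.step x y v = v := by
  have hA : v ∉ Γ.VA := fun h => h.1.elim hv
  have hB : v ∉ Γ.VB := fun h => h.1.elim hv
  simp [step, hA, hB]

theorem adj_step {x : Γ.StratA} {y : Γ.StratB} {v : V} (hv : v ∉ Γ.VT) :
    Γ.Adj v (Γ.step x y v) := by
  have hv' : ∃ w, Γ.Adj v w := by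
    by_contra h
    exact hv fun w hw => h ⟨w, hw⟩
  unfold step
  split_ifs with hA hB
  · exact (x ⟨v, hA⟩).2
  · exact (y ⟨v, hB⟩).2
  · cases ho : Γ.owner v with
    | alice => exact absurd ⟨hv', ho⟩ hA
    | bob => exact absurd ⟨hv', ho⟩ hB

theorem play_succ (x : Γ.StratA) (y : Γ.StratB) (k : ℕ) :
    Γ.play x y (k + 1) = Γ.step x y (Γ.play x y k) := by
  simp [play, Function.iterate_succ_apply']

theorem play_eq_of_mem_VT {x : Γ.StratA} {y : Γ.StratB} {k : ℕ} (hk : Γ.play x y k ∈ Γ.VT)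
    (j : ℕ) : Γ.play x y (k + j) = Γ.play x y k := by
  induction j with
  | zero => rfl
  | succ j ih => rw [← add_assoc, play_succ, ih, Γ.step_of_mem_VT hk]

/-- Every play eventually stays in exactly one non-transient SCC, namely the terminal where it ends
or the SCC that contains the dicycle it repeats. -/
theorem existsUnique_msOutcome [Finite V] (x : Γ.StratA) (y : Γ.StratB) :
    ∃! ω : Γ.MsOutcome, ∀ᶠ k in Filter.atTop, Γ.play x y k ∈ ω.1 := by
  refine existsUnique_of_exists_of_unique ?_ ?_
  · by_cases hT : ∃ k, Γ.play x y k ∈ Γ.VT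
    · obtain ⟨k, hk⟩ := hT
      have hs : Γ.scc (Γ.play x y k) = {Γ.play x y k} := by
        ext w
        constructor
        · rintro ⟨h, -⟩
          rcases Relation.ReflTransGen.cases_head h with h | ⟨c, hc, -⟩
          · exact h.symm
          · exact absurd hc (hk c)
        · rintro rfl
          exact ⟨.refl, .refl⟩
      refine ⟨⟨_, Γ.isSCC_scc (Γ.play x y k), fun h => h.1 ⟨_, hk, hs⟩⟩, ?_⟩
      filter_upwards [Filter.eventually_ge_atTop k] with m hm
      obtain ⟨j, rfl⟩ := Nat.exists_eq_add_of_le hm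
      rw [Γ.play_eq_of_mem_VT hk]
      exact ⟨.refl, .refl⟩
    · have hadj : ∀ k, Γ.Adj (Γ.play x y k) (Γ.play x y (k + 1)) := fun k => by
        rw [play_succ]
        exact Γ.adj_step fun h => hT ⟨k, h⟩
      have hreach : ∀ i j, Relation.ReflTransGen Γ.Adj (Γ.play x y i) (Γ.play x y (i + j)) := by
        intro i j
        induction j with
        | zero => exact .refl
        | succ j ih => exact ih.tail (hadj (i + j))
      obtain ⟨i, j, hij, heq⟩ : ∃ i j, i < j ∧ Γ.play x y i = Γ.play x y j := by
        obtain ⟨i, j, hne, h⟩ := Finite.exists_ne_map_eq_of_infinite (Γ.play x y)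
        rcases lt_or_gt_of_ne hne with h' | h'
        · exact ⟨i, j, h', h⟩
        · exact ⟨j, i, h', h.symm⟩
      obtain ⟨d, rfl⟩ := Nat.exists_eq_add_of_lt hij
      have hper : ∀ t, Γ.play x y (i + d + 1 + t) = Γ.play x y (i + t) := by
        intro t
        induction t with
        | zero => exact heq.symm
        | succ t ih => rw [← add_assoc, play_succ, ih, ← add_assoc, play_succ]
      have hmul : ∀ m, Γ.play x y (i + m * (d + 1)) = Γ.play x y i := by
        intro m
        induction m with
        | zero => simp
        | succ m ih =>
          have e : i + (m + 1) * (d + 1) = i + d + 1 + m * (d + 1) := by ring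
          rw [e, hper, ih]
      have hmem : ∀ j, Γ.play x y (i + j) ∈ Γ.scc (Γ.play x y i) := by
        intro j
        refine ⟨hreach i j, ?_⟩
        have h := hreach (i + j) (j * d)
        have e : i + j + j * d = i + j * (d + 1) := by ring
        rwa [e, hmul] at h
      have hdi : Γ.HasDicycle (Γ.scc (Γ.play x y i)) := by
        refine ⟨_, hmem 0, ?_⟩
        have h1 : Γ.AdjOn (Γ.scc (Γ.play x y i)) (Γ.play x y i) (Γ.play x y (i + 1)) :=
          ⟨hmem 0, hmem 1, hadj i⟩
        exact Relation.TransGen.head' h1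
          ((Γ.isSCC_scc (Γ.play x y i)).1.2 _ (hmem 1) _ (hmem 0))
      refine ⟨⟨_, Γ.isSCC_scc (Γ.play x y i), fun h => h.2 hdi⟩, ?_⟩
      filter_upwards [Filter.eventually_ge_atTop i] with m hm
      obtain ⟨j, rfl⟩ := Nat.exists_eq_add_of_le hm
      exact hmem j
  · intro ω₁ ω₂ h₁ h₂
    obtain ⟨k, hk₁, hk₂⟩ := (h₁.and h₂).exists
    exact Subtype.ext ((ω₁.2.1.eq_scc hk₁).trans (ω₂.2.1.eq_scc hk₂).symm)

/-- The game form of the multi-stage structure: the SCC in which the play ends. -/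
noncomputable def msForm [Finite V] (x : Γ.StratA) (y : Γ.StratB) : Γ.MsOutcome :=
  (Γ.existsUnique_msOutcome x y).choose

end GameStructure

/-! ### Machine model

A random access machine in structured form: registers and arrays hold natural numbers, all
arithmetic is by `+ 1` and `- 1`, arrays are addressed indirectly, and every elementary operation
has unit cost. -/

namespace Ram

structure Memory where
  reg : ℕ → ℕ
  arr : ℕ → ℕ → ℕ

inductive Expr where
  | const (c : ℕ)
  | reg (r : ℕ)
  | read (a : ℕ) (i : Expr)
  | succ (e : Expr)
  | pred (e : Expr)

namespace Expr

def eval (s : Memory) : Expr → ℕ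
  | const c => c
  | reg r => s.reg r
  | read a i => s.arr a (i.eval s)
  | succ e => e.eval s + 1
  | pred e => e.eval s - 1

def cost : Expr → ℕ
  | const _ => 1
  | reg _ => 1
  | read _ i => i.cost + 1
  | succ e => e.cost + 1
  | pred e => e.cost + 1

end Expr

inductive Test where
  | eq (e₁ e₂ : Expr)
  | lt (e₁ e₂ : Expr)
  | neg (b : Test)
  | conj (b₁ b₂ : Test)

namespace Test

def holds (s : Memory) : Test → Prop
  | eq e₁ e₂ => e₁.eval s = e₂.eval s
  | lt e₁ e₂ => e₁.eval s < e₂.eval s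
  | neg b => ¬ b.holds s
  | conj b₁ b₂ => b₁.holds s ∧ b₂.holds s

def cost : Test → ℕ
  | eq e₁ e₂ => e₁.cost + e₂.cost + 1
  | lt e₁ e₂ => e₁.cost + e₂.cost + 1
  | neg b => b.cost + 1
  | conj b₁ b₂ => b₁.cost + b₂.cost + 1

end Test

inductive Prog where
  | skip
  | assign (r : ℕ) (e : Expr)
  | write (a : ℕ) (i e : Expr)
  | seq (p q : Prog)
  | ite (b : Test) (p q : Prog)
  | loop (b : Test) (p : Prog)

/-- `Exec p s s' t`: the program `p`, started in memory `s`, halts in memory `s'` after `t`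
elementary operations. -/
inductive Exec : Prog → Memory → Memory → ℕ → Prop where
  | skip (s) : Exec .skip s s 1
  | assign (s r e) :
      Exec (.assign r e) s ⟨Function.update s.reg r (e.eval s), s.arr⟩ (e.cost + 1)
  | write (s a i e) :
      Exec (.write a i e) s
        ⟨s.reg, Function.update s.arr a (Function.update (s.arr a) (i.eval s) (e.eval s))⟩
        (i.cost + e.cost + 1)
  | seq {p q s₁ s₂ s₃ t₁ t₂} : Exec p s₁ s₂ t₁ → Exec q s₂ s₃ t₂ →
      Exec (.seq p q) s₁ s₃ (t₁ + t₂)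
  | ite_true {b p q s s' t} : b.holds s → Exec p s s' t → Exec (.ite b p q) s s' (b.cost + t)
  | ite_false {b p q s s' t} : ¬ b.holds s → Exec q s s' t → Exec (.ite b p q) s s' (b.cost + t)
  | loop_true {b p s₁ s₂ s₃ t₁ t₂} : b.holds s₁ → Exec p s₁ s₂ t₁ → Exec (.loop b p) s₂ s₃ t₂ →
      Exec (.loop b p) s₁ s₃ (b.cost + t₁ + t₂)
  | loop_false {b p s} : ¬ b.holds s → Exec (.loop b p) s s b.cost

/-- `p`, started in memory `s`, halts after at most `T` elementary operations in a memory that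
satisfies `Q`. -/
def HaltsWithin (p : Prog) (s : Memory) (T : ℕ) (Q : Memory → Prop) : Prop :=
  ∃ s' t, Exec p s s' t ∧ t ≤ T ∧ Q s'

end Ram

/-! ### Input and output of programs on game structures with positions `0, …, n - 1` -/

namespace GameStructure

variable {n : ℕ} (Γ : GameStructure (Fin n))

/-- `l` lists the arcs, each of them once, in any order. -/
def IsArcList (l : List (Fin n × Fin n)) : Prop :=
  l.Nodup ∧ ∀ v w, (v, w) ∈ l ↔ Γ.Adj v w

/-- The number that stands for a player in the input. -/
def playerCode : Player → ℕ
  | .alice => 0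
  | .bob => 1

/-- The memory that holds `Γ`: the registers `0, 1, 2` hold the number of positions, the number of
arcs and the initial position; the arrays `0, 1, 2` hold the owners of the positions and the tails
and heads of the arcs. Register `3` and array `3` hold the additional data `c` and `label`, and all
other cells are zero. -/
def encode (l : List (Fin n × Fin n)) (c : ℕ) (label : Fin n → ℕ) : Ram.Memory where
  reg := fun r => match r with
    | 0 => n
    | 1 => l.length
    | 2 => Γ.init
    | 3 => c
    | _ => 0
  arr := fun a i => match a with
    | 0 => if h : i < n then playerCode (Γ.owner ⟨i, h⟩) else 0
    | 1 => if h : i < l.length then l[i].1 else 0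
    | 2 => if h : i < l.length then l[i].2 else 0
    | 3 => if h : i < n then label ⟨i, h⟩ else 0
    | _ => 0

/-- The input that consists of `Γ` alone. -/
def encodeStructure (l : List (Fin n × Fin n)) : Ram.Memory := Γ.encode l 0 (fun _ => 0)

open Classical in
/-- The input for the `±1` game `(g; ΩA, ΩAᶜ)` of the DGGS `Γ`: register `3` tells whether
`c ∈ ΩA`, and array `3` tells which terminals belong to `ΩA`. -/
noncomputable def encodeDggsGame (l : List (Fin n × Fin n)) (ΩA : Set Γ.DggsOutcome) : Ram.Memory :=
  Γ.encode l (if none ∈ ΩA then 1 else 0)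
    (fun v => if ∃ h : v ∈ Γ.VT, some ⟨v, h⟩ ∈ ΩA then 1 else 0)

open Classical in
/-- The input for the `±1` game `(g; ΩA, ΩAᶜ)` of the multi-stage structure `Γ`: array `3` tells
which positions belong to outcomes in `ΩA`. -/
noncomputable def encodeMsGame (l : List (Fin n × Fin n)) (ΩA : Set Γ.MsOutcome) : Ram.Memory :=
  Γ.encode l 0 (fun v => if ∃ ω ∈ ΩA, v ∈ ω.1 then 1 else 0)

/-- The memory `s` lists the outcomes `V_T ∪ {c}`, each of them once, in array `0`, with their
number in register `0`; the number `n` stands for `c`. -/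
def ListsDggsOutcomes (s : Ram.Memory) : Prop :=
  ∃ f : Fin (s.reg 0) ≃ Γ.DggsOutcome, ∀ i : Fin (s.reg 0),
    s.arr 0 i = (f i).elim n (fun v => (v.1 : ℕ))

/-- The memory `s` lists the outcomes of the multi-stage structure: their number `k` is in register
`0`, they are numbered `1, …, k`, and for each position array `0` holds the number of the
outcome that contains it, or `0` if there is none. -/
def ListsMsOutcomes (s : Ram.Memory) : Prop :=
  ∃ f : Fin (s.reg 0) ≃ Γ.MsOutcome, ∀ v : Fin n,
    (∀ i : Fin (s.reg 0), v ∈ (f i).1 → s.arr 0 v = i + 1) ∧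
    ((∀ ω : Γ.MsOutcome, v ∉ ω.1) → s.arr 0 v = 0)

/-- The memory `s` holds a solution of the `±1` game `(g; ΩA, ΩAᶜ)`: register `0` is `0` if Alice
wins and `1` if Bob wins, and array `0` holds a winning strategy of the winner, as the target of the
chosen move from each position that the winner controls. -/
def HoldsSolution {Ω : Type*} (g : Γ.StratA → Γ.StratB → Ω) (ΩA : Set Ω) (s : Ram.Memory) : Prop :=
  (s.reg 0 = 0 ∧ ∃ x, WinsAlice g ΩA x ∧ ∀ v : Γ.VA, s.arr 0 (v.1 : ℕ) = ((x v).1 : ℕ)) ∨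
  (s.reg 0 = 1 ∧ ∃ y, WinsBob g ΩA y ∧ ∀ v : Γ.VB, s.arr 0 (v.1 : ℕ) = ((y v).1 : ℕ))

end GameStructure

/-! ### Reasoning about programs with a time budget -/

namespace Ram

/-! Both game forms reduce to one kind of labelled game. For DGGS a terminal is labelled by the
player who wins there, and every other position by the player who wins `c`; for MSDGGS the positions
of outcomes in `ΩA` are labelled by Alice and all others by Bob. The labels are constant on strongly
connected components (`dggsLabel_eq`, `msLabel_eq`), and along every play they eventually equal the
winner (`isLabelling_dggs`, `isLabelling_ms`).

A solution is certified locally by `Cert`. The winner's moves keep the play among positions won by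
that player, the loser cannot leave them, and a rank drops at each position labelled by the other
player. If the loser's label occurred from some time on, the rank would decrease forever
(`Cert.eventually_eq`).

Certificates come from backward induction. List the positions so that components are consecutive and
arcs never lead to an earlier component, and process the list from its end. A position still
undecided is given to the player of its label, and each victory is propagated against the arcs, with
a counter of the unrefuted moves at each position. This is sound because an undecided successor of
the declared position `v` is `v` itself or comes before `v` in the list; then it lies in the same
component, and so does everything between them. All declarations until its turn are therefore for
the same player, who will also win the successor. `WonBy` records this promise, `SolveInv.declare`
makes it, and `SolveInv.solved` redeems it.

The list is found by two depth-first searches, the second against the arcs with roots in reverse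
order of the first finishing times (`scc_of_two_searches`). Each search, and the propagation, runs
in linear time since a potential bounded by `3n + m` drops in every round.

The existence of certificates is read off from the correctness of the algorithm (`exists_cert`). It
gives determinacy of all `±1` games, and determinacy gives tightness (`isTight_of_determined`). -/

theorem Test.cost_pos (b : Test) : 0 < b.cost := by
  cases b <;> simp [Test.cost]

namespace Prog

/-- Arrays to which a program may write. -/
def arrs : Prog → List ℕ
  | skip => []
  | assign _ _ => []
  | write a _ _ => [a]
  | seq p q => p.arrs ++ q.arrs
  | ite _ p q => p.arrs ++ q.arrs
  | loop _ p => p.arrs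

/-- Registers that a program may change. -/
def regs : Prog → List ℕ
  | skip => []
  | assign r _ => [r]
  | write _ _ _ => []
  | seq p q => p.regs ++ q.regs
  | ite _ p q => p.regs ++ q.regs
  | loop _ p => p.regs

/-- Programs without loops. -/
def straight : Prog → Bool
  | seq p q => p.straight && q.straight
  | ite _ p q => p.straight && q.straight
  | loop _ _ => false
  | _ => true

/-- A bound for the running time of a program without loops. -/
def bound : Prog → ℕ
  | skip => 1
  | assign _ e => e.cost + 1
  | write _ i e => i.cost + e.cost + 1
  | seq p q => p.bound + q.bound
  | ite b p q => b.cost + (p.bound + q.bound)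
  -- A dummy value, like the effect of a loop in `eval`: both functions are meaningful only for
  -- `straight` programs.
  | loop b _ => b.cost

open Classical in
/-- The effect of a program without loops. -/
noncomputable def eval : Prog → Memory → Memory
  | skip, s => s
  | assign r e, s => ⟨Function.update s.reg r (e.eval s), s.arr⟩
  | write a i e, s =>
      ⟨s.reg, Function.update s.arr a (Function.update (s.arr a) (i.eval s) (e.eval s))⟩
  | seq p q, s => q.eval (p.eval s)
  | ite b p q, s => if b.holds s then p.eval s else q.eval s
  | loop _ _, s => s

theorem exec_eval (p : Prog) (h : p.straight = true) (s : Memory) :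
    ∃ t ≤ p.bound, Exec p s (p.eval s) t := by
  induction p generalizing s with
  | skip => exact ⟨1, le_rfl, .skip s⟩
  | assign r e => exact ⟨_, le_rfl, .assign s r e⟩
  | write a i e => exact ⟨_, le_rfl, .write s a i e⟩
  | seq p q ihp ihq =>
    simp only [straight, Bool.and_eq_true] at h
    obtain ⟨t₁, h₁, e₁⟩ := ihp h.1 s
    obtain ⟨t₂, h₂, e₂⟩ := ihq h.2 (p.eval s)
    exact ⟨_, Nat.add_le_add h₁ h₂, .seq e₁ e₂⟩
  | ite b p q ihp ihq =>
    simp only [straight, Bool.and_eq_true] at h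
    by_cases hb : b.holds s
    · obtain ⟨t₁, h₁, e₁⟩ := ihp h.1 s
      refine ⟨_, ?_, by simpa [eval, hb] using Exec.ite_true hb e₁⟩
      simp only [bound]; omega
    · obtain ⟨t₁, h₁, e₁⟩ := ihq h.2 s
      refine ⟨_, ?_, by simpa [eval, hb] using Exec.ite_false hb e₁⟩
      simp only [bound]; omega
  | loop => simp [straight] at h

end Prog

/-- `s'` agrees with `s` in all cells that `p` cannot change. -/
structure Frame (p : Prog) (s s' : Memory) : Prop where
  arr : ∀ a, a ∉ p.arrs → s'.arr a = s.arr a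
  reg : ∀ r, r ∉ p.regs → s'.reg r = s.reg r

theorem Exec.frame {p : Prog} {s s' : Memory} {t : ℕ} (h : Exec p s s' t) : Frame p s s' := by
  induction h with
  | skip s => exact ⟨fun _ _ => rfl, fun _ _ => rfl⟩
  | assign s r e =>
    refine ⟨fun _ _ => rfl, fun r' hr => ?_⟩
    simp only [Prog.regs, List.mem_singleton] at hr
    simp [Function.update_of_ne hr]
  | write s a i e =>
    refine ⟨fun a' ha => ?_, fun _ _ => rfl⟩
    simp only [Prog.arrs, List.mem_singleton] at ha
    simp [Function.update_of_ne ha]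
  | seq _ _ h₁ h₂ =>
    refine ⟨fun a ha => ?_, fun r hr => ?_⟩
    · simp only [Prog.arrs, List.mem_append, not_or] at ha
      rw [h₂.arr a ha.2, h₁.arr a ha.1]
    · simp only [Prog.regs, List.mem_append, not_or] at hr
      rw [h₂.reg r hr.2, h₁.reg r hr.1]
  | ite_true _ _ h =>
    refine ⟨fun a ha => h.arr a ?_, fun r hr => h.reg r ?_⟩
    · simp only [Prog.arrs, List.mem_append, not_or] at ha; exact ha.1
    · simp only [Prog.regs, List.mem_append, not_or] at hr; exact hr.1
  | ite_false _ _ h =>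
    refine ⟨fun a ha => h.arr a ?_, fun r hr => h.reg r ?_⟩
    · simp only [Prog.arrs, List.mem_append, not_or] at ha; exact ha.2
    · simp only [Prog.regs, List.mem_append, not_or] at hr; exact hr.2
  | loop_true _ _ _ h₁ h₂ =>
    exact ⟨fun a ha => (h₂.arr a ha).trans (h₁.arr a ha),
      fun r hr => (h₂.reg r hr).trans (h₁.reg r hr)⟩
  | loop_false _ => exact ⟨fun _ _ => rfl, fun _ _ => rfl⟩

/-- `p`, started in memory `s` with `T` units of time, halts in a memory `s'` with `r` units left
such that `Q s' r`. -/
def Runs (p : Prog) (Q : Memory → ℕ → Prop) (s : Memory) (T : ℕ) : Prop :=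
  ∃ s' t r, Exec p s s' t ∧ t + r ≤ T ∧ Q s' r

theorem Runs.haltsWithin {p : Prog} {Q : Memory → Prop} {s : Memory} {T : ℕ}
    (h : Runs p (fun s' _ => Q s') s T) : HaltsWithin p s T Q := by
  obtain ⟨s', t, r, he, ht, hQ⟩ := h
  exact ⟨s', t, he, by omega, hQ⟩

theorem Runs.frame {p : Prog} {Q Q' : Memory → ℕ → Prop} {s : Memory} {T : ℕ} (h : Runs p Q s T)
    (hQ : ∀ s' r, Frame p s s' → Q s' r → Q' s' r) : Runs p Q' s T := by
  obtain ⟨s', t, r, he, ht, h'⟩ := h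
  exact ⟨s', t, r, he, ht, hQ s' r he.frame h'⟩

/-- Charging the static bound in place of the actual time turns loop-free code into the evaluation
of a function. -/
theorem Runs.straight {p : Prog} {Q : Memory → ℕ → Prop} {s : Memory} {T : ℕ}
    (hp : p.straight = true) (hT : p.bound ≤ T) (hQ : Q (p.eval s) (T - p.bound)) :
    Runs p Q s T := by
  obtain ⟨t, ht, he⟩ := p.exec_eval hp s
  exact ⟨_, t, T - p.bound, he, by omega, hQ⟩

theorem Runs.seq {p q : Prog} {Q Q' : Memory → ℕ → Prop} {s : Memory} {T : ℕ}
    (h : Runs p Q' s T) (h' : ∀ s' r, Frame p s s' → Q' s' r → Runs q Q s' r) :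
    Runs (.seq p q) Q s T := by
  obtain ⟨s₁, t₁, r₁, e₁, ht₁, hq⟩ := h
  obtain ⟨s₂, t₂, r₂, e₂, ht₂, hQ⟩ := h' s₁ r₁ e₁.frame hq
  exact ⟨s₂, t₁ + t₂, r₂, .seq e₁ e₂, by omega, hQ⟩

/-- Induction on the budget itself: each test costs at least one operation, so an invariant that
mentions the remaining time yields termination and the time bound at once. The frame refers to the
memory `s₀` at the entry of the loop, so cells that the body cannot change need not occur in `I`. -/
theorem Runs.loop {b : Test} {p : Prog} {I Q : Memory → ℕ → Prop} {s₀ : Memory} {T₀ : ℕ}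
    (h : ∀ s T, Frame p s₀ s → I s T → b.cost ≤ T ∧ (b.holds s → Runs p I s (T - b.cost)) ∧
      (¬ b.holds s → Q s (T - b.cost))) (h₀ : I s₀ T₀) : Runs (.loop b p) Q s₀ T₀ := by
  suffices H : ∀ T s, Frame p s₀ s → I s T → Runs (.loop b p) Q s T from
    H T₀ s₀ ⟨fun _ _ => rfl, fun _ _ => rfl⟩ h₀
  intro T
  induction T using Nat.strong_induction_on with
  | _ T ih =>
    intro s hf hI
    obtain ⟨hc, h₁, h₂⟩ := h s T hf hI
    have hpos := b.cost_pos
    by_cases hb : b.holds s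
    · obtain ⟨s₁, t₁, r₁, e₁, ht₁, hI₁⟩ := h₁ hb
      have hf₁ := e₁.frame
      obtain ⟨s₂, t₂, r₂, e₂, ht₂, hQ⟩ := ih r₁ (by omega) s₁
        ⟨fun a ha => (hf₁.arr a ha).trans (hf.arr a ha),
          fun r hr => (hf₁.reg r hr).trans (hf.reg r hr)⟩ hI₁
      exact ⟨s₂, _, r₂, .loop_true hb e₁ e₂, by omega, hQ⟩
    · exact ⟨s, _, _, .loop_false hb, by omega, h₂ hb⟩

end Ram

/-! ### Arc lists as linked lists -/

/-- `i` is one more than the last index `j < k` with `t j = v`, or `0` if there is none. -/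
def lastIdx (t : ℕ → ℕ) (v : ℕ) : ℕ → ℕ
  | 0 => 0
  | k + 1 => if t k = v then k + 1 else lastIdx t v k

theorem lastIdx_le (t : ℕ → ℕ) (v k : ℕ) : lastIdx t v k ≤ k := by
  induction k with
  | zero => simp [lastIdx]
  | succ k ih => simp only [lastIdx]; split_ifs <;> omega

theorem lastIdx_spec (t : ℕ → ℕ) (v k : ℕ) (h : lastIdx t v k ≠ 0) :
    t (lastIdx t v k - 1) = v := by
  induction k with
  | zero => simp [lastIdx] at h
  | succ k ih =>
    simp only [lastIdx] at h ⊢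
    split_ifs at h ⊢ with hk
    · simpa using hk
    · exact ih h

theorem lt_lastIdx {t : ℕ → ℕ} {v k j : ℕ} (hj : j < k) (hv : t j = v) : j < lastIdx t v k := by
  induction k with
  | zero => omega
  | succ k ih =>
    simp only [lastIdx]
    split_ifs with hk
    · exact hj
    · refine ih (lt_of_le_of_ne (Nat.le_of_lt_succ hj) ?_)
      rintro rfl; exact hk hv

/-- The arcs `j < m` that lie before the pointer `P (t j)`: those that a search has not yet used. -/
def undone (m : ℕ) (t P : ℕ → ℕ) : Finset ℕ := (Finset.range m).filter fun j => j < P (t j)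

/-- `P` points into the linked lists of the arcs with equal `t`. -/
def IsPtr (m : ℕ) (t P : ℕ → ℕ) : Prop := ∀ v, P v ≠ 0 → P v ≤ m ∧ t (P v - 1) = v

theorem mem_undone {m : ℕ} {t P : ℕ → ℕ} {j : ℕ} : j ∈ undone m t P ↔ j < m ∧ j < P (t j) := by
  simp [undone]

theorem isPtr_lastIdx (m : ℕ) (t : ℕ → ℕ) : IsPtr m t (fun v => lastIdx t v m) :=
  fun v h => ⟨lastIdx_le t v m, lastIdx_spec t v m h⟩

theorem undone_lastIdx (m : ℕ) (t : ℕ → ℕ) :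
    undone m t (fun v => lastIdx t v m) = Finset.range m := by
  ext j
  simp only [mem_undone, Finset.mem_range]
  exact ⟨fun h => h.1, fun h => ⟨h, lt_lastIdx h rfl⟩⟩

section advance

variable {m : ℕ} {t P N : ℕ → ℕ} {u e : ℕ}

theorem IsPtr.advance (hP : IsPtr m t P) (hN : ∀ j < m, N j = lastIdx t (t j) j)
    (he : P u = e + 1) : IsPtr m t (Function.update P u (N e)) := by
  obtain ⟨hm, ht⟩ := hP u (by omega)
  rw [he] at hm ht
  simp only [Nat.add_sub_cancel] at ht
  intro v hv
  by_cases h : v = u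
  · subst h
    rw [Function.update_self, hN e hm, ht] at *
    exact ⟨(lastIdx_le _ _ _).trans (by omega), lastIdx_spec _ _ _ hv⟩
  · rw [Function.update_of_ne h] at *
    exact hP v hv

/-- Pointers are indices plus one, with `0` for the end of a list. The link of `e` leads to the
preceding arc with the same value of `t`, so following it uses up the arc `e` and no other. Hence
the number of undone arcs can serve to measure time. -/
theorem IsPtr.undone_advance (hP : IsPtr m t P) (hN : ∀ j < m, N j = lastIdx t (t j) j)
    (he : P u = e + 1) : undone m t (Function.update P u (N e)) = (undone m t P).erase e := by
  obtain ⟨hm, ht⟩ := hP u (by omega)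
  rw [he] at hm ht
  simp only [Nat.add_sub_cancel] at ht
  ext j
  simp only [mem_undone, Finset.mem_erase]
  by_cases h : t j = u
  · rw [h, Function.update_self, hN e hm, ht, he]
    constructor
    · rintro ⟨h₁, h₂⟩
      have := lastIdx_le t u e
      exact ⟨by omega, h₁, by omega⟩
    · rintro ⟨h₁, h₂, h₃⟩
      exact ⟨h₂, lt_lastIdx (by omega) h⟩
  · rw [Function.update_of_ne h]
    constructor
    · rintro ⟨h₁, h₂⟩
      refine ⟨?_, h₁, h₂⟩
      rintro rfl; exact h ht
    · rintro ⟨-, h₂⟩; exact h₂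

theorem IsPtr.mem_undone_top (hP : IsPtr m t P) (he : P u = e + 1) :
    e < m ∧ t e = u ∧ e ∈ undone m t P := by
  obtain ⟨hm, ht⟩ := hP u (by omega)
  rw [he] at hm ht
  simp only [Nat.add_sub_cancel] at ht
  exact ⟨hm, ht, mem_undone.2 ⟨hm, by rw [ht, he]; omega⟩⟩

end advance

/-! ### Depth-first search -/

/-- The arcs `src j → tgt j` with `j < m`. -/
def Arc (m : ℕ) (src tgt : ℕ → ℕ) (a b : ℕ) : Prop := ∃ j < m, src j = a ∧ tgt j = b

/-- Reachability along the arcs `src j → tgt j` with `j < m`. -/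
abbrev Reach (m : ℕ) (src tgt : ℕ → ℕ) : ℕ → ℕ → Prop := Relation.ReflTransGen (Arc m src tgt)

/-- `O` enumerates the positions. -/
def Enumerates (n : ℕ) (O : ℕ → ℕ) : Prop :=
  (∀ x < n, O x < n) ∧ ∀ v < n, ∃ x < n, O x = v

/-- The state of a depth-first search: roots are taken from `O`, of which the indices below `i` are
left; `K` holds the number of the search tree, the last of which is `k`; the stack is `S` with height
`sp`, the finished positions are listed in `F`, and `P` points to the next arc of each position;
`st p` is the number of positions finished before `S p` was discovered. -/
structure DfsInv (n m : ℕ) (src tgt O : ℕ → ℕ) (i sp f k : ℕ) (P K S F st : ℕ → ℕ) : Prop where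
  i_le : i ≤ n
  ptr : IsPtr m src P
  ord : ∀ y, i ≤ y → y < n → K (O y) ≠ 0
  S_lt : ∀ p < sp, S p < n
  F_lt : ∀ q < f, F q < n
  S_col : ∀ p < sp, K (S p) = k ∧ k ≠ 0
  F_col : ∀ q < f, K (F q) ≠ 0
  cover : ∀ v < n, K v ≠ 0 → (∃ p < sp, S p = v) ∨ ∃ q < f, F q = v
  K_le : ∀ v < n, K v ≤ k
  S_inj : ∀ p < sp, ∀ q < sp, S p = S q → p = q
  F_inj : ∀ p < f, ∀ q < f, F p = F q → p = q
  S_ne_F : ∀ p < sp, ∀ q < f, S p ≠ F q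
  F_ptr : ∀ q < f, P (F q) = 0
  mono : ∀ j < m, j ∉ undone m src P → K (tgt j) ≠ 0 ∧ K (tgt j) ≤ K (src j)
  S_reach : ∀ p q, p ≤ q → q < sp → Reach m src tgt (S p) (S q)
  st_le : ∀ p < sp, st p ≤ f
  F_reach : ∀ p < sp, ∀ q < f, st p ≤ q → Reach m src tgt (S p) (F q)
  -- Positions finished before the discovery of `S p` have no arcs to what is discovered from then
  -- on. When `S p` is finished, this becomes the second half of `fin`.
  S_arc : ∀ p < sp, ∀ q < st p, ∀ b, Arc m src tgt (F q) b →
    (∃ q < st p, F q = b) ∨ ∃ p' < p, S p' = b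
  -- The intended `s` is the number of positions finished before `F p` was discovered: those with
  -- indices from `s` to `p` are reachable from `F p`, and no arc from an earlier finished position
  -- enters this interval.
  fin : ∀ p < f, ∃ s ≤ p, (∀ q, s ≤ q → q ≤ p → Reach m src tgt (F p) (F q)) ∧
    ∀ q' < s, ∀ q < f, Arc m src tgt (F q') (F q) → q < s ∨ p < q
  -- Roots are tried from the largest index of `O` downwards, so all positions behind the root of
  -- tree `c` lie in trees with smaller numbers.
  root : ∀ c, 1 ≤ c → c ≤ k → ∃ x, i ≤ x ∧ x < n ∧ K (O x) = c ∧
    (∀ y, x < y → y < n → K (O y) < c) ∧ ∀ v < n, K v = c → Reach m src tgt (O x) v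
  F_mono : ∀ p q, p ≤ q → q < f → K (F p) ≤ K (F q)

namespace DfsInv

variable {n m : ℕ} {src tgt O : ℕ → ℕ} {i sp f k : ℕ} {P K S F st : ℕ → ℕ}

theorem initial {P : ℕ → ℕ} (hP : IsPtr m src P) (hu : undone m src P = Finset.range m)
    (S F : ℕ → ℕ) : DfsInv n m src tgt O n 0 0 0 P (fun _ => 0) S F (fun _ => 0) := by
  refine ⟨le_rfl, hP, ?_, ?_, ?_, ?_, ?_, fun v _ h => absurd rfl h, fun v _ => le_rfl, ?_, ?_, ?_,
    ?_, fun j hj h => absurd (by simpa [hu] using hj) h, ?_, ?_, ?_, ?_, ?_, ?_, ?_⟩ <;>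
  · intros; omega

theorem skip (h : DfsInv n m src tgt O i sp f k P K S F st)
    (hK : K (O (i - 1)) ≠ 0) : DfsInv n m src tgt O (i - 1) sp f k P K S F st := by
  refine { h with i_le := (by have := h.i_le; omega), ord := ?_, root := ?_ }
  · intro y hy hn
    by_cases hyi : y = i - 1
    · rwa [hyi]
    · exact h.ord y (by omega) hn
  · intro c hc hk
    obtain ⟨x, hx, h'⟩ := h.root c hc hk
    exact ⟨x, by omega, h'⟩

/-- Common to the discovery of a root and of the target of an arc. The two cases differ in `i'`,
`k'` and the reasons for `hord`, `hreach` and `hroot`. -/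
theorem push (h : DfsInv n m src tgt O i sp f k P K S F st)
    (hA : ∀ j < m, tgt j < n) {i' k' u : ℕ} (hu : u < n) (hK : K u = 0) (hi : i' ≤ n)
    (hk : k ≤ k') (hk0 : k' ≠ 0) (hkk : 0 < sp → k' = k)
    (hord : ∀ y, i' ≤ y → y < n → O y = u ∨ K (O y) ≠ 0)
    (hreach : ∀ p < sp, Reach m src tgt (S p) u)
    (hroot : ∀ c, 1 ≤ c → c ≤ k' → ∃ x, i' ≤ x ∧ x < n ∧ (Function.update K u k') (O x) = c ∧
      (∀ y, x < y → y < n → (Function.update K u k') (O y) < c) ∧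
      ∀ v < n, (Function.update K u k') v = c → Reach m src tgt (O x) v) :
    DfsInv n m src tgt O i' (sp + 1) f k' P (Function.update K u k') (Function.update S sp u) F
      (Function.update st sp f) := by
  have hS : ∀ p < sp, Function.update S sp u p = S p := fun p hp =>
    Function.update_of_ne (by omega) _ _
  have hst : ∀ p < sp, Function.update st sp f p = st p := fun p hp =>
    Function.update_of_ne (by omega) _ _
  have hF : ∀ q < f, F q ≠ u := fun q hq he => h.F_col q hq (he ▸ hK)
  have hSu : ∀ p < sp, S p ≠ u := fun p hp he => (h.S_col p hp).2 (by
    rw [← (h.S_col p hp).1, he, hK])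
  have hKv : ∀ v, v ≠ u → Function.update K u k' v = K v := fun v hv =>
    Function.update_of_ne hv _ _
  have hlt : ∀ p < sp + 1, p < sp ∨ p = sp := fun p hp => by omega
  refine ⟨hi, h.ptr, ?_, ?_, h.F_lt, ?_, ?_, ?_, ?_, ?_, h.F_inj, ?_, h.F_ptr, ?_, ?_, ?_, ?_, ?_,
    h.fin, hroot, ?_⟩
  · intro y hy hn
    by_cases hyu : O y = u
    · rw [hyu, Function.update_self]; exact hk0
    · rw [hKv _ hyu]; exact (hord y hy hn).resolve_left hyu
  · intro p hp
    rcases hlt p hp with hp | rfl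
    · rw [hS p hp]; exact h.S_lt p hp
    · simpa using hu
  · intro p hp
    rcases hlt p hp with hp | rfl
    · rw [hS p hp, hKv _ (hSu p hp), hkk (by omega)]
      exact h.S_col p hp
    · simpa using hk0
  · intro q hq
    rw [hKv _ (hF q hq)]; exact h.F_col q hq
  · intro v hv hKv'
    by_cases hvu : v = u
    · exact .inl ⟨sp, by omega, by simp [hvu]⟩
    · rw [hKv v hvu] at hKv'
      rcases h.cover v hv hKv' with ⟨p, hp, e⟩ | h'
      · exact .inl ⟨p, by omega, by rw [hS p hp, e]⟩
      · exact .inr h'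
  · intro v hv
    by_cases hvu : v = u
    · simp [hvu]
    · rw [hKv v hvu]; exact (h.K_le v hv).trans hk
  · intro p hp q hq e
    rcases hlt p hp with hp | rfl <;> rcases hlt q hq with hq | rfl
    · rw [hS p hp, hS q hq] at e; exact h.S_inj p hp q hq e
    · rw [hS p hp, Function.update_self] at e; exact absurd e (hSu p hp)
    · rw [hS q hq, Function.update_self] at e; exact absurd e.symm (hSu q hq)
    · rfl
  · intro p hp q hq
    rcases hlt p hp with hp | rfl
    · rw [hS p hp]; exact h.S_ne_F p hp q hq
    · rw [Function.update_self]; exact (hF q hq).symm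
  · intro j hj hd
    obtain ⟨h1, h2⟩ := h.mono j hj hd
    have h3 : tgt j ≠ u := by rintro e; rw [e] at h1; exact h1 hK
    rw [hKv _ h3]
    refine ⟨h1, ?_⟩
    by_cases h4 : src j = u
    · rw [h4, Function.update_self]; exact (h.K_le _ (hA j hj)).trans hk
    · rw [hKv _ h4]; exact h2
  · intro p q hpq hq
    rcases hlt q hq with hq | rfl
    · rw [hS p (by omega), hS q hq]; exact h.S_reach p q hpq hq
    · rw [Function.update_self]
      rcases hlt p (by omega) with hp | rfl
      · rw [hS p hp]; exact hreach p hp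
      · rw [Function.update_self]
  · intro p hp
    rcases hlt p hp with hp | rfl
    · rw [hst p hp]; exact h.st_le p hp
    · simp
  · intro p hp q hq hpq
    rcases hlt p hp with hp | rfl
    · rw [hst p hp] at hpq
      rw [hS p hp]; exact h.F_reach p hp q hq hpq
    · rw [Function.update_self] at hpq; omega
  · intro p hp q hq b hb
    rcases hlt p hp with hp | rfl
    · rw [hst p hp] at hq ⊢
      rcases h.S_arc p hp q hq b hb with h' | ⟨p', hp', e⟩
      · exact .inl h'
      · exact .inr ⟨p', hp', by rw [hS p' (by omega), e]⟩
    · rw [Function.update_self] at hq ⊢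
      -- A finished position has used up its arcs, so by `mono` their targets are marked. By `cover`
      -- they are finished or lie on the stack, below the position pushed now.
      obtain ⟨j, hj, e1, e2⟩ := hb
      have hd : j ∉ undone m src P := by
        rw [mem_undone, e1, h.F_ptr q hq]; omega
      have := (h.mono j hj hd).1
      rcases h.cover _ (hA j hj) this with ⟨p', hp', e⟩ | ⟨q', hq', e⟩
      · exact .inr ⟨p', hp', by rw [hS p' hp', e, e2]⟩
      · exact .inl ⟨q', hq', by rw [e, e2]⟩
  · intro p q hpq hq
    rw [hKv _ (hF q hq), hKv _ (hF p (by omega))]; exact h.F_mono p q hpq hq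

theorem push_root (h : DfsInv n m src tgt O i 0 f k P K S F st) (hA : ∀ j < m, tgt j < n)
    (hO : Enumerates n O) (h0 : i ≠ 0) (hK : K (O (i - 1)) = 0) :
    DfsInv n m src tgt O (i - 1) 1 f (k + 1) P (Function.update K (O (i - 1)) (k + 1))
      (Function.update S 0 (O (i - 1))) F (Function.update st 0 f) := by
  have hi := h.i_le
  refine h.push hA (hO.1 _ (by omega)) hK (by omega) (by omega) (by omega) (by omega) ?_
    (by omega) ?_
  · intro y hy hn
    by_cases hyi : y = i - 1
    · exact .inl (by rw [hyi])
    · exact .inr (h.ord y (by omega) hn)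
  · intro c hc hk
    have hne : ∀ y, i ≤ y → y < n → O y ≠ O (i - 1) := fun y hy hn e =>
      h.ord y hy hn (e ▸ hK)
    by_cases hck : c = k + 1
    · subst hck
      refine ⟨i - 1, le_rfl, by omega, by simp, fun y hy hn => ?_, fun v hv hc => ?_⟩
      · rw [Function.update_of_ne (hne y (by omega) hn)]
        have := h.K_le _ (hO.1 y hn); omega
      · by_cases hvu : v = O (i - 1)
        · rw [hvu]
        · rw [Function.update_of_ne hvu] at hc
          have := h.K_le v hv; omega
    · obtain ⟨x, hx, hn, h1, h2, h3⟩ := h.root c hc (by omega)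
      refine ⟨x, by omega, hn, by rw [Function.update_of_ne (hne x hx hn), h1], ?_, ?_⟩
      · intro y hy hn
        rw [Function.update_of_ne (hne y (by omega) hn)]; exact h2 y hy hn
      · intro v hv hc
        by_cases hvu : v = O (i - 1)
        · rw [hvu, Function.update_self] at hc; omega
        · rw [Function.update_of_ne hvu] at hc; exact h3 v hv hc

theorem push_arc (h : DfsInv n m src tgt O i (sp + 1) f k P K S F st) (hA : ∀ j < m, tgt j < n)
    {u : ℕ} (ha : Arc m src tgt (S sp) u) (hK : K u = 0) :
    DfsInv n m src tgt O i (sp + 2) f k P (Function.update K u k)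
      (Function.update S (sp + 1) u) F (Function.update st (sp + 1) f) := by
  have hu : u < n := by obtain ⟨j, hj, -, e⟩ := ha; exact e ▸ hA j hj
  have hsp := h.S_col sp (by omega)
  refine h.push hA hu hK h.i_le le_rfl hsp.2 (by simp) (fun y hy hn => .inr (h.ord y hy hn)) ?_ ?_
  · intro p hp
    exact (h.S_reach p sp (by omega) (by omega)).tail ha
  · intro c hc hk
    obtain ⟨x, hx, hn, h1, h2, h3⟩ := h.root c hc (by omega)
    have hne : ∀ y, x ≤ y → y < n → O y ≠ u := fun y hy hn e =>
      h.ord y (by omega) hn (e ▸ hK)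
    refine ⟨x, by omega, hn, by rw [Function.update_of_ne (hne x le_rfl hn), h1], ?_, ?_⟩
    · intro y hy hn
      rw [Function.update_of_ne (hne y (by omega) hn)]; exact h2 y hy hn
    · intro v hv hc
      by_cases hvu : v = u
      · rw [hvu, Function.update_self] at hc
        rw [hvu]
        exact (h3 _ (h.S_lt sp (by omega)) (hsp.1.trans hc)).tail ha
      · rw [Function.update_of_ne hvu] at hc; exact h3 v hv hc

/-- The target must be marked beforehand because `mono` speaks about every used arc. The tree
numbers cannot violate `mono`: positions on the stack carry `k`, the largest number so far. -/
theorem advance (h : DfsInv n m src tgt O i sp f k P K S F st) {N : ℕ → ℕ}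
    (hN : ∀ j < m, N j = lastIdx src (src j) j) (hA : ∀ j < m, tgt j < n) {p e : ℕ} (hp : p < sp)
    (he : P (S p) = e + 1) (hK : K (tgt e) ≠ 0) :
    DfsInv n m src tgt O i sp f k (Function.update P (S p) (N e)) K S F st := by
  obtain ⟨hm, hsrc, -⟩ := h.ptr.mem_undone_top he
  refine { h with ptr := h.ptr.advance hN he, F_ptr := ?_, mono := ?_ }
  · intro q hq
    rw [Function.update_of_ne (h.S_ne_F p hp q hq).symm]
    exact h.F_ptr q hq
  · intro j hj hd
    rw [h.ptr.undone_advance hN he] at hd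
    by_cases hje : j = e
    · subst hje
      refine ⟨hK, ?_⟩
      rw [hsrc, (h.S_col p hp).1]
      exact h.K_le _ (hA j hj)
    · exact h.mono j hj fun h' => hd (Finset.mem_erase.2 ⟨hje, h'⟩)

/-- The new witness for `fin` is the interval from `st sp` to `f`. Its positions are reachable from
`S sp` by `F_reach`, and `S_arc` excludes arcs into it from positions finished earlier. -/
theorem finish (h : DfsInv n m src tgt O i (sp + 1) f k P K S F st) (hP : P (S sp) = 0) :
    DfsInv n m src tgt O i sp (f + 1) k P K S (Function.update F f (S sp)) st := by
  have hF : ∀ q < f, Function.update F f (S sp) q = F q := fun q hq =>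
    Function.update_of_ne (by omega) _ _
  have hlt : ∀ p < f + 1, p < f ∨ p = f := fun p hp => by omega
  have hsp : sp < sp + 1 := by omega
  have hcol := h.S_col sp hsp
  refine ⟨h.i_le, h.ptr, h.ord, ?_, ?_, ?_, ?_, ?_, h.K_le, ?_, ?_, ?_, ?_, h.mono, ?_, ?_, ?_, ?_,
    ?_, h.root, ?_⟩
  · exact fun p hp => h.S_lt p (by omega)
  · intro q hq
    rcases hlt q hq with hq | rfl
    · rw [hF q hq]; exact h.F_lt q hq
    · rw [Function.update_self]; exact h.S_lt sp hsp
  · exact fun p hp => h.S_col p (by omega)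
  · intro q hq
    rcases hlt q hq with hq | rfl
    · rw [hF q hq]; exact h.F_col q hq
    · rw [Function.update_self, hcol.1]; exact hcol.2
  · intro v hv hK
    rcases h.cover v hv hK with ⟨p, hp, e⟩ | ⟨q, hq, e⟩
    · by_cases hps : p = sp
      · exact .inr ⟨f, by omega, by rw [Function.update_self, ← e, hps]⟩
      · exact .inl ⟨p, by omega, e⟩
    · exact .inr ⟨q, by omega, by rw [hF q hq, e]⟩
  · exact fun p hp q hq => h.S_inj p (by omega) q (by omega)
  · intro p hp q hq e
    rcases hlt p hp with hp | rfl <;> rcases hlt q hq with hq | rfl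
    · rw [hF p hp, hF q hq] at e; exact h.F_inj p hp q hq e
    · rw [hF p hp, Function.update_self] at e; exact absurd e.symm (h.S_ne_F sp hsp p hp)
    · rw [hF q hq, Function.update_self] at e; exact absurd e (h.S_ne_F sp hsp q hq)
    · rfl
  · intro p hp q hq
    rcases hlt q hq with hq | rfl
    · rw [hF q hq]; exact h.S_ne_F p (by omega) q hq
    · rw [Function.update_self]; intro e
      have := h.S_inj p (by omega) sp hsp e; omega
  · intro q hq
    rcases hlt q hq with hq | rfl
    · rw [hF q hq]; exact h.F_ptr q hq
    · rw [Function.update_self]; exact hP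
  · exact fun p q hpq hq => h.S_reach p q hpq (by omega)
  · intro p hp; have := h.st_le p (by omega); omega
  · intro p hp q hq hpq
    rcases hlt q hq with hq | rfl
    · rw [hF q hq]; exact h.F_reach p (by omega) q hq hpq
    · rw [Function.update_self]; exact h.S_reach p sp (by omega) hsp
  · intro p hp q hq b hb
    have hst := h.st_le p (by omega)
    rw [hF q (by omega)] at hb
    rcases h.S_arc p (by omega) q hq b hb with ⟨q', hq', e⟩ | h'
    · exact .inl ⟨q', hq', by rw [hF q' (by omega), e]⟩
    · exact .inr h'
  · intro p hp
    rcases hlt p hp with hp | rfl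
    · obtain ⟨s, hs, h1, h2⟩ := h.fin p hp
      refine ⟨s, hs, fun q hq hqp => ?_, fun q' hq' q hq ha => ?_⟩
      · rw [hF p hp, hF q (by omega)]; exact h1 q hq hqp
      · rcases hlt q hq with hq | rfl
        · rw [hF q' (by omega), hF q hq] at ha; exact h2 q' hq' q hq ha
        · exact .inr hp
    · have hst := h.st_le sp hsp
      refine ⟨st sp, hst, fun q hq hqp => ?_, fun q' hq' q hq ha => ?_⟩
      · rw [Function.update_self]
        rcases hlt q (by omega) with hq' | rfl
        · rw [hF q hq']; exact h.F_reach sp hsp q hq' hq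
        · rw [Function.update_self]
      · rw [hF q' (by omega)] at ha
        left
        rcases h.S_arc sp hsp q' hq' _ ha with ⟨q2, hq2, e⟩ | ⟨p', hp', e⟩
        · rcases hlt q hq with hq | rfl
          · rw [hF q hq] at e
            have := h.F_inj q2 (by omega) q hq e
            omega
          · rw [Function.update_self] at e
            exact absurd e.symm (h.S_ne_F sp hsp q2 (by omega))
        · rcases hlt q hq with hq | rfl
          · rw [hF q hq] at e
            exact absurd e (h.S_ne_F p' (by omega) q hq)
          · rw [Function.update_self] at e
            have := h.S_inj p' (by omega) sp hsp e
            omega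
  · intro p q hpq hq
    rcases hlt q hq with hq | rfl
    · rw [hF q hq, hF p (by omega)]; exact h.F_mono p q hpq hq
    · rw [Function.update_self]
      rcases hlt p (by omega) with hp | rfl
      · rw [hF p hp, hcol.1]; exact h.K_le _ (h.F_lt p hp)
      · rw [Function.update_self]

end DfsInv

/-- What a depth-first search achieves: `K` numbers the search trees and `F` lists the positions in
the order in which they are finished. -/
structure DfsPost (n m : ℕ) (src tgt O K F : ℕ → ℕ) : Prop where
  enum : Enumerates n F
  mono : ∀ a b, Arc m src tgt a b → K b ≤ K a
  fin : ∀ p < n, ∃ s ≤ p, (∀ q, s ≤ q → q ≤ p → Reach m src tgt (F p) (F q)) ∧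
    ∀ q' < s, ∀ q < n, Arc m src tgt (F q') (F q) → q < s ∨ p < q
  root : ∀ v < n, ∃ x < n, K (O x) = K v ∧ (∀ y, x < y → y < n → K (O y) < K v) ∧
    ∀ w < n, K w = K v → Reach m src tgt (O x) w
  F_mono : ∀ p q, p ≤ q → q < n → K (F p) ≤ K (F q)

theorem DfsInv.post {n m : ℕ} {src tgt O : ℕ → ℕ} {f k : ℕ} {P K S F st : ℕ → ℕ}
    (h : DfsInv n m src tgt O 0 0 f k P K S F st) (hO : Enumerates n O)
    (hA : ∀ j < m, src j < n) : DfsPost n m src tgt O K F := by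
  have hK : ∀ v < n, K v ≠ 0 := by
    intro v hv
    obtain ⟨x, hx, rfl⟩ := hO.2 v hv
    exact h.ord x (by omega) hx
  have hc : ∀ v < n, ∃ q < f, F q = v := fun v hv =>
    (h.cover v hv (hK v hv)).resolve_left (by rintro ⟨p, hp, -⟩; omega)
  have hfn : f = n := by
    have : (Finset.range f).image F = Finset.range n := by
      ext v
      simp only [Finset.mem_image, Finset.mem_range]
      exact ⟨by rintro ⟨q, hq, rfl⟩; exact h.F_lt q hq, hc v⟩
    have h2 := congrArg Finset.card this
    rwa [Finset.card_image_of_injOn, Finset.card_range, Finset.card_range] at h2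
    intro p hp q hq
    exact h.F_inj p (by simpa using hp) q (by simpa using hq)
  subst hfn
  refine ⟨⟨h.F_lt, hc⟩, ?_, h.fin, ?_, h.F_mono⟩
  · rintro a b ⟨j, hj, rfl, rfl⟩
    refine (h.mono j hj ?_).2
    obtain ⟨q, hq, e⟩ := hc _ (hA j hj)
    rw [mem_undone, ← e, h.F_ptr q hq]; omega
  · intro v hv
    obtain ⟨x, -, hx, h1⟩ := h.root (K v) (Nat.one_le_iff_ne_zero.2 (hK v hv)) (h.K_le v hv)
    exact ⟨x, hx, h1⟩

/-- Number of positions not yet marked. -/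
def unmarked (n : ℕ) (K : ℕ → ℕ) : ℕ := ((Finset.range n).filter fun v => K v = 0).card

theorem unmarked_le (n : ℕ) (K : ℕ → ℕ) : unmarked n K ≤ n :=
  (Finset.card_filter_le _ _).trans_eq (Finset.card_range n)

theorem unmarked_update {n : ℕ} {K : ℕ → ℕ} {u k : ℕ} (hu : u < n) (hK : K u = 0) (hk : k ≠ 0) :
    unmarked n (Function.update K u k) + 1 = unmarked n K := by
  have h : ((Finset.range n).filter fun v => Function.update K u k v = 0) =
      ((Finset.range n).filter fun v => K v = 0).erase u := by
    ext v
    by_cases hv : v = u <;> simp [hv, hk]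
  rw [unmarked, h, Finset.card_erase_add_one (by simp [hu, hK]), unmarked]

/-! ### Depth-first search as a program -/

namespace Ram

/-- Body of the depth-first search: arrays `d, …, d + 6` hold the order of the roots, the pointers,
the links, the targets, the tree numbers, the stack and the list of finished positions. -/
def dfsBody (d : ℕ) : Prog :=
  .ite (.eq (.reg 11) (.const 0))
    (.seq (.assign 10 (.pred (.reg 10)))
    (.seq (.assign 14 (.read d (.reg 10)))
      (.ite (.eq (.read (d + 4) (.reg 14)) (.const 0))
        (.seq (.assign 13 (.succ (.reg 13)))
        (.seq (.write (d + 4) (.reg 14) (.reg 13))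
        (.seq (.write (d + 5) (.reg 11) (.reg 14))
          (.assign 11 (.succ (.reg 11))))))
        .skip)))
    (.seq (.assign 14 (.read (d + 5) (.pred (.reg 11))))
    (.seq (.assign 15 (.read (d + 1) (.reg 14)))
      (.ite (.eq (.reg 15) (.const 0))
        (.seq (.assign 11 (.pred (.reg 11)))
        (.seq (.write (d + 6) (.reg 12) (.reg 14))
          (.assign 12 (.succ (.reg 12)))))
        (.seq (.assign 15 (.pred (.reg 15)))
        (.seq (.write (d + 1) (.reg 14) (.read (d + 2) (.reg 15)))
        (.seq (.assign 14 (.read (d + 3) (.reg 15)))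
          (.ite (.eq (.read (d + 4) (.reg 14)) (.const 0))
            (.seq (.write (d + 4) (.reg 14) (.reg 13))
            (.seq (.write (d + 5) (.reg 11) (.reg 14))
              (.assign 11 (.succ (.reg 11)))))
            .skip)))))))

/-- The search is not over. -/
def searchTest : Test := .neg (.conj (.eq (.reg 11) (.const 0)) (.eq (.reg 10) (.const 0)))

def dfs (d : ℕ) : Prog :=
  .seq (.seq (.assign 10 (.reg 0)) (.seq (.assign 11 (.const 0))
      (.seq (.assign 12 (.const 0)) (.assign 13 (.const 0)))))
    (.loop searchTest (dfsBody d))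

/-- The potential counts roots not yet tried, stack height, unused arcs and, twice, unmarked
positions. A round tries a root, pops, or uses an arc, which lowers one of the first three; a push
is more than paid for by the position it marks. -/
theorem runs_dfsBody {d n m : ℕ} {src tgt O N st : ℕ → ℕ} {s : Memory}
    (hA : ∀ j < m, tgt j < n)
    (hO : Enumerates n O) (hN : ∀ j < m, N j = lastIdx src (src j) j) (hsO : s.arr d = O)
    (hsN : s.arr (d + 2) = N) (hsT : ∀ j < m, s.arr (d + 3) j = tgt j)
    (h : DfsInv n m src tgt O (s.reg 10) (s.reg 11) (s.reg 12) (s.reg 13) (s.arr (d + 1))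
      (s.arr (d + 4)) (s.arr (d + 5)) (s.arr (d + 6)) st) (hb : searchTest.holds s) :
    ∃ st', DfsInv n m src tgt O (((dfsBody d).eval s).reg 10) (((dfsBody d).eval s).reg 11)
      (((dfsBody d).eval s).reg 12) (((dfsBody d).eval s).reg 13) (((dfsBody d).eval s).arr (d + 1))
      (((dfsBody d).eval s).arr (d + 4)) (((dfsBody d).eval s).arr (d + 5))
      (((dfsBody d).eval s).arr (d + 6)) st' ∧
      2 * unmarked n (((dfsBody d).eval s).arr (d + 4)) + ((dfsBody d).eval s).reg 10 +
        ((dfsBody d).eval s).reg 11 + (undone m src (((dfsBody d).eval s).arr (d + 1))).card + 1 ≤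
      2 * unmarked n (s.arr (d + 4)) + s.reg 10 + s.reg 11 +
        (undone m src (s.arr (d + 1))).card := by
  have hi := h.i_le
  by_cases h1 : s.reg 11 = 0
  · have h0 : s.reg 10 ≠ 0 := by
      simpa [searchTest, Test.holds, Expr.eval, h1] using hb
    have hlt : O (s.reg 10 - 1) < n := hO.1 _ (by omega)
    by_cases h2 : s.arr (d + 4) (O (s.reg 10 - 1)) = 0
    · rw [h1] at h
      refine ⟨Function.update st 0 (s.reg 12), ?_, ?_⟩
      · simpa [dfsBody, Prog.eval, Test.holds, Expr.eval, h1, h2, hsO] using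
          h.push_root hA hO h0 h2
      · have := unmarked_update (k := s.reg 13 + 1) hlt h2 (by omega)
        simp [dfsBody, Prog.eval, Test.holds, Expr.eval, h1, h2, hsO]
        omega
    · refine ⟨st, ?_, ?_⟩
      · simpa [dfsBody, Prog.eval, Test.holds, Expr.eval, h1, h2, hsO] using h.skip h2
      · simp [dfsBody, Prog.eval, Test.holds, Expr.eval, h1, h2, hsO]
        omega
  · obtain ⟨sp, hsp⟩ := Nat.exists_eq_succ_of_ne_zero h1
    simp only [Nat.succ_eq_add_one] at hsp
    rw [hsp] at h
    by_cases h2 : s.arr (d + 1) (s.arr (d + 5) sp) = 0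
    · refine ⟨st, ?_, ?_⟩
      · simpa [dfsBody, Prog.eval, Test.holds, Expr.eval, hsp, h2] using h.finish h2
      · simp [dfsBody, Prog.eval, Test.holds, Expr.eval, hsp, h2]
    · obtain ⟨e, he⟩ := Nat.exists_eq_succ_of_ne_zero h2
      simp only [Nat.succ_eq_add_one] at he
      obtain ⟨hm, hsrc, hu⟩ := h.ptr.mem_undone_top he
      have hcard := Finset.card_erase_add_one hu
      rw [← h.ptr.undone_advance hN he] at hcard
      by_cases h3 : s.arr (d + 4) (tgt e) = 0
      · have hp := h.push_arc hA ⟨e, hm, hsrc, rfl⟩ h3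
        have hk := (h.S_col sp (by omega)).2
        have hS : Function.update (s.arr (d + 5)) (sp + 1) (tgt e) sp = s.arr (d + 5) sp :=
          Function.update_of_ne (by omega) _ _
        have ha := hp.advance hN hA (p := sp) (e := e) (by omega) (by rw [hS, he])
          (by simpa using hk)
        rw [hS] at ha
        refine ⟨Function.update st (sp + 1) (s.reg 12), ?_, ?_⟩
        · simpa [dfsBody, Prog.eval, Test.holds, Expr.eval, hsp, he, h3, hsN, hsT e hm] using ha
        · have := unmarked_update (k := s.reg 13) (hA e hm) h3 hk
          simp [dfsBody, Prog.eval, Test.holds, Expr.eval, hsp, he, h3, hsN, hsT e hm]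
          omega
      · refine ⟨st, ?_, ?_⟩
        · simpa [dfsBody, Prog.eval, Test.holds, Expr.eval, hsp, he, h3, hsN, hsT e hm] using
            h.advance hN hA (by omega) he h3
        · simp [dfsBody, Prog.eval, Test.holds, Expr.eval, hsp, he, h3, hsN, hsT e hm]
          omega

/-- Each unit of the potential carries 100 operations, enough for one test (8) and one execution of
the body (at most 80). The potential starts at no more than `3 * n + m`, and `B` is the time
reserved for the programs that follow. -/
theorem runs_dfs {d n m : ℕ} {src tgt O N : ℕ → ℕ} {s : Memory} {T B : ℕ}
    (hn : s.reg 0 = n) (hA : ∀ j < m, src j < n ∧ tgt j < n)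
    (hO : Enumerates n O) (hN : ∀ j < m, N j = lastIdx src (src j) j) (hsO : s.arr d = O)
    (hsP : s.arr (d + 1) = fun v => lastIdx src v m) (hsN : s.arr (d + 2) = N)
    (hsT : ∀ j < m, s.arr (d + 3) j = tgt j) (hsK : s.arr (d + 4) = fun _ => 0)
    (hT : B + 100 * (3 * n + m) + 100 ≤ T) :
    Runs (dfs d) (fun s' r => DfsPost n m src tgt O (s'.arr (d + 4)) (s'.arr (d + 6)) ∧ B ≤ r)
      s T := by
  refine Runs.seq (Q' := fun s' r => (s'.reg 10 = n ∧ s'.reg 11 = 0 ∧ s'.reg 12 = 0 ∧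
    s'.reg 13 = 0) ∧ B + 100 * (3 * n + m) + 50 ≤ r) ?_ ?_
  · refine Runs.straight rfl ?_ ⟨?_, ?_⟩
    · simp [Prog.bound, Expr.cost]; omega
    · simp [Prog.eval, Expr.eval, hn]
    · simp [Prog.bound, Expr.cost]; omega
  rintro s₁ r₁ hf₁ ⟨⟨h10, h11, h12, h13⟩, hr₁⟩
  have harr : ∀ a, s₁.arr a = s.arr a := fun a => hf₁.arr a (by simp [Prog.arrs])
  rw [← harr] at hsO hsP hsN hsT hsK
  refine Runs.loop (I := fun s' r => (∃ st, DfsInv n m src tgt O (s'.reg 10) (s'.reg 11) (s'.reg 12)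
    (s'.reg 13) (s'.arr (d + 1)) (s'.arr (d + 4)) (s'.arr (d + 5)) (s'.arr (d + 6)) st) ∧
    B + 100 * (2 * unmarked n (s'.arr (d + 4)) + s'.reg 10 +
        s'.reg 11 + (undone m src (s'.arr (d + 1))).card) + 50 ≤ r) ?_ ?_
  · rintro s' r hf ⟨⟨st, h⟩, hr⟩
    have hc : searchTest.cost = 8 := rfl
    refine ⟨by omega, fun hb => ?_, fun hb => ?_⟩
    · have hbd : (dfsBody d).bound ≤ 80 := by simp [dfsBody, Prog.bound, Expr.cost, Test.cost]
      obtain ⟨st', h', hΦ⟩ := runs_dfsBody (fun j hj => (hA j hj).2) hO hN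
        ((hf.arr d (by simp [Prog.arrs, dfsBody])).trans hsO)
        ((hf.arr (d + 2) (by simp [Prog.arrs, dfsBody])).trans hsN)
        (by rwa [hf.arr (d + 3) (by simp [Prog.arrs, dfsBody])]) h hb
      exact Runs.straight rfl (by omega) ⟨⟨st', h'⟩, by omega⟩
    · have hb' : s'.reg 11 = 0 ∧ s'.reg 10 = 0 := by
        simpa [searchTest, Test.holds, Expr.eval] using hb
      rw [hb'.1, hb'.2] at h
      exact ⟨h.post hO fun j hj => (hA j hj).1, by omega⟩
  · rw [h10, h11, h12, h13, hsP, hsK, undone_lastIdx, Finset.card_range]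
    refine ⟨⟨_, DfsInv.initial (isPtr_lastIdx m src) (undone_lastIdx m src) _ _⟩, ?_⟩
    have := unmarked_le n (fun _ => 0)
    omega

end Ram

/-! ### Strongly connected components by two searches -/

theorem DfsPost.col_le {n m : ℕ} {src tgt O K F : ℕ → ℕ} (h : DfsPost n m src tgt O K F) {a b : ℕ}
    (hab : Reach m src tgt a b) : K b ≤ K a := by
  induction hab with
  | refl => exact le_rfl
  | tail _ h' ih => exact (h.mono _ _ h').trans ih

theorem Arc.swap {m : ℕ} {src tgt : ℕ → ℕ} {a b : ℕ} (h : Arc m src tgt a b) : Arc m tgt src b a :=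
  let ⟨j, hj, h1, h2⟩ := h
  ⟨j, hj, h2, h1⟩

theorem Reach.swap {m : ℕ} {src tgt : ℕ → ℕ} {a b : ℕ} (h : Reach m src tgt a b) :
    Reach m tgt src b a := by
  induction h with
  | refl => exact .refl
  | tail _ h' ih => exact .head h'.swap ih

/-- A path all of whose positions are finished no later than its last position `F p` consists of
positions reachable from `F p`. -/
theorem DfsPost.reach_of_path {n m : ℕ} {src tgt O K F : ℕ → ℕ} (h : DfsPost n m src tgt O K F)
    {p a : ℕ} (hp : p < n) (C : ℕ → Prop) (hC : ∀ v, C v → ∃ q ≤ p, F q = v)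
    (hpath : Relation.ReflTransGen (fun a b => C a ∧ Arc m src tgt a b) a (F p)) :
    Reach m src tgt (F p) a := by
  obtain ⟨s, hs, h1, h2⟩ := h.fin p hp
  -- Followed backwards from `F p`, the path stays in the interval from `s` to `p`: it cannot pass
  -- `p` by `hC`, and no arc enters the interval from a position finished before `s`.
  suffices H : ∃ q, s ≤ q ∧ q ≤ p ∧ F q = a by
    obtain ⟨q, hq, hqp, rfl⟩ := H
    exact h1 q hq hqp
  induction hpath using Relation.ReflTransGen.head_induction_on with
  | refl => exact ⟨p, hs, le_rfl, rfl⟩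
  | head hab _ ih =>
    obtain ⟨q, hq, hqp, rfl⟩ := ih
    obtain ⟨q', hq', rfl⟩ := hC _ hab.1
    refine ⟨q', ?_, hq', rfl⟩
    by_contra hlt
    have := h2 q' (by omega) q (by omega) hab.2
    omega

/-- Let `F x` be the root of a tree of the second search, which follows the arcs backwards. Each `w`
in that tree reaches `F x` along the arcs. Tree numbers do not increase along backward arcs, so all
positions on the path have numbers at least that of `w`. Positions finished after `F x` in the first
search have smaller numbers, so the path consists of positions finished no later than `F x`, and
`DfsPost.reach_of_path` gives a way back from `F x` to `w`. Conversely, mutually reachable positions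
have equal numbers by monotonicity. -/
theorem scc_of_two_searches {n m : ℕ} {src tgt O K F K' F' : ℕ → ℕ}
    (h : DfsPost n m src tgt O K F) (h' : DfsPost n m tgt src F K' F') {v w : ℕ} (hv : v < n)
    (hw : w < n) (hA : ∀ j < m, src j < n ∧ tgt j < n) :
    K' v = K' w ↔ Reach m src tgt v w ∧ Reach m src tgt w v := by
  constructor
  · obtain ⟨x, hx, hxv, hmax, hr⟩ := h'.root v hv
    have key : ∀ w < n, K' w = K' v → Reach m src tgt w (F x) ∧ Reach m src tgt (F x) w := by
      intro w hw hwv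
      have hxw := hr w hw hwv
      refine ⟨hxw.swap, ?_⟩
      have hup : Relation.ReflTransGen
          (fun a b => (a < n ∧ K' v ≤ K' a) ∧ Arc m src tgt a b) w (F x) := by
        have hle : ∀ a, Reach m tgt src (F x) a → Reach m tgt src a w →
            Relation.ReflTransGen
              (fun a b => (a < n ∧ K' v ≤ K' a) ∧ Arc m src tgt a b) a (F x) := by
          intro a ha
          induction ha with
          | refl => intro _; exact .refl
          | tail _ hbc ih =>
            intro hc
            refine .head ⟨⟨?_, ?_⟩, hbc.swap⟩ (ih (.head hbc hc))
            · obtain ⟨j, hj, -, rfl⟩ := hbc; exact (hA j hj).1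
            · rw [← hwv]; exact h'.col_le hc
        exact hle w hxw .refl
      refine h.reach_of_path hx (fun a => a < n ∧ K' v ≤ K' a) ?_ hup
      rintro a ⟨ha, hKa⟩
      obtain ⟨q, hq, rfl⟩ := h.enum.2 a ha
      refine ⟨q, ?_, rfl⟩
      by_contra hlt
      have := hmax q (by omega) hq
      omega
    intro e
    have h1 := key v hv rfl
    have h2 := key w hw e.symm
    exact ⟨h1.1.trans h2.2, h2.1.trans h1.2⟩
  · rintro ⟨h1, h2⟩
    exact le_antisymm (h'.col_le h1.swap) (h'.col_le h2.swap)

/-! ### Linking the arcs and computing the components -/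

namespace Ram

/-- `for` loop with counter in register `16` and the number of rounds in register `b`. -/
def forLoop (b : ℕ) (p : Prog) : Prog :=
  .seq (.assign 16 (.const 0))
    (.loop (.lt (.reg 16) (.reg b)) (.seq p (.assign 16 (.succ (.reg 16)))))

/-- Since the body is loop-free, a step of the invariant is a statement about `eval`. The extra 10
operations per round pay for the test and the increment of the counter. -/
theorem runs_forLoop {b : ℕ} {p : Prog} (I : ℕ → Memory → Prop) (c : ℕ) {N B T : ℕ} {s : Memory}
    (hN : s.reg b = N) (hp : p.straight = true) (hb : b ∉ 16 :: p.regs) (h16 : 16 ∉ p.regs)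
    (hc : p.bound ≤ c) (h0 : I 0 ⟨Function.update s.reg 16 0, s.arr⟩)
    (hI : ∀ i < N, ∀ s', Frame (forLoop b p) s s' → s'.reg 16 = i → I i s' →
      I (i + 1) ⟨Function.update (p.eval s').reg 16 (i + 1), (p.eval s').arr⟩)
    (hT : B + (c + 10) * N + 10 ≤ T) :
    Runs (forLoop b p) (fun s' r => I N s' ∧ B ≤ r) s T := by
  simp only [List.mem_cons, not_or] at hb
  refine Runs.seq (Q' := fun s' r => (s'.reg 16 = 0 ∧ I 0 s') ∧ B + (c + 10) * N + 5 ≤ r) ?_ ?_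
  · refine Runs.straight rfl ?_ ⟨⟨by simp [Prog.eval, Expr.eval], h0⟩, ?_⟩
    · simp [Prog.bound, Expr.cost]; omega
    · simp [Prog.bound, Expr.cost]; omega
  rintro s₁ r₁ hf₁ ⟨⟨h16', h0'⟩, hr₁⟩
  have hN₁ : s₁.reg b = N := (hf₁.reg b (by simpa [Prog.regs] using hb.1)).trans hN
  refine Runs.loop (I := fun s' r => (s'.reg 16 ≤ N ∧ I (s'.reg 16) s') ∧
    B + (c + 10) * (N - s'.reg 16) + 5 ≤ r) ?_ ?_
  · rintro s' r hf ⟨⟨hle, h⟩, hr⟩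
    have hN' : s'.reg b = N := (hf.reg b (by simp [Prog.regs, hb])).trans hN₁
    have hcost : (Test.lt (.reg 16) (.reg b)).cost = 3 := rfl
    refine ⟨by omega, fun ht => ?_, fun ht => ?_⟩
    · have hlt : s'.reg 16 < N := by simpa [Test.holds, Expr.eval, hN'] using ht
      have hmul : (c + 10) * (N - s'.reg 16) = (c + 10) * (N - (s'.reg 16 + 1)) + (c + 10) := by
        rw [← Nat.mul_succ]; congr 1; omega
      obtain ⟨t, -, he⟩ := p.exec_eval hp s'
      have h16e : (p.eval s').reg 16 = s'.reg 16 := he.frame.reg 16 h16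
      have hfr : Frame (forLoop b p) s s' :=
        ⟨fun a ha => by
          simp only [forLoop, Prog.arrs, List.mem_append, not_or] at ha
          rw [hf.arr a (by simpa [Prog.arrs] using ha.2), hf₁.arr a (by simp [Prog.arrs])],
        fun q hq => by
          simp only [forLoop, Prog.regs, List.mem_append, not_or] at hq
          rw [hf.reg q (by simpa [Prog.regs] using hq.2), hf₁.reg q (by simpa [Prog.regs] using hq.1)]⟩
      have := hI _ hlt s' hfr rfl h
      refine Runs.straight (by simp [Prog.straight, hp]) ?_ ⟨?_, ?_⟩
      · simp [Prog.bound, Expr.cost]; omega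
      · simp only [Prog.eval, Expr.eval, h16e, Function.update_self]
        exact ⟨hlt, this⟩
      · simp only [Prog.eval, Expr.eval, h16e, Function.update_self, Prog.bound, Expr.cost]
        omega
    · have : s'.reg 16 = N := by
        have : ¬ s'.reg 16 < N := by simpa [Test.holds, Expr.eval, hN'] using ht
        omega
      rw [this] at h
      exact ⟨h, by omega⟩
  · refine ⟨⟨by omega, ?_⟩, ?_⟩
    · rwa [h16']
    · rw [h16']; simpa using hr₁

/-- Linking of the arcs: forward lists in the arrays `11, 12, 13`, backward lists in `17, 18, 19`, a
second copy of the heads of the backward lists in `23`, out-degrees in `25`, and some target of an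
arc from each position in `27`. -/
def linkBody : Prog :=
  .seq (.write 12 (.reg 16) (.read 11 (.read 1 (.reg 16))))
  (.seq (.write 11 (.read 1 (.reg 16)) (.succ (.reg 16)))
  (.seq (.write 13 (.reg 16) (.read 2 (.reg 16)))
  (.seq (.write 18 (.reg 16) (.read 17 (.read 2 (.reg 16))))
  (.seq (.write 17 (.read 2 (.reg 16)) (.succ (.reg 16)))
  (.seq (.write 19 (.reg 16) (.read 1 (.reg 16)))
  (.seq (.write 23 (.read 2 (.reg 16)) (.succ (.reg 16)))
  (.seq (.write 25 (.read 1 (.reg 16)) (.succ (.read 25 (.read 1 (.reg 16)))))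
    (.write 27 (.read 1 (.reg 16)) (.read 2 (.reg 16))))))))))

/-- The backward pointers are needed twice: the second search consumes those in array `17`, the
backward induction those in array `23`, while the links in array `18` are only read. The moves in
array `27` are arbitrary legal defaults, and the out-degrees are the initial counters of unrefuted
moves. -/
structure Linked (src tgt : ℕ → ℕ) (m : ℕ) (s : Memory) : Prop where
  fwd : s.arr 11 = fun v => lastIdx src v m
  fwd_next : ∀ j < m, s.arr 12 j = lastIdx src (src j) j
  fwd_tgt : ∀ j < m, s.arr 13 j = tgt j
  bwd : s.arr 17 = fun v => lastIdx tgt v m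
  bwd_next : ∀ j < m, s.arr 18 j = lastIdx tgt (tgt j) j
  bwd_tgt : ∀ j < m, s.arr 19 j = src j
  bwd' : s.arr 23 = fun v => lastIdx tgt v m
  deg : ∀ v, s.arr 25 v = ((Finset.range m).filter fun j => src j = v).card
  move : ∀ j < m, Arc m src tgt (src j) (s.arr 27 (src j))

theorem lastIdx_succ (t : ℕ → ℕ) (k : ℕ) :
    (fun v => lastIdx t v (k + 1)) = Function.update (fun v => lastIdx t v k) (t k) (k + 1) := by
  ext v
  simp only [lastIdx, Function.update_apply, eq_comm]

theorem runs_link {m : ℕ} {s : Memory} {T B : ℕ} (hm : s.reg 1 = m)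
    (hz : ∀ a, 4 ≤ a → s.arr a = fun _ => 0) (hT : B + 100 * m + 10 ≤ T) :
    Runs (forLoop 1 linkBody) (fun s' r => Linked (s.arr 1) (s.arr 2) m s' ∧ B ≤ r) s T := by
  have hbd : linkBody.bound ≤ 60 := by simp [linkBody, Prog.bound, Expr.cost]
  refine runs_forLoop (Linked (s.arr 1) (s.arr 2)) 60 hm rfl (by decide) (by decide) hbd ?_ ?_
    (by omega)
  · constructor <;> simp [hz, lastIdx]
  · intro i hi s' hf h16 h
    have h1 : s'.arr 1 = s.arr 1 := hf.arr 1 (by decide)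
    have h2 : s'.arr 2 = s.arr 2 := hf.arr 2 (by decide)
    obtain ⟨a1, a2, a3, a4, a5, a6, a7, a8, a9⟩ := h
    have hlt : ∀ j < i + 1, j = i ∨ j < i ∧ j ≠ i := fun j hj => by omega
    constructor
    · simp [linkBody, Prog.eval, Expr.eval, h16, h1, h2, a1, lastIdx_succ]
    · intro j hj
      rcases hlt j hj with rfl | ⟨hj, hne⟩
      · simp [linkBody, Prog.eval, Expr.eval, h16, h1, a1]
      · simp [linkBody, Prog.eval, Expr.eval, h16, h1, hne, a2 j hj]
    · intro j hj
      rcases hlt j hj with rfl | ⟨hj, hne⟩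
      · simp [linkBody, Prog.eval, Expr.eval, h16, h2]
      · simp [linkBody, Prog.eval, Expr.eval, h16, hne, a3 j hj]
    · simp [linkBody, Prog.eval, Expr.eval, h16, h1, h2, a4, lastIdx_succ]
    · intro j hj
      rcases hlt j hj with rfl | ⟨hj, hne⟩
      · simp [linkBody, Prog.eval, Expr.eval, h16, h2, a4]
      · simp [linkBody, Prog.eval, Expr.eval, h16, h2, hne, a5 j hj]
    · intro j hj
      rcases hlt j hj with rfl | ⟨hj, hne⟩
      · simp [linkBody, Prog.eval, Expr.eval, h16, h1]
      · simp [linkBody, Prog.eval, Expr.eval, h16, hne, a6 j hj]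
    · simp [linkBody, Prog.eval, Expr.eval, h16, h1, h2, a7, lastIdx_succ]
    · intro v
      rw [Finset.range_add_one, Finset.filter_insert]
      by_cases hv : s.arr 1 i = v
      · subst hv
        simp [linkBody, Prog.eval, Expr.eval, h16, h1, a8]
      · simp [linkBody, Prog.eval, Expr.eval, h16, h1, hv, a8, Function.update_of_ne (Ne.symm hv)]
    · intro j hj
      by_cases hv : s.arr 1 j = s.arr 1 i
      · refine ⟨i, by omega, hv.symm, ?_⟩
        simp [linkBody, Prog.eval, Expr.eval, h16, h1, h2, hv]
      · have hj' : j < i := by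
          rcases hlt j hj with rfl | h
          · exact absurd rfl hv
          · exact h.1
        obtain ⟨j', hj', e1, e2⟩ := a9 j hj'
        refine ⟨j', by omega, e1, ?_⟩
        simp [linkBody, Prog.eval, Expr.eval, h16, h1, h2, hv, e2]

/-- Computes in array `20` the numbers of the strongly connected components, and in array `22` a list
of the positions that is sorted by these numbers. -/
def sccProg : Prog :=
  .seq (forLoop 1 linkBody) (.seq (forLoop 0 (.write 10 (.reg 16) (.reg 16)))
    (.seq (dfs 10) (dfs 16)))

/-- Outcome of `sccProg`. -/
structure SccPost (n m : ℕ) (src tgt K F : ℕ → ℕ) : Prop where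
  enum : Enumerates n F
  eq_iff : ∀ v < n, ∀ w < n, K v = K w ↔ Reach m src tgt v w ∧ Reach m src tgt w v
  mono : ∀ a b, Arc m src tgt a b → K a ≤ K b
  F_mono : ∀ p q, p ≤ q → q < n → K (F p) ≤ K (F q)

theorem runs_sccProg {n m : ℕ} {s : Memory} {T B : ℕ} (hn : s.reg 0 = n) (hm : s.reg 1 = m)
    (hz : ∀ a, 4 ≤ a → s.arr a = fun _ => 0)
    (hA : ∀ j < m, s.arr 1 j < n ∧ s.arr 2 j < n) (hT : B + 1000 * (n + m) + 1000 ≤ T) :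
    Runs sccProg (fun s' r => (SccPost n m (s.arr 1) (s.arr 2) (s'.arr 20) (s'.arr 22) ∧
      (∃ s₁, Linked (s.arr 1) (s.arr 2) m s₁ ∧ ∀ a ∈ [18, 23, 25, 27], s'.arr a = s₁.arr a)) ∧
      B ≤ r) s T := by
  refine Runs.seq (runs_link (B := B + 900 * (n + m) + 900) hm hz (by omega)) ?_
  rintro s₁ r₁ hf₁ ⟨h₁, hr₁⟩
  refine Runs.seq (runs_forLoop (fun i s' => ∀ v < i, s'.arr 10 v = v) 20
    (B := B + 800 * (n + m) + 800) ((hf₁.reg 0 (by decide)).trans hn) rfl (by decide) (by decide)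
    (by simp [Prog.bound, Expr.cost]) (by simp) ?_ (by omega)) ?_
  · intro i _ s' _ h16 h v hv
    by_cases hvi : v = i
    · simp [Prog.eval, Expr.eval, h16, hvi]
    · simp [Prog.eval, Expr.eval, h16, hvi, h v (by omega)]
  rintro s₂ r₂ hf₂ ⟨h₂, hr₂⟩
  have hO : Enumerates n (s₂.arr 10) :=
    ⟨fun x hx => by rwa [h₂ x hx], fun v hv => ⟨v, hv, h₂ v hv⟩⟩
  have e₂ : ∀ a ≠ 10, s₂.arr a = s₁.arr a := fun a ha => hf₂.arr a (by
    simpa [forLoop, Prog.arrs] using ha)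
  have z₂ : ∀ a, a ∈ [14, 20] → s₂.arr a = fun _ => 0 := by
    intro a ha
    rw [e₂ a (by rintro rfl; revert ha; decide), ← hz a (by simp at ha; omega)]
    refine hf₁.arr a ?_
    simp only [List.mem_cons, List.not_mem_nil, or_false] at ha
    rcases ha with rfl | rfl <;> decide
  have n₂ : s₂.reg 0 = n := by rw [hf₂.reg 0 (by decide), hf₁.reg 0 (by decide), hn]
  refine Runs.seq (runs_dfs (d := 10) (N := s₂.arr 12) (B := B + 400 * (n + m) + 400) n₂ hA hO
    (by rw [e₂ 12 (by decide)]; exact h₁.fwd_next) rfl (by rw [e₂ _ (by decide)]; exact h₁.fwd) rfl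
    (by rw [e₂ _ (by decide)]; exact h₁.fwd_tgt) (z₂ 14 (by decide)) (by omega)) ?_
  rintro s₃ r₃ hf₃ ⟨h₃, hr₃⟩
  have e₃ : ∀ a ∉ [10, 11, 14, 15, 16], s₃.arr a = s₁.arr a := by
    intro a ha
    simp only [List.mem_cons, List.not_mem_nil, or_false, not_or] at ha
    rw [hf₃.arr a (by simp [dfs, dfsBody, Prog.arrs]; omega), e₂ a ha.1]
  -- The blocks of arrays of the two searches overlap in array `16`: there the first search leaves
  -- its finishing order, which is the order of the roots for the second. The arrays `17, 18, 19`
  -- that follow it hold the backward lists, so tails and heads are exchanged.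
  refine Runs.frame (runs_dfs (d := 16) (N := s₃.arr 18) (B := B)
    ((hf₃.reg 0 (by decide)).trans n₂) (fun j hj => (hA j hj).symm) h₃.enum
    (by rw [e₃ 18 (by decide)]; exact h₁.bwd_next) rfl (by rw [e₃ _ (by decide)]; exact h₁.bwd) rfl
    (by rw [e₃ _ (by decide)]; exact h₁.bwd_tgt)
    (by rw [hf₃.arr _ (by decide)]; exact z₂ 20 (by decide)) (by omega)) ?_
  rintro s₄ r₄ hf₄ ⟨h₄, hr₄⟩
  refine ⟨⟨⟨h₄.enum, fun v hv w hw => scc_of_two_searches h₃ h₄ hv hw hA,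
    fun a b hab => h₄.mono b a hab.swap, h₄.F_mono⟩, s₁, h₁, fun a ha => ?_⟩, hr₄⟩
  simp only [List.mem_cons, List.not_mem_nil, or_false] at ha
  rcases ha with rfl | rfl | rfl | rfl <;>
  · rw [hf₄.arr _ (by decide), e₃ _ (by decide)]

end Ram

/-! ### Backward induction -/

/-- The position `w` is won by `c`, or will be because only positions labelled `c` come before it in
the order in which the positions are processed. -/
def WonBy (n : ℕ) (O lw : ℕ → ℕ) (i : ℕ) (W : ℕ → ℕ) (c w : ℕ) : Prop :=
  W w = c ∨ W w = 0 ∧ ∃ x < n, O x = w ∧ ∀ y, x ≤ y → y ≤ i → lw (O y) = c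

/-- The reason why the position `v` is won by `W v`. -/
structure Reason (n m : ℕ) (src tgt own lw O : ℕ → ℕ) (i : ℕ) (W M rk : ℕ → ℕ) (v : ℕ) : Prop where
  term : (∀ j < m, src j ≠ v) → W v = lw v
  self : own v + 1 = W v → (∃ j < m, src j = v) →
    (W v = lw v ∧ ∃ w, Arc m src tgt v w ∧ WonBy n O lw i W (W v) w) ∨
    (Arc m src tgt v (M v) ∧ W (M v) = W v ∧ rk (M v) < rk v)
  opp : own v + 1 ≠ W v → ∀ w, Arc m src tgt v w →
    (W v = lw v ∧ WonBy n O lw i W (W v) w) ∨ (W w = W v ∧ rk w < rk v)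

/-- The state of the backward induction: `own` and `lw` hold the owners (`0`, `1`) and the winners
(`1`, `2`) of infinite plays around the positions; `W` holds the winners found so far, `D` the numbers
of moves not yet refuted, `M` the moves, `rk` the order in which the winners were found. -/
structure SolveInv (n m : ℕ) (src tgt own lw O : ℕ → ℕ) (i sp : ℕ) (R W D S M rk : ℕ → ℕ) (t : ℕ) :
    Prop where
  i_le : i ≤ n
  ptr : IsPtr m tgt R
  ord : ∀ y, i ≤ y → y < n → W (O y) ≠ 0
  W_le : ∀ v < n, W v ≤ 2
  S_lt : ∀ p < sp, S p < n
  S_W : ∀ p < sp, W (S p) = lw (O i) ∧ W (S p) ≠ 0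
  closed : ∀ v < n, W v ≠ 0 → (∃ p < sp, S p = v) ∨ R v = 0
  done : ∀ j < m, j ∉ undone m tgt R → W (tgt j) ≠ 0 ∧ (W (src j) = 0 → W (tgt j) ≠ own (src j) + 1)
  deg : ∀ v < n, W v = 0 → D v = ((undone m tgt R).filter fun j => src j = v).card ∧
    (D v = 0 → ∀ j < m, src j ≠ v)
  rk_lt : ∀ v < n, W v ≠ 0 → rk v < t
  reason : ∀ v < n, W v ≠ 0 → Reason n m src tgt own lw O i W M rk v
  move : ∀ j < m, Arc m src tgt (src j) (M (src j))

namespace SolveInv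

variable {n m : ℕ} {src tgt own lw O : ℕ → ℕ} {i sp t : ℕ} {R W D S M rk : ℕ → ℕ}

theorem initial (hR : IsPtr m tgt R) (hu : undone m tgt R = Finset.range m)
    (hD : ∀ v, D v = ((Finset.range m).filter fun j => src j = v).card)
    (hM : ∀ j < m, Arc m src tgt (src j) (M (src j))) (S : ℕ → ℕ) :
    SolveInv n m src tgt own lw O n 0 R (fun _ => 0) D S M (fun _ => 0) 0 := by
  refine ⟨le_rfl, hR, fun y _ _ => by omega, fun _ _ => by omega, fun _ _ => by omega,
    fun _ _ => by omega, fun _ _ h => absurd rfl h, fun j hj h => ?_, fun v _ _ => ?_,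
    fun _ _ h => absurd rfl h, fun _ _ h => absurd rfl h, hM⟩
  · exact absurd (by simpa [hu] using hj) h
  · refine ⟨by rw [hu, hD], fun h0 j hj e => ?_⟩
    rw [hD, Finset.card_eq_zero] at h0
    have : j ∈ (Finset.range m).filter fun j => src j = v := by simp [hj, e]
    rw [h0] at this
    simp at this

theorem skip (h : SolveInv n m src tgt own lw O i 0 R W D S M rk t)
    (hW : W (O (i - 1)) ≠ 0) : SolveInv n m src tgt own lw O (i - 1) 0 R W D S M rk t := by
  have hok : ∀ c w, WonBy n O lw i W c w → WonBy n O lw (i - 1) W c w := by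
    rintro c w (h1 | ⟨h1, x, hx, e, h2⟩)
    · exact .inl h1
    · exact .inr ⟨h1, x, hx, e, fun y hy hyi => h2 y hy (by omega)⟩
  refine { h with i_le := (by have := h.i_le; omega), ord := ?_, S_W := (by omega), reason := ?_ }
  · intro y hy hn
    by_cases hyi : y = i - 1
    · rwa [hyi]
    · exact h.ord y (by omega) hn
  · intro v hv hWv
    obtain ⟨r1, r2, r3⟩ := h.reason v hv hWv
    refine ⟨r1, fun ho hj => ?_, fun ho w hw => ?_⟩
    · rcases r2 ho hj with ⟨e, w, hw, hk⟩ | h'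
      · exact .inl ⟨e, w, hw, hok _ _ hk⟩
      · exact .inr h'
    · rcases r3 ho w hw with ⟨e, hk⟩ | h'
      · exact .inl ⟨e, hok _ _ hk⟩
      · exact .inr h'

/-- Common to declaration, where `i'` is `i - 1` and the stack is empty, and to propagation, where
`i'` is `i`. In both cases the new winner is the label of `O i'`, which is what keeps earlier
promises. -/
theorem mark (h : SolveInv n m src tgt own lw O i sp R W D S M rk t) {i' u c : ℕ}
    {D' M' : ℕ → ℕ} (hu : u < n) (hW : W u = 0) (hi : i' ≤ i) (hc : c = lw (O i')) (hc0 : c ≠ 0)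
    (hc2 : c ≤ 2) (hS : ∀ p < sp, W (S p) = c) (hord : ∀ y, i' ≤ y → y < n → O y = u ∨ W (O y) ≠ 0)
    (hx : ∀ x < n, W (O x) = 0 → x ≤ i') (hD : ∀ v, v ≠ u → D' v = D v)
    (hM : ∀ v, v ≠ u → M' v = M v) (hmove : ∀ j < m, Arc m src tgt (src j) (M' (src j)))
    (hr : Reason n m src tgt own lw O i' (Function.update W u c) M' (Function.update rk u t) u) :
    SolveInv n m src tgt own lw O i' (sp + 1) R (Function.update W u c) D'
      (Function.update S sp u) M' (Function.update rk u t) (t + 1) := by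
  have hWv : ∀ v, v ≠ u → Function.update W u c v = W v := fun v hv =>
    Function.update_of_ne hv _ _
  have hrk : ∀ v, v ≠ u → Function.update rk u t v = rk v := fun v hv =>
    Function.update_of_ne hv _ _
  have hne : ∀ v, W v ≠ 0 → v ≠ u := fun v hv e => hv (e ▸ hW)
  have hSp : ∀ p < sp, Function.update S sp u p = S p := fun p hp =>
    Function.update_of_ne (by omega) _ _
  have hlt : ∀ p < sp + 1, p < sp ∨ p = sp := fun p hp => by omega
  have hok : ∀ c' w, c' ≠ 0 → WonBy n O lw i W c' w →
      WonBy n O lw i' (Function.update W u c) c' w := by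
    rintro c' w hc' (h1 | ⟨h1, x, hxn, e, h2⟩)
    · exact .inl (by rw [hWv w (hne w (by rwa [h1])), h1])
    -- If `u` had been promised to `c'`, the promise is kept: `u` is undecided, so its index is at
    -- most `i'`, the label of `O i'` is covered by the promise, and this label is the winner `c` of
    -- `u`.
    · by_cases hwu : w = u
      · left
        rw [hwu, Function.update_self, hc]
        exact h2 i' (hx x hxn (by rw [e, h1])) hi
      · exact .inr ⟨by rw [hWv w hwu, h1], x, hxn, e, fun y hy hyi => h2 y hy (by omega)⟩
  refine ⟨hi.trans h.i_le, h.ptr, ?_, ?_, ?_, ?_, ?_, ?_, ?_, ?_, ?_, hmove⟩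
  · intro y hy hn
    by_cases hyu : O y = u
    · rw [hyu, Function.update_self]; exact hc0
    · rw [hWv _ hyu]; exact (hord y hy hn).resolve_left hyu
  · intro v hv
    by_cases hvu : v = u
    · rw [hvu, Function.update_self]; exact hc2
    · rw [hWv v hvu]; exact h.W_le v hv
  · intro p hp
    rcases hlt p hp with hp | rfl
    · rw [hSp p hp]; exact h.S_lt p hp
    · rwa [Function.update_self]
  · intro p hp
    rcases hlt p hp with hp | rfl
    · rw [hSp p hp, hWv _ (hne _ (by rwa [hS p hp])), hS p hp]; exact ⟨hc, hc0⟩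
    · rw [Function.update_self, Function.update_self]; exact ⟨hc, hc0⟩
  · intro v hv hv0
    by_cases hvu : v = u
    · exact .inl ⟨sp, by omega, by rw [Function.update_self, hvu]⟩
    · rw [hWv v hvu] at hv0
      rcases h.closed v hv hv0 with ⟨p, hp, e⟩ | h'
      · exact .inl ⟨p, by omega, by rw [hSp p hp, e]⟩
      · exact .inr h'
  · intro j hj hd
    obtain ⟨h1, h2⟩ := h.done j hj hd
    rw [hWv _ (hne _ h1)]
    refine ⟨h1, fun h3 => h2 ?_⟩
    by_cases hs : src j = u
    · rw [hs, hW]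
    · rwa [hWv _ hs] at h3
  · intro v hv hv0
    by_cases hvu : v = u
    · rw [hvu, Function.update_self] at hv0; exact absurd hv0 hc0
    · rw [hWv v hvu] at hv0
      rw [hD v hvu]; exact h.deg v hv hv0
  · intro v hv hv0
    by_cases hvu : v = u
    · rw [hvu, Function.update_self]; omega
    · rw [hWv v hvu] at hv0
      rw [hrk v hvu]; have := h.rk_lt v hv hv0; omega
  · intro v hv hv0
    by_cases hvu : v = u
    · rw [hvu]; exact hr
    · rw [hWv v hvu] at hv0
      obtain ⟨r1, r2, r3⟩ := h.reason v hv hv0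
      constructor
      · rw [hWv v hvu]; exact r1
      · rw [hWv v hvu, hM v hvu, hrk v hvu]
        intro ho hj
        rcases r2 ho hj with ⟨e, w, hw, hk⟩ | ⟨h1, h2, h3⟩
        · exact .inl ⟨e, w, hw, hok _ _ hv0 hk⟩
        · have := hne (M v) (by rwa [h2])
          exact .inr ⟨h1, by rw [hWv _ this, h2], by rwa [hrk _ this]⟩
      · rw [hWv v hvu, hrk v hvu]
        intro ho w hw
        rcases r3 ho w hw with ⟨e, hk⟩ | ⟨h2, h3⟩
        · exact .inl ⟨e, hok _ _ hv0 hk⟩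
        · have := hne w (by rwa [h2])
          exact .inr ⟨by rw [hWv _ this, h2], by rwa [hrk _ this]⟩

theorem lt_of_eq_zero (h : SolveInv n m src tgt own lw O i sp R W D S M rk t) {x : ℕ} (hx : x < n)
    (h0 : W (O x) = 0) : x < i := by
  by_contra hlt
  exact h.ord x (by omega) hx h0

theorem eq_of_ne_own (hown : ∀ v < n, own v ≤ 1) {v a b : ℕ} (hv : v < n) (ha : a ≠ 0) (ha2 : a ≤ 2)
    (hb : b ≠ 0) (hb2 : b ≤ 2) (h1 : a ≠ own v + 1) (h2 : own v + 1 ≠ b) : a = b := by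
  have := hown v hv; omega

/-- With an empty stack all victories have been propagated. An undecided successor is the position
itself or precedes it in the order, and then `hlab` makes all labels up to this position equal,
which is a promise in the sense of `WonBy`. -/
theorem declare (h : SolveInv n m src tgt own lw O i 0 R W D S M rk t)
    (hA : ∀ j < m, src j < n ∧ tgt j < n) (hO : Enumerates n O) (hown : ∀ v < n, own v ≤ 1)
    (hlw : ∀ v < n, lw v ≠ 0 ∧ lw v ≤ 2)
    (hlab : ∀ x y, x < y → y < n → Arc m src tgt (O y) (O x) →
      ∀ z, x ≤ z → z ≤ y → lw (O z) = lw (O y))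
    (h0 : i ≠ 0) (hW : W (O (i - 1)) = 0) :
    SolveInv n m src tgt own lw O (i - 1) 1 R (Function.update W (O (i - 1)) (lw (O (i - 1)))) D
      (Function.update S 0 (O (i - 1))) M (Function.update rk (O (i - 1)) t) (t + 1) := by
  have hi := h.i_le
  have hu : O (i - 1) < n := hO.1 _ (by omega)
  obtain ⟨hl0, hl2⟩ := hlw _ hu
  have hwon : ∀ w, Arc m src tgt (O (i - 1)) w → W w = 0 →
      WonBy n O lw (i - 1) (Function.update W (O (i - 1)) (lw (O (i - 1)))) (lw (O (i - 1))) w := by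
    intro w hw hw0
    by_cases hwu : w = O (i - 1)
    · left; rw [hwu, Function.update_self]
    · have hwn : w < n := by obtain ⟨j, hj, -, rfl⟩ := hw; exact (hA j hj).2
      obtain ⟨x, hx, rfl⟩ := hO.2 w hwn
      have hxi := h.lt_of_eq_zero hx hw0
      have : x ≠ i - 1 := by rintro rfl; exact hwu rfl
      exact .inr ⟨by rw [Function.update_of_ne hwu, hw0], x, hx, rfl,
        hlab x (i - 1) (by omega) (by omega) hw⟩
  have hdone : ∀ j < m, W (tgt j) ≠ 0 → j ∉ undone m tgt R := by
    intro j hj hWj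
    rw [mem_undone, (h.closed _ (hA j hj).2 hWj).resolve_left (by rintro ⟨p, hp, -⟩; omega)]
    omega
  refine h.mark hu hW (by omega) rfl hl0 hl2 (by omega) ?_ ?_ (fun _ _ => rfl) (fun _ _ => rfl)
    h.move ⟨?_, ?_, ?_⟩
  · intro y hy hn
    by_cases hyi : y = i - 1
    · exact .inl (by rw [hyi])
    · exact .inr (h.ord y (by omega) hn)
  · intro x hx hx0
    have := h.lt_of_eq_zero hx hx0; omega
  · intro _; rw [Function.update_self]
  · rw [Function.update_self]
    rintro ho ⟨j, hj, hjs⟩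
    -- The counter of an undecided position with moves is positive, so some move is unused. Its
    -- target is undecided, since no unused arc leads to a decided position when the stack is empty.
    obtain ⟨hd, hd0⟩ := h.deg _ hu hW
    have hne : D (O (i - 1)) ≠ 0 := fun h' => hd0 h' j hj hjs
    rw [hd, Finset.card_ne_zero] at hne
    obtain ⟨e, he⟩ := hne
    rw [Finset.mem_filter, mem_undone] at he
    refine .inl ⟨rfl, tgt e, ⟨e, he.1.1, he.2, rfl⟩, hwon _ ⟨e, he.1.1, he.2, rfl⟩ ?_⟩
    by_contra hWe
    exact hdone e he.1.1 hWe (mem_undone.2 he.1)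
  · rw [Function.update_self]
    intro ho w hw
    refine .inl ⟨rfl, ?_⟩
    by_cases hw0 : W w = 0
    · exact hwon w hw hw0
    · left
      -- A decided successor is not won by the owner, for otherwise the position would have been
      -- marked. The opponent wins it, and here the opponent is the player of the label.
      obtain ⟨j, hj, hjs, rfl⟩ := hw
      have h1 := (h.done j hj (hdone j hj hw0)).2 (by rw [hjs, hW])
      rw [hjs] at h1
      have h2 := eq_of_ne_own hown hu hw0 (h.W_le _ (hA j hj).2) hl0 hl2 h1 ho
      rw [Function.update_of_ne (by rintro e; exact hw0 (e ▸ hW)), h2]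

/-- A position is marked during the propagation from the positions on the stack. -/
theorem mark_arc (h : SolveInv n m src tgt own lw O i (sp + 1) R W D S M rk t) {u c : ℕ}
    {D' M' : ℕ → ℕ} (hu : u < n) (hW : W u = 0) (hc : c = W (S sp)) (hc0 : c ≠ 0)
    (hD : ∀ v, v ≠ u → D' v = D v)
    (hM : ∀ v, v ≠ u → M' v = M v) (hmove : ∀ j < m, Arc m src tgt (src j) (M' (src j)))
    (hr : Reason n m src tgt own lw O i (Function.update W u c) M' (Function.update rk u t) u) :
    SolveInv n m src tgt own lw O i (sp + 2) R (Function.update W u c) D'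
      (Function.update S (sp + 1) u) M' (Function.update rk u t) (t + 1) := by
  have hc' : c = lw (O i) := hc.trans (h.S_W sp (by omega)).1
  refine h.mark hu hW le_rfl hc' hc0 (hc ▸ h.W_le _ (h.S_lt sp (by omega)))
    (fun p hp => (h.S_W p hp).1.trans hc'.symm) (fun y hy hn => .inr (h.ord y hy hn)) ?_ hD hM hmove hr
  intro x hx hx0
  exact (h.lt_of_eq_zero hx hx0).le

/-- For an undecided source the arc is a refuted move. The counter drops by one and must stay
positive, because a source without unrefuted moves is marked before the pointer is advanced. -/
theorem advance (h : SolveInv n m src tgt own lw O i sp R W D S M rk t) {N : ℕ → ℕ}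
    (hN : ∀ j < m, N j = lastIdx tgt (tgt j) j) {u e : ℕ} (hu : W u ≠ 0)
    (he : R u = e + 1) {D' : ℕ → ℕ} (hD : ∀ v, v ≠ src e → D' v = D v)
    (hW : W (src e) = 0 → W u ≠ own (src e) + 1 ∧ D (src e) = D' (src e) + 1 ∧ D' (src e) ≠ 0) :
    SolveInv n m src tgt own lw O i sp (Function.update R u (N e)) W D' S M rk t := by
  obtain ⟨hm, htgt, hmem⟩ := h.ptr.mem_undone_top he
  have hun := h.ptr.undone_advance hN he
  refine { h with ptr := h.ptr.advance hN he, closed := ?_, done := ?_, deg := ?_ }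
  · intro v hv hv0
    rcases h.closed v hv hv0 with h' | h'
    · exact .inl h'
    · refine .inr ?_
      rw [Function.update_of_ne, h']
      rintro rfl; omega
  · intro j hj hd
    rw [hun] at hd
    by_cases hje : j = e
    · subst hje
      rw [htgt]
      exact ⟨hu, fun h' => (hW h').1⟩
    · exact h.done j hj fun h' => hd (Finset.mem_erase.2 ⟨hje, h'⟩)
  · intro v hv hv0
    obtain ⟨h1, h2⟩ := h.deg v hv hv0
    rw [hun, Finset.filter_erase]
    by_cases hve : v = src e
    · subst hve
      obtain ⟨-, h3, h4⟩ := hW hv0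
      refine ⟨?_, fun h5 => absurd h5 h4⟩
      have := Finset.card_erase_add_one (s := (undone m tgt R).filter fun j => src j = src e)
        (a := e) (by simp [hmem])
      omega
    · rw [hD v hve, Finset.erase_eq_of_notMem]
      · exact ⟨h1, h2⟩
      · simp only [Finset.mem_filter, not_and]
        rintro - rfl; exact hve rfl

theorem pop (h : SolveInv n m src tgt own lw O i (sp + 1) R W D S M rk t) (hR : R (S sp) = 0) :
    SolveInv n m src tgt own lw O i sp R W D S M rk t := by
  refine { h with S_lt := fun p hp => h.S_lt p (by omega), S_W := fun p hp => h.S_W p (by omega), closed := ?_ }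
  intro v hv hv0
  rcases h.closed v hv hv0 with ⟨p, hp, rfl⟩ | h'
  · by_cases hps : p = sp
    · rw [hps]; exact .inr hR
    · exact .inl ⟨p, by omega, rfl⟩
  · exact .inr h'

theorem reason_own {u w : ℕ} (hu : W u ≠ 0) (hw : W w = 0) (ha : Arc m src tgt w u)
    (ho : own w + 1 = W u) (hrk : rk u < t) :
    Reason n m src tgt own lw O i (Function.update W w (W u)) (Function.update M w u)
      (Function.update rk w t) w := by
  have hne : u ≠ w := by rintro rfl; exact hu hw
  constructor
  · intro h; obtain ⟨j, hj, e, -⟩ := ha; exact absurd e (h j hj)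
  · intro _ _
    right
    simp only [Function.update_self, Function.update_of_ne hne]
    exact ⟨ha, trivial, hrk⟩
  · intro h'; rw [Function.update_self] at h'; exact absurd ho h'

/-- The counter `1` says that `e` is the last unused arc from its source. The targets of the others
are decided and not won by the owner, so among two players they have the same winner as `u`, and
smaller ranks than the new mark. -/
theorem reason_opp (h : SolveInv n m src tgt own lw O i sp R W D S M rk t)
    (hA : ∀ j < m, src j < n ∧ tgt j < n) (hown : ∀ v < n, own v ≤ 1) {u e : ℕ}
    (hun : u < n) (hu : W u ≠ 0) (he : R u = e + 1) (hw : W (src e) = 0)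
    (ho : own (src e) + 1 ≠ W u) (hD : D (src e) = 1) :
    Reason n m src tgt own lw O i (Function.update W (src e) (W u)) M
      (Function.update rk (src e) t) (src e) := by
  obtain ⟨hm, htgt, hmem⟩ := h.ptr.mem_undone_top he
  constructor
  · intro h'; exact absurd rfl (h' e hm)
  · intro h'; rw [Function.update_self] at h'; exact absurd h' ho
  · rintro - w ⟨j, hj, hjs, rfl⟩
    right
    have key : W (tgt j) = W u := by
      by_cases hje : j = e
      · rw [hje, htgt]
      · have hd : j ∉ undone m tgt R := by
          intro hjm
          have h1 := (h.deg _ (hA e hm).1 hw).1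
          rw [hD] at h1
          obtain ⟨x, hx⟩ := Finset.card_eq_one.1 h1.symm
          have h2 : e ∈ (undone m tgt R).filter fun j => src j = src e := by simp [hmem]
          have h3 : j ∈ (undone m tgt R).filter fun j => src j = src e := by simp [hjm, hjs]
          rw [hx, Finset.mem_singleton] at h2 h3
          exact hje (h3.trans h2.symm)
        obtain ⟨h1, h2⟩ := h.done j hj hd
        rw [hjs] at h2
        exact eq_of_ne_own hown (hA e hm).1 h1 (h.W_le _ (hA j hj).2) hu (h.W_le _ hun) (h2 hw) ho
    have hne : tgt j ≠ src e := by rintro e'; rw [e', hw] at key; exact hu key.symm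
    rw [Function.update_of_ne hne, Function.update_of_ne hne, Function.update_self,
      Function.update_self]
    exact ⟨key, h.rk_lt _ (hA j hj).2 (by rwa [key])⟩

end SolveInv

/-- Winners `W` and moves `M` with a proof by ranks that the moves win. -/
structure Solved (n m : ℕ) (src tgt own lw W M rk : ℕ → ℕ) : Prop where
  W_ne : ∀ v < n, W v ≠ 0
  W_le : ∀ v < n, W v ≤ 2
  term : ∀ v < n, (∀ j < m, src j ≠ v) → W v = lw v
  move : ∀ v, (∃ j < m, src j = v) → Arc m src tgt v (M v)
  self : ∀ v, (∃ j < m, src j = v) → own v + 1 = W v →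
    W (M v) = W v ∧ (lw v = W v ∨ rk (M v) < rk v)
  opp : ∀ v, own v + 1 ≠ W v → ∀ w, Arc m src tgt v w → W w = W v ∧ (lw v = W v ∨ rk w < rk v)

/-- At the end nothing is undecided, so every promise has become a fact. Where label and winner
agree, no drop of rank is needed and any move to a position with the same winner will do; `M'` takes
one if there is one, and otherwise keeps the move found by propagation. -/
theorem SolveInv.solved {n m : ℕ} {src tgt own lw O : ℕ → ℕ} {t : ℕ} {R W D S M M' rk : ℕ → ℕ}
    (h : SolveInv n m src tgt own lw O 0 0 R W D S M rk t) (hO : Enumerates n O)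
    (hA : ∀ j < m, src j < n ∧ tgt j < n)
    (hM : ∀ v, (M' v = M v ∧ ∀ j < m, src j = v → W v = lw v → W (tgt j) ≠ W v) ∨
      ∃ j < m, src j = v ∧ tgt j = M' v ∧ W v = lw v ∧ W (tgt j) = W v) :
    Solved n m src tgt own lw W M' rk := by
  have hW : ∀ v < n, W v ≠ 0 := by
    intro v hv
    obtain ⟨x, hx, rfl⟩ := hO.2 v hv
    exact h.ord x (by omega) hx
  have hwon : ∀ c w, Arc m src tgt c w → ∀ a, WonBy n O lw 0 W a w → W w = a := by
    rintro c w ⟨j, hj, -, rfl⟩ a (h1 | ⟨h1, -⟩)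
    · exact h1
    · exact absurd h1 (hW _ (hA j hj).2)
  refine ⟨hW, h.W_le, fun v hv => (h.reason v hv (hW v hv)).term, ?_, ?_, ?_⟩
  · rintro v ⟨j, hj, rfl⟩
    rcases hM (src j) with ⟨e, -⟩ | ⟨j', hj', e1, e2, -⟩
    · rw [e]; exact h.move j hj
    · exact ⟨j', hj', e1, e2⟩
  · rintro v ⟨j, hj, rfl⟩ ho
    have hv := (hA j hj).1
    rcases hM (src j) with ⟨e, h'⟩ | ⟨j', hj', e1, e2, e3, e4⟩
    · rcases (h.reason _ hv (hW _ hv)).self ho ⟨j, hj, rfl⟩ with ⟨e1, w, ha, hw⟩ | ⟨h1, h2, h3⟩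
      · have hww := hwon _ _ ha _ hw
        obtain ⟨j', hj', e2, rfl⟩ := ha
        exact absurd hww (h' j' hj' e2 e1)
      · rw [e]; exact ⟨h2, .inr h3⟩
    · rw [← e2]; exact ⟨e4, .inl e3.symm⟩
  · intro v ho w ha
    have hv : v < n := by obtain ⟨j, hj, rfl, -⟩ := ha; exact (hA j hj).1
    rcases (h.reason v hv (hW v hv)).opp ho w ha with ⟨e, hw⟩ | ⟨h1, h2⟩
    · exact ⟨hwon _ _ ha _ hw, .inl e.symm⟩
    · exact ⟨h1, .inr h2⟩

/-! ### Backward induction as a program -/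

namespace Ram

/-- Body of the backward induction: array `22` holds the order of the positions, `23` and `18` the
lists of incoming arcs, `24` the winners, `25` the counters, `26` the stack, `27` the moves, and `28`
the winners of infinite plays. -/
def solveBody : Prog :=
  .ite (.eq (.reg 11) (.const 0))
    (.seq (.assign 10 (.pred (.reg 10)))
    (.seq (.assign 14 (.read 22 (.reg 10)))
      (.ite (.eq (.read 24 (.reg 14)) (.const 0))
        (.seq (.write 24 (.reg 14) (.read 28 (.reg 14)))
        (.seq (.write 26 (.reg 11) (.reg 14))
          (.assign 11 (.succ (.reg 11)))))
        .skip)))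
    (.seq (.assign 14 (.read 26 (.pred (.reg 11))))
    (.seq (.assign 15 (.read 23 (.reg 14)))
      (.ite (.eq (.reg 15) (.const 0))
        (.assign 11 (.pred (.reg 11)))
        (.seq (.assign 15 (.pred (.reg 15)))
        (.seq (.write 23 (.reg 14) (.read 18 (.reg 15)))
        (.seq (.assign 17 (.read 1 (.reg 15)))
          (.ite (.eq (.read 24 (.reg 17)) (.const 0))
            (.ite (.eq (.succ (.read 0 (.reg 17))) (.read 24 (.reg 14)))
              (.seq (.write 24 (.reg 17) (.read 24 (.reg 14)))
              (.seq (.write 27 (.reg 17) (.reg 14))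
              (.seq (.write 26 (.reg 11) (.reg 17))
                (.assign 11 (.succ (.reg 11))))))
              (.seq (.write 25 (.reg 17) (.pred (.read 25 (.reg 17))))
                (.ite (.eq (.read 25 (.reg 17)) (.const 0))
                  (.seq (.write 24 (.reg 17) (.read 24 (.reg 14)))
                  (.seq (.write 26 (.reg 11) (.reg 17))
                    (.assign 11 (.succ (.reg 11)))))
                  .skip)))
            .skip)))))))

/-- The potential is that of depth-first search, with decided positions in the role of marked ones
and arcs used backwards. -/
theorem runs_solveBody {n m : ℕ} {src tgt own lw O N rk : ℕ → ℕ} {t : ℕ} {s : Memory}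
    (hA : ∀ j < m, src j < n ∧ tgt j < n)
    (hO : Enumerates n O) (hN : ∀ j < m, N j = lastIdx tgt (tgt j) j)
    (hown : ∀ v < n, own v ≤ 1) (hlw : ∀ v < n, lw v ≠ 0 ∧ lw v ≤ 2)
    (hlab : ∀ x y, x < y → y < n → Arc m src tgt (O y) (O x) →
      ∀ z, x ≤ z → z ≤ y → lw (O z) = lw (O y))
    (hsO : s.arr 22 = O) (hsN : s.arr 18 = N) (hs1 : s.arr 1 = src) (hs0 : s.arr 0 = own)
    (hsl : s.arr 28 = lw)
    (h : SolveInv n m src tgt own lw O (s.reg 10) (s.reg 11) (s.arr 23) (s.arr 24) (s.arr 25)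
      (s.arr 26) (s.arr 27) rk t) (hb : searchTest.holds s) :
    ∃ rk' t', SolveInv n m src tgt own lw O ((solveBody.eval s).reg 10) ((solveBody.eval s).reg 11)
      ((solveBody.eval s).arr 23) ((solveBody.eval s).arr 24) ((solveBody.eval s).arr 25)
      ((solveBody.eval s).arr 26) ((solveBody.eval s).arr 27) rk' t' ∧
      2 * unmarked n ((solveBody.eval s).arr 24) + (solveBody.eval s).reg 10 +
        (solveBody.eval s).reg 11 + (undone m tgt ((solveBody.eval s).arr 23)).card + 1 ≤
      2 * unmarked n (s.arr 24) + s.reg 10 + s.reg 11 + (undone m tgt (s.arr 23)).card := by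
  have hi := h.i_le
  by_cases h1 : s.reg 11 = 0
  · have h0 : s.reg 10 ≠ 0 := by
      simpa [searchTest, Test.holds, Expr.eval, h1] using hb
    have hlt : O (s.reg 10 - 1) < n := hO.1 _ (by omega)
    by_cases h2 : s.arr 24 (O (s.reg 10 - 1)) = 0
    · rw [h1] at h
      refine ⟨Function.update rk (O (s.reg 10 - 1)) t, t + 1, ?_, ?_⟩
      · simpa [solveBody, Prog.eval, Test.holds, Expr.eval, h1, h2, hsO, hsl] using
          h.declare hA hO hown hlw hlab h0 h2
      · have := unmarked_update hlt h2 (hlw _ hlt).1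
        simp [solveBody, Prog.eval, Test.holds, Expr.eval, h1, h2, hsO, hsl]
        omega
    · refine ⟨rk, t, ?_, ?_⟩
      · rw [h1] at h
        simpa [solveBody, Prog.eval, Test.holds, Expr.eval, h1, h2, hsO] using h.skip h2
      · simp [solveBody, Prog.eval, Test.holds, Expr.eval, h1, h2, hsO]
        omega
  · obtain ⟨sp, hsp⟩ := Nat.exists_eq_succ_of_ne_zero h1
    simp only [Nat.succ_eq_add_one] at hsp
    rw [hsp] at h
    obtain ⟨u, hu⟩ : ∃ u, s.arr 26 sp = u := ⟨_, rfl⟩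
    have hun : u < n := hu ▸ h.S_lt sp (by omega)
    by_cases h2 : s.arr 23 u = 0
    · refine ⟨rk, t, ?_, ?_⟩
      · simpa [solveBody, Prog.eval, Test.holds, Expr.eval, hsp, hu, h2] using h.pop (hu ▸ h2)
      · simp [solveBody, Prog.eval, Test.holds, Expr.eval, hsp, hu, h2]
    · obtain ⟨e, he⟩ := Nat.exists_eq_succ_of_ne_zero h2
      simp only [Nat.succ_eq_add_one] at he
      obtain ⟨hm, htgt, hmem⟩ := h.ptr.mem_undone_top he
      have hcard := Finset.card_erase_add_one hmem
      rw [← h.ptr.undone_advance hN he] at hcard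
      have hWu : s.arr 24 u ≠ 0 := hu ▸ (h.S_W sp (by omega)).2
      obtain ⟨w, hw⟩ : ∃ w, src e = w := ⟨_, rfl⟩
      have hwn : w < n := hw ▸ (hA e hm).1
      have hwu : s.arr 24 w = 0 → w ≠ u := by rintro h' rfl; exact hWu h'
      by_cases h3 : s.arr 24 w = 0
      · have hum := unmarked_update hwn h3 hWu
        have hup : Function.update (s.arr 24) w (s.arr 24 u) u = s.arr 24 u :=
          Function.update_of_ne (hwu h3).symm _ _
        by_cases h4 : own w + 1 = s.arr 24 u
        · have hr := SolveInv.reason_own (n := n) (own := own) (lw := lw) (O := O) (i := s.reg 10)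
            (M := s.arr 27) (rk := rk) (t := t) hWu h3 ⟨e, hm, hw, htgt⟩ h4 (h.rk_lt u hun hWu)
          -- Again the invariant marks before it advances the pointer, contrary to the program: once
          -- the source is decided, `advance` has no condition on its counter.
          have hk := h.mark_arc hwn h3 (by rw [hu]) hWu (fun _ _ => rfl)
            (fun v hv => Function.update_of_ne hv _ _) (fun j hj => by
              by_cases hj' : src j = w
              · rw [hj', Function.update_self]; exact ⟨e, hm, hw, htgt⟩
              · rw [Function.update_of_ne hj']; exact h.move j hj) hr
          have ha := hk.advance hN (u := u) (by rw [hup]; exact hWu) he (fun _ _ => rfl)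
            (by rw [hw, Function.update_self]; exact fun h' => absurd h' hWu)
          refine ⟨Function.update rk w t, t + 1, ?_, ?_⟩
          · simpa [solveBody, Prog.eval, Test.holds, Expr.eval, hsp, hu, he, hs1, hs0, hsN, hw, h3,
              h4] using ha
          · simp [solveBody, Prog.eval, Test.holds, Expr.eval, hsp, hu, he, hs1, hs0, hsN, hw, h3,
              h4]
            omega
        · have hdeg := h.deg w hwn h3
          have hD0 : s.arr 25 w ≠ 0 := fun h' => hdeg.2 h' e hm hw
          by_cases h5 : s.arr 25 w - 1 = 0
          · have hr := h.reason_opp hA hown hun hWu he (hw ▸ h3) (hw ▸ h4) (by rw [hw]; omega)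
            rw [hw] at hr
            have hk := h.mark_arc (D' := Function.update (s.arr 25) w (s.arr 25 w - 1)) hwn h3
              (by rw [hu]) hWu (fun v hv => Function.update_of_ne hv _ _)
              (fun _ _ => rfl) h.move hr
            have ha := hk.advance hN (u := u) (by rw [hup]; exact hWu) he (fun _ _ => rfl)
              (by rw [hw, Function.update_self]; exact fun h' => absurd h' hWu)
            refine ⟨Function.update rk w t, t + 1, ?_, ?_⟩
            · simpa [solveBody, Prog.eval, Test.holds, Expr.eval, hsp, hu, he, hs1, hs0, hsN, hw,
                h3, h4, h5] using ha
            · simp [solveBody, Prog.eval, Test.holds, Expr.eval, hsp, hu, he, hs1, hs0, hsN, hw,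
                h3, h4, h5]
              omega
          · have ha := h.advance hN (u := u) hWu he
              (D' := Function.update (s.arr 25) w (s.arr 25 w - 1))
              (fun v hv => Function.update_of_ne (hw ▸ hv) _ _)
              (by rw [hw, Function.update_self]; exact fun _ => ⟨Ne.symm h4, by omega, h5⟩)
            refine ⟨rk, t, ?_, ?_⟩
            · simpa [solveBody, Prog.eval, Test.holds, Expr.eval, hsp, hu, he, hs1, hs0, hsN, hw,
                h3, h4, h5] using ha
            · simp [solveBody, Prog.eval, Test.holds, Expr.eval, hsp, hu, he, hs1, hs0, hsN, hw,
                h3, h4, h5]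
              omega
      · have ha := h.advance hN (u := u) hWu he (fun _ _ => rfl)
          (by rw [hw]; exact fun h' => absurd h' h3)
        refine ⟨rk, t, ?_, ?_⟩
        · simpa [solveBody, Prog.eval, Test.holds, Expr.eval, hsp, hu, he, hs1, hsN, hw,
            h3] using ha
        · simp [solveBody, Prog.eval, Test.holds, Expr.eval, hsp, hu, he, hs1, hsN, hw, h3]
          omega

/-- Moves that stay in positions won by the same player are preferred where infinite plays suffice. -/
def moveBody : Prog :=
  .seq (.assign 14 (.read 1 (.reg 16)))
  (.seq (.assign 15 (.read 2 (.reg 16)))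
    (.ite (.conj (.eq (.read 24 (.reg 14)) (.read 28 (.reg 14)))
        (.eq (.read 24 (.reg 15)) (.read 24 (.reg 14))))
      (.write 27 (.reg 14) (.reg 15)) .skip))

def solveProg : Prog :=
  .seq (.seq (.assign 10 (.reg 0)) (.assign 11 (.const 0)))
  (.seq (.loop searchTest solveBody)
  (.seq (forLoop 1 moveBody)
  (.seq (forLoop 0 (.write 0 (.reg 16) (.read 27 (.reg 16))))
    (.assign 0 (.pred (.read 24 (.reg 2)))))))

theorem runs_solveProg {n m : ℕ} {src tgt own lw O : ℕ → ℕ} {s s₀ : Memory} {T : ℕ}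
    (hn : s.reg 0 = n) (hm : s.reg 1 = m)
    (hA : ∀ j < m, src j < n ∧ tgt j < n) (hO : Enumerates n O)
    (hown : ∀ v < n, own v ≤ 1) (hlw : ∀ v < n, lw v ≠ 0 ∧ lw v ≤ 2)
    (hlab : ∀ x y, x < y → y < n → Arc m src tgt (O y) (O x) →
      ∀ z, x ≤ z → z ≤ y → lw (O z) = lw (O y))
    (hL : Linked src tgt m s₀) (hs₀ : ∀ a ∈ [18, 23, 25, 27], s.arr a = s₀.arr a)
    (hsO : s.arr 22 = O) (hs1 : s.arr 1 = src) (hs2 : s.arr 2 = tgt) (hs0 : s.arr 0 = own)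
    (hsl : s.arr 28 = lw) (hsW : s.arr 24 = fun _ => 0) (hT : 1000 * (n + m) + 1000 ≤ T) :
    Runs solveProg (fun s' _ => ∃ W M rk, Solved n m src tgt own lw W M rk ∧
      s'.reg 0 = W (s.reg 2) - 1 ∧ ∀ v < n, s'.arr 0 v = M v) s T := by
  refine Runs.seq (Q' := fun s' r => (s'.reg 10 = n ∧ s'.reg 11 = 0) ∧
    1000 * (n + m) + 900 ≤ r) ?_ ?_
  · refine Runs.straight rfl ?_ ⟨?_, ?_⟩
    · simp [Prog.bound, Expr.cost]; omega
    · simp [Prog.eval, Expr.eval, hn]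
    · simp [Prog.bound, Expr.cost]; omega
  rintro s₁ r₁ hf₁ ⟨⟨h10, h11⟩, hr₁⟩
  have harr : ∀ a, s₁.arr a = s.arr a := fun a => hf₁.arr a (by simp [Prog.arrs])
  have hN : ∀ j < m, s.arr 18 j = lastIdx tgt (tgt j) j := by
    rw [hs₀ 18 (by decide)]; exact hL.bwd_next
  refine Runs.seq (Q' := fun s' r => (∃ S R D rk t, SolveInv n m src tgt own lw O 0 0
    R (s'.arr 24) D S (s'.arr 27) rk t) ∧ 500 * (n + m) + 500 ≤ r) ?_ ?_
  · refine Runs.loop (I := fun s' r => (∃ rk t, SolveInv n m src tgt own lw O (s'.reg 10)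
      (s'.reg 11) (s'.arr 23) (s'.arr 24) (s'.arr 25) (s'.arr 26) (s'.arr 27) rk t) ∧
      500 * (n + m) + 100 * (2 * unmarked n (s'.arr 24) + s'.reg 10 + s'.reg 11 +
        (undone m tgt (s'.arr 23)).card) + 800 ≤ r) ?_ ?_
    · rintro s' r hf ⟨⟨rk, t, h⟩, hr⟩
      have hc : searchTest.cost = 8 := rfl
      refine ⟨by omega, fun hb => ?_, fun hb => ?_⟩
      · have hbd : solveBody.bound ≤ 91 := by
          simp [solveBody, Prog.bound, Expr.cost, Test.cost]
        have hfa : ∀ a ∉ solveBody.arrs, s'.arr a = s.arr a := fun a ha =>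
          (hf.arr a ha).trans (harr a)
        obtain ⟨rk', t', h', hΦ⟩ := runs_solveBody hA hO hN hown hlw hlab
          ((hfa 22 (by decide)).trans hsO) (hfa 18 (by decide)) ((hfa 1 (by decide)).trans hs1)
          ((hfa 0 (by decide)).trans hs0) ((hfa 28 (by decide)).trans hsl) h hb
        exact Runs.straight rfl (by omega) ⟨⟨rk', t', h'⟩, by omega⟩
      · have hb' : s'.reg 11 = 0 ∧ s'.reg 10 = 0 := by
          simpa [searchTest, Test.holds, Expr.eval] using hb
        rw [hb'.1, hb'.2] at h
        exact ⟨⟨_, _, _, rk, t, h⟩, by omega⟩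
    · rw [h10, h11, harr, harr, harr, harr, harr, hsW, hs₀ 23 (by decide), hs₀ 25 (by decide),
        hs₀ 27 (by decide), hL.bwd', undone_lastIdx, Finset.card_range]
      refine ⟨⟨_, _, SolveInv.initial (isPtr_lastIdx m tgt) (undone_lastIdx m tgt) hL.deg hL.move _⟩,
        ?_⟩
      have := unmarked_le n (fun _ => 0)
      omega
  rintro s₂ r₂ hf₂ ⟨⟨S, R, D, rk, t, h₂⟩, hr₂⟩
  have hfa₂ : ∀ a ∉ solveBody.arrs, s₂.arr a = s.arr a := fun a ha =>
    (hf₂.arr a ha).trans (harr a)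
  -- For each `v`, either the move is unchanged and none of the first `i` arcs is an admissible
  -- replacement, or the move is the target of an admissible arc among them. For `i = m` this is the
  -- hypothesis on `M'` in `SolveInv.solved`.
  refine Runs.seq (runs_forLoop (fun i s' => ∀ v,
    (s'.arr 27 v = s₂.arr 27 v ∧ ∀ j < i, src j = v → s₂.arr 24 v = lw v →
      s₂.arr 24 (tgt j) ≠ s₂.arr 24 v) ∨
    ∃ j < i, src j = v ∧ tgt j = s'.arr 27 v ∧ s₂.arr 24 v = lw v ∧
      s₂.arr 24 (tgt j) = s₂.arr 24 v) 50 (B := 200 * (n + m) + 200)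
    (N := m) (by rw [hf₂.reg 1 (by decide), hf₁.reg 1 (by decide), hm]) rfl
    (by decide) (by decide) (by simp [moveBody, Prog.bound, Expr.cost, Test.cost]) ?_ ?_
    (by omega)) ?_
  · intro v; exact .inl ⟨rfl, fun j hj => by omega⟩
  · intro i hi s' hf h16 h v
    have e1 : s'.arr 1 = src := by rw [hf.arr 1 (by decide), hfa₂ 1 (by decide), hs1]
    have e2 : s'.arr 2 = tgt := by rw [hf.arr 2 (by decide), hfa₂ 2 (by decide), hs2]
    have e28 : s'.arr 28 = lw := by rw [hf.arr 28 (by decide), hfa₂ 28 (by decide), hsl]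
    have e24 : s'.arr 24 = s₂.arr 24 := hf.arr 24 (by decide)
    by_cases hc : s₂.arr 24 (src i) = lw (src i) ∧ s₂.arr 24 (tgt i) = s₂.arr 24 (src i)
    · by_cases hv : v = src i
      · refine .inr ⟨i, by omega, hv.symm, ?_, ?_, ?_⟩
        · simp [moveBody, Prog.eval, Test.holds, Expr.eval, h16, e1, e2, e28, e24, hc.1, hc.2, hv]
        · rw [hv]; exact hc.1
        · rw [hv]; exact hc.2
      · have e : (moveBody.eval s').arr 27 v = s'.arr 27 v := by
          have hc2 : s₂.arr 24 (tgt i) = lw (src i) := hc.2.trans hc.1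
          simp [moveBody, Prog.eval, Test.holds, Expr.eval, h16, e1, e2, e28, e24, hc.1, hc2, hv]
        simp only [e]
        rcases h v with ⟨h1, h2⟩ | ⟨j, hj, h1⟩
        · refine .inl ⟨h1, fun j hj hjv => ?_⟩
          have : j ≠ i := by rintro rfl; exact hv hjv.symm
          exact h2 j (by omega) hjv
        · exact .inr ⟨j, by omega, h1⟩
    · have e : (moveBody.eval s').arr 27 v = s'.arr 27 v := by
        simp [moveBody, Prog.eval, Test.holds, Expr.eval, h16, e1, e2, e28, e24, hc]
      simp only [e]
      rcases h v with ⟨h1, h2⟩ | ⟨j, hj, h1⟩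
      · refine .inl ⟨h1, fun j hj hjv hl he => ?_⟩
        by_cases hji : j = i
        · subst hji; subst hjv; exact hc ⟨hl, he⟩
        · exact h2 j (by omega) hjv hl he
      · exact .inr ⟨j, by omega, h1⟩
  rintro s₃ r₃ hf₃ ⟨h₃, hr₃⟩
  have hsol := h₂.solved hO hA h₃
  refine Runs.seq (runs_forLoop (fun i s' => ∀ v < i, s'.arr 0 v = s₃.arr 27 v) 20 (N := n)
    (B := 100) (by rw [hf₃.reg 0 (by decide), hf₂.reg 0 (by decide), hf₁.reg 0 (by decide), hn])
    rfl (by decide) (by decide) (by simp [Prog.bound, Expr.cost]) (by simp) ?_ (by omega)) ?_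
  · intro i _ s' hf h16 h v hv
    have e27 : s'.arr 27 = s₃.arr 27 := hf.arr 27 (by decide)
    by_cases hvi : v = i
    · simp [Prog.eval, Expr.eval, h16, hvi, e27]
    · simp [Prog.eval, Expr.eval, h16, hvi, h v (by omega)]
  rintro s₄ r₄ hf₄ ⟨h₄, hr₄⟩
  -- The winners `1` and `2` become the output codes `0` and `1`. Only now may the strategy occupy
  -- array `0`, whose owners are no longer needed.
  refine Runs.straight rfl (by simp [Prog.bound, Expr.cost]; omega)
    ⟨_, _, _, hsol, ?_, by simpa [Prog.eval] using h₄⟩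
  have e2 : s₄.reg 2 = s.reg 2 := by
    rw [hf₄.reg 2 (by decide), hf₃.reg 2 (by decide), hf₂.reg 2 (by decide), hf₁.reg 2 (by decide)]
  have e24 : s₄.arr 24 = s₂.arr 24 := by rw [hf₄.arr 24 (by decide), hf₃.arr 24 (by decide)]
  simp [Prog.eval, Expr.eval, e2, e24]

end Ram

namespace GameStructure

/-! ### Certificates for winning positions -/

section Certificate

variable {V : Type u} {Γ : GameStructure V}

/-- The positions are divided into those won by Alice and those won by Bob, and the moves `mv` of a
player keep the play in positions won by that player; a rank decreases along the positions that are
not labelled by their winner. -/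
structure Cert (Γ : GameStructure V) (lab win : V → Player) (mv : V → V) (rk : V → ℕ) : Prop where
  adj : ∀ v ∉ Γ.VT, Γ.Adj v (mv v)
  term : ∀ v ∈ Γ.VT, win v = lab v
  self : ∀ v ∉ Γ.VT, Γ.owner v = win v → win (mv v) = win v ∧ (lab v = win v ∨ rk (mv v) < rk v)
  opp : ∀ v, Γ.owner v ≠ win v → ∀ w, Γ.Adj v w → win w = win v ∧ (lab v = win v ∨ rk w < rk v)

/-- Alice wins the plays whose positions are eventually labelled by her, and Bob wins the plays
whose positions are eventually labelled by him. -/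
def IsLabelling {Ω : Type*} (g : Γ.StratA → Γ.StratB → Ω) (ΩA : Set Ω) (lab : V → Player) : Prop :=
  ∀ x y, (g x y ∈ ΩA → ∀ᶠ k in Filter.atTop, lab (Γ.play x y k) = Player.alice) ∧
    (g x y ∉ ΩA → ∀ᶠ k in Filter.atTop, lab (Γ.play x y k) = Player.bob)

theorem not_mem_VT {v : V} : v ∉ Γ.VT ↔ ∃ w, Γ.Adj v w := by
  simp [VT]

/-- If the player `win Γ.init` follows `mv`, every position of the play is won by that player. Were
the eventual label `p` different, the play would not reach a terminal, where label and winner agree,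
and the rank would drop at each late step. -/
theorem Cert.eventually_eq {lab win : V → Player} {mv : V → V} {rk : V → ℕ}
    (h : Γ.Cert lab win mv rk) {x : Γ.StratA} {y : Γ.StratB}
    (hf : ∀ v ∉ Γ.VT, Γ.owner v = win Γ.init → Γ.step x y v = mv v) {p : Player}
    (hp : ∀ᶠ k in Filter.atTop, lab (Γ.play x y k) = p) : p = win Γ.init := by
  have hstep : ∀ v ∉ Γ.VT, win v = win Γ.init → win (Γ.step x y v) = win v ∧
      (lab v = win v ∨ rk (Γ.step x y v) < rk v) := by
    intro v hv hw
    by_cases ho : Γ.owner v = win v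
    · rw [hf v hv (ho.trans hw)]; exact h.self v hv ho
    · exact h.opp v ho _ (Γ.adj_step hv)
  have hwin : ∀ k, win (Γ.play x y k) = win Γ.init := by
    intro k
    induction k with
    | zero => rfl
    | succ k ih =>
      rw [play_succ]
      by_cases hv : Γ.play x y k ∈ Γ.VT
      · rw [Γ.step_of_mem_VT hv, ih]
      · rw [(hstep _ hv ih).1, ih]
  obtain ⟨k₀, hk₀⟩ := Filter.eventually_atTop.1 hp
  by_contra hne
  have hdec : ∀ j, rk (Γ.play x y (k₀ + j)) + j ≤ rk (Γ.play x y k₀) := by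
    intro j
    induction j with
    | zero => simp
    | succ j ih =>
      have hl := hk₀ (k₀ + j) (by omega)
      have hlw : lab (Γ.play x y (k₀ + j)) ≠ win (Γ.play x y (k₀ + j)) := by
        rw [hl, hwin]; exact hne
      have hv : Γ.play x y (k₀ + j) ∉ Γ.VT := fun hv => hlw (h.term _ hv).symm
      have := (hstep _ hv (hwin _)).2.resolve_left hlw
      rw [← add_assoc k₀, play_succ]
      omega
  have := hdec (rk (Γ.play x y k₀) + 1)
  omega

theorem Cert.winsAlice {lab win : V → Player} {mv : V → V} {rk : V → ℕ}
    (h : Γ.Cert lab win mv rk) {Ω : Type*} {g : Γ.StratA → Γ.StratB → Ω} {ΩA : Set Ω}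
    (hg : IsLabelling g ΩA lab) (hw : win Γ.init = Player.alice) :
    WinsAlice g ΩA fun v => ⟨mv v.1, h.adj v.1 (not_mem_VT.2 v.2.1)⟩ := by
  intro y
  by_contra hn
  have := h.eventually_eq (y := y) (fun v hv ho => ?_) ((hg _ y).2 hn)
  · rw [hw] at this; exact Player.noConfusion this
  · have hA : v ∈ Γ.VA := ⟨not_mem_VT.1 hv, ho.trans hw⟩
    simp [step, hA]

theorem Cert.winsBob {lab win : V → Player} {mv : V → V} {rk : V → ℕ}
    (h : Γ.Cert lab win mv rk) {Ω : Type*} {g : Γ.StratA → Γ.StratB → Ω} {ΩA : Set Ω}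
    (hg : IsLabelling g ΩA lab) (hw : win Γ.init = Player.bob) :
    WinsBob g ΩA fun v => ⟨mv v.1, h.adj v.1 (not_mem_VT.2 v.2.1)⟩ := by
  intro x hn
  have := h.eventually_eq (x := x) (fun v hv ho => ?_) ((hg x _).1 hn)
  · rw [hw] at this; exact Player.noConfusion this
  · have hB : v ∈ Γ.VB := ⟨not_mem_VT.1 hv, ho.trans hw⟩
    have hA : v ∉ Γ.VA := fun hA => by
      have := hA.2.symm.trans hB.2
      exact Player.noConfusion this
    simp [step, hA, hB]

open Classical in
/-- Labels for a game on the terminals and infinite plays. -/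
noncomputable def dggsLabel (Γ : GameStructure V) (ΩA : Set Γ.DggsOutcome) (v : V) : Player :=
  if (if h : v ∈ Γ.VT then some ⟨v, h⟩ else none : Γ.DggsOutcome) ∈ ΩA then .alice else .bob

open Classical in
/-- Labels for a game on the strongly connected components. -/
noncomputable def msLabel (Γ : GameStructure V) (ΩA : Set Γ.MsOutcome) (v : V) : Player :=
  if ∃ ω ∈ ΩA, v ∈ ω.1 then .alice else .bob

theorem isLabelling_dggs (ΩA : Set Γ.DggsOutcome) :
    IsLabelling Γ.dggsForm ΩA (Γ.dggsLabel ΩA) := by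
  classical
  intro x y
  have key : ∀ᶠ k in Filter.atTop, (if h : Γ.play x y k ∈ Γ.VT then some ⟨_, h⟩ else none) =
      Γ.dggsForm x y := by
    by_cases h : ∃ k, Γ.play x y k ∈ Γ.VT
    · filter_upwards [Filter.eventually_ge_atTop (Nat.find h)] with k hk
      obtain ⟨j, rfl⟩ := Nat.exists_eq_add_of_le hk
      have hv := Nat.find_spec h
      have e := Γ.play_eq_of_mem_VT hv j
      have hv' : Γ.play x y (Nat.find h + j) ∈ Γ.VT := by rwa [e]
      rw [dif_pos hv', dggsForm, dif_pos h]
      exact congrArg some (Subtype.ext e)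
    · refine Filter.Eventually.of_forall fun k => ?_
      rw [dif_neg fun hk => h ⟨k, hk⟩, dggsForm, dif_neg h]
  constructor
  · intro hg
    filter_upwards [key] with k hk
    simp only [dggsLabel, hk, hg, if_true]
  · intro hg
    filter_upwards [key] with k hk
    simp only [dggsLabel, hk, hg, if_false]

theorem isLabelling_ms [Finite V] (ΩA : Set Γ.MsOutcome) :
    IsLabelling Γ.msForm ΩA (Γ.msLabel ΩA) := by
  intro x y
  have key : ∀ᶠ k in Filter.atTop, Γ.play x y k ∈ (Γ.msForm x y).1 :=
    (Γ.existsUnique_msOutcome x y).choose_spec.1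
  constructor
  · intro hg
    filter_upwards [key] with k hk
    exact if_pos ⟨_, hg, hk⟩
  · intro hg
    filter_upwards [key] with k hk
    refine if_neg ?_
    rintro ⟨ω, hω, hm⟩
    -- Components that share a position coincide, so an outcome in `ΩA` cannot contain a late
    -- position of a play that ends in another one.
    have : ω = Γ.msForm x y :=
      Subtype.ext ((ω.2.1.eq_scc hm).trans ((Γ.msForm x y).2.1.eq_scc hk).symm)
    exact hg (this ▸ hω)

/-- Two distinct mutually reachable positions both have moves, so both carry the label of `c`. -/
theorem dggsLabel_eq (ΩA : Set Γ.DggsOutcome) {v w : V} (h : Relation.ReflTransGen Γ.Adj v w)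
    (h' : Relation.ReflTransGen Γ.Adj w v) : Γ.dggsLabel ΩA v = Γ.dggsLabel ΩA w := by
  rcases h.cases_head with rfl | ⟨a, ha, -⟩
  · rfl
  · rcases h'.cases_head with rfl | ⟨b, hb, -⟩
    · rfl
    · rw [dggsLabel, dggsLabel, dif_neg (not_mem_VT.2 ⟨a, ha⟩), dif_neg (not_mem_VT.2 ⟨b, hb⟩)]

theorem msLabel_eq (ΩA : Set Γ.MsOutcome) {v w : V} (h : Relation.ReflTransGen Γ.Adj v w)
    (h' : Relation.ReflTransGen Γ.Adj w v) : Γ.msLabel ΩA v = Γ.msLabel ΩA w := by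
  have key : ∀ ω : Γ.MsOutcome, v ∈ ω.1 ↔ w ∈ ω.1 := by
    intro ω
    constructor
    · intro hv
      rw [ω.2.1.eq_scc hv]; exact ⟨h, h'⟩
    · intro hw
      rw [ω.2.1.eq_scc hw]; exact ⟨h', h⟩
  classical
  unfold msLabel
  exact if_congr (by simp only [key]) rfl rfl

theorem Cert.winsAlice_or_winsBob {lab win : V → Player} {mv : V → V} {rk : V → ℕ}
    (h : Γ.Cert lab win mv rk) {Ω : Type*} {g : Γ.StratA → Γ.StratB → Ω} {ΩA : Set Ω}
    (hg : IsLabelling g ΩA lab) : (∃ x, WinsAlice g ΩA x) ∨ ∃ y, WinsBob g ΩA y := by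
  cases hw : win Γ.init with
  | alice => exact .inl ⟨_, h.winsAlice hg hw⟩
  | bob => exact .inr ⟨_, h.winsBob hg hw⟩

theorem Cert.holdsSolution {n : ℕ} {Γ : GameStructure (Fin n)} {lab win : Fin n → Player}
    {mv : Fin n → Fin n} {rk : Fin n → ℕ} (h : Γ.Cert lab win mv rk) {Ω : Type*}
    {g : Γ.StratA → Γ.StratB → Ω} {ΩA : Set Ω} (hg : IsLabelling g ΩA lab) {s : Ram.Memory}
    (h0 : s.reg 0 = playerCode (win Γ.init)) (hm : ∀ v ∉ Γ.VT, s.arr 0 (v : ℕ) = mv v) :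
    Γ.HoldsSolution g ΩA s := by
  cases hw : win Γ.init with
  | alice =>
    exact .inl ⟨by rw [h0, hw]; rfl, _, h.winsAlice hg hw, fun v => hm v.1 (not_mem_VT.2 v.2.1)⟩
  | bob =>
    exact .inr ⟨by rw [h0, hw]; rfl, _, h.winsBob hg hw, fun v => hm v.1 (not_mem_VT.2 v.2.1)⟩

end Certificate

end GameStructure

/-- A game form all of whose `±1` games are determined is tight. -/
theorem isTight_of_determined {X Y Ω : Type*} (g : X → Y → Ω)
    (h : ∀ ΩA : Set Ω, (∃ x, WinsAlice g ΩA x) ∨ ∃ y, WinsBob g ΩA y) : IsTight g := by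
  intro φ ψ
  -- Alice is given the outcomes that Bob's response `φ` avoids, so she cannot win. A winning `y` of
  -- Bob forces all outcomes into the range of `φ`'s graph, in particular the one against `ψ y`.
  rcases h (Set.range fun x => g x (φ x))ᶜ with ⟨x, hx⟩ | ⟨y, hy⟩
  · exact absurd ⟨x, rfl⟩ (hx (φ x))
  · exact ⟨g (ψ y) y, by simpa using hy (ψ y), y, rfl⟩

namespace GameStructure

open Ram

/-! ### The solver -/

section Solver

variable {n : ℕ} {Γ : GameStructure (Fin n)} {l : List (Fin n × Fin n)} {c : ℕ} {label : Fin n → ℕ}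

theorem encode_tail {j : ℕ} (hj : j < l.length) : (Γ.encode l c label).arr 1 j = l[j].1 := by
  simp [encode, hj]

theorem encode_head {j : ℕ} (hj : j < l.length) : (Γ.encode l c label).arr 2 j = l[j].2 := by
  simp [encode, hj]

theorem encode_zero {a : ℕ} (ha : 4 ≤ a) : (Γ.encode l c label).arr a = fun _ => 0 := by
  obtain ⟨b, rfl⟩ := Nat.exists_eq_add_of_le' ha
  rfl

theorem encode_bound : ∀ j < l.length, (Γ.encode l c label).arr 1 j < n ∧
    (Γ.encode l c label).arr 2 j < n := by
  intro j hj
  rw [encode_tail hj, encode_head hj]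
  exact ⟨l[j].1.2, l[j].2.2⟩

theorem encode_arc (hl : Γ.IsArcList l) {a b : ℕ} :
    Arc l.length ((Γ.encode l c label).arr 1) ((Γ.encode l c label).arr 2) a b ↔
      ∃ (ha : a < n) (hb : b < n), Γ.Adj ⟨a, ha⟩ ⟨b, hb⟩ := by
  constructor
  · rintro ⟨j, hj, e1, e2⟩
    rw [encode_tail hj] at e1
    rw [encode_head hj] at e2
    subst e1 e2
    exact ⟨l[j].1.2, l[j].2.2, (hl.2 _ _).1 (List.getElem_mem hj)⟩
  · rintro ⟨ha, hb, hab⟩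
    obtain ⟨j, hj, e⟩ := List.getElem_of_mem ((hl.2 _ _).2 hab)
    exact ⟨j, hj, by rw [encode_tail hj, e], by rw [encode_head hj, e]⟩

theorem encode_arc_fin (hl : Γ.IsArcList l) {v w : Fin n} :
    Arc l.length ((Γ.encode l c label).arr 1) ((Γ.encode l c label).arr 2) v w ↔ Γ.Adj v w :=
  (encode_arc hl).trans ⟨fun ⟨_, _, h⟩ => h, fun h => ⟨v.2, w.2, h⟩⟩

theorem encode_source (hl : Γ.IsArcList l) {v : Fin n} :
    (∃ j < l.length, (Γ.encode l c label).arr 1 j = v) ↔ v ∉ Γ.VT := by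
  rw [not_mem_VT]
  constructor
  · rintro ⟨j, hj, e⟩
    obtain ⟨_, hb, h⟩ := (encode_arc hl).1 ⟨j, hj, e, rfl⟩
    exact ⟨_, h⟩
  · rintro ⟨w, hw⟩
    obtain ⟨j, hj, e, -⟩ := (encode_arc_fin (c := c) (label := label) hl).2 hw
    exact ⟨j, hj, e⟩

theorem encode_reach (hl : Γ.IsArcList l) {v w : Fin n} :
    Reach l.length ((Γ.encode l c label).arr 1) ((Γ.encode l c label).arr 2) v w ↔
      Relation.ReflTransGen Γ.Adj v w := by
  constructor
  · intro h
    have key : ∀ b, Reach l.length ((Γ.encode l c label).arr 1) ((Γ.encode l c label).arr 2) v b →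
        ∀ hb : b < n, Relation.ReflTransGen Γ.Adj v ⟨b, hb⟩ := by
      intro b hb
      induction hb with
      | refl => intro _; exact .refl
      | tail _ h ih =>
        intro hb
        obtain ⟨ha, _, h⟩ := (encode_arc hl).1 h
        exact (ih ha).tail h
    exact key w h w.2
  · intro h
    induction h with
    | refl => exact .refl
    | tail _ h ih => exact ih.tail ((encode_arc_fin hl).2 h)

theorem encode_owner (v : Fin n) : (Γ.encode l c label).arr 0 v = playerCode (Γ.owner v) := by
  simp [encode]

theorem playerCode_le (p : Player) : playerCode p ≤ 1 := by cases p <;> simp [playerCode]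

theorem playerCode_inj {p q : Player} (h : playerCode p = playerCode q) : p = q := by
  cases p <;> cases q <;> simp_all [playerCode]

theorem exists_playerCode {a : ℕ} (h0 : a ≠ 0) (h2 : a ≤ 2) : ∃ p, a = playerCode p + 1 := by
  rcases (by omega : a = 1 ∨ a = 2) with rfl | rfl
  · exact ⟨.alice, rfl⟩
  · exact ⟨.bob, rfl⟩

theorem cert_of_solved (hl : Γ.IsArcList l) {lab : Fin n → Player} {lw W M rk : ℕ → ℕ}
    (hlw : ∀ v : Fin n, lw v = playerCode (lab v) + 1)
    (h : Solved n l.length ((Γ.encode l c label).arr 1) ((Γ.encode l c label).arr 2)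
      ((Γ.encode l c label).arr 0) lw W M rk) :
    ∃ win mv rk', Γ.Cert lab win mv rk' ∧ (∀ v : Fin n, W v = playerCode (win v) + 1) ∧
      ∀ v ∉ Γ.VT, M (v : ℕ) = mv v := by
  choose win hwin using fun v : Fin n => exists_playerCode (h.W_ne v v.2) (h.W_le v v.2)
  have hW : ∀ v w : Fin n, W v = W w ↔ win v = win w := by
    intro v w
    rw [hwin, hwin]
    exact ⟨fun e => playerCode_inj (by omega), fun e => by rw [e]⟩
  have hL : ∀ v : Fin n, lw v = W v ↔ lab v = win v := by
    intro v
    rw [hlw, hwin]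
    exact ⟨fun e => playerCode_inj (by omega), fun e => by rw [e]⟩
  have hown : ∀ v : Fin n, (Γ.encode l c label).arr 0 v + 1 = W v ↔ Γ.owner v = win v := by
    intro v
    rw [encode_owner, hwin]
    exact ⟨fun e => playerCode_inj (by omega), fun e => by rw [e]⟩
  have hmv : ∀ v : Fin n, ∃ w : Fin n, v ∉ Γ.VT → Γ.Adj v w ∧ M v = w := by
    intro v
    by_cases hv : v ∈ Γ.VT
    · exact ⟨v, fun h' => absurd hv h'⟩
    · obtain ⟨_, hb, ha⟩ := (encode_arc hl).1 (h.move v ((encode_source hl).2 hv))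
      exact ⟨⟨M v, hb⟩, fun _ => ⟨ha, rfl⟩⟩
  choose mv hmv using hmv
  refine ⟨win, mv, fun v => rk v, ⟨fun v hv => (hmv v hv).1, ?_, ?_, ?_⟩, hwin,
    fun v hv => (hmv v hv).2⟩
  · intro v hv
    refine ((hL v).1 (h.term v v.2 fun j hj e => ?_).symm).symm
    exact (encode_source hl).1 ⟨j, hj, e⟩ hv
  · intro v hv ho
    obtain ⟨h1, h2⟩ := h.self v ((encode_source hl).2 hv) ((hown v).2 ho)
    rw [(hmv v hv).2] at h1 h2
    exact ⟨(hW _ _).1 h1, h2.imp_left (hL v).1⟩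
  · intro v ho w hw
    obtain ⟨h1, h2⟩ := h.opp v (fun e => ho ((hown v).1 e)) w ((encode_arc_fin hl).2 hw)
    exact ⟨(hW _ _).1 h1, h2.imp_left (hL v).1⟩

/-- Solution of a `±1` game; the loop body `lb` determines the winners of infinite plays. -/
def solver (lb : Prog) : Prog := .seq sccProg (.seq (forLoop 0 lb) solveProg)

/-- The two game forms differ only in how labels are computed, so the labelling program `lb` is a
parameter. It may write to array `28` only, which leaves the results of `sccProg` intact. -/
theorem runs_solver (hl : Γ.IsArcList l) {lab : Fin n → Player} {lb : Prog}
    (hlab : ∀ v w, Relation.ReflTransGen Γ.Adj v w → Relation.ReflTransGen Γ.Adj w v →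
      lab v = lab w)
    (hs : lb.straight = true) (hr : lb.regs = []) (ha : ∀ a ∈ lb.arrs, a = 28) (hb : lb.bound ≤ 50)
    (hlb : ∀ (v : Fin n) (s : Memory), s.reg 3 = c → s.reg 16 = v →
      s.arr 3 = (Γ.encode l c label).arr 3 → (s.arr 25 v = 0 ↔ v ∈ Γ.VT) →
      (lb.eval s).arr 28 = Function.update (s.arr 28) v (playerCode (lab v) + 1)) :
    HaltsWithin (solver lb) (Γ.encode l c label) (5000 * (n + l.length)) fun s' =>
      ∃ win mv rk, Γ.Cert lab win mv rk ∧ s'.reg 0 = playerCode (win Γ.init) ∧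
        ∀ v ∉ Γ.VT, s'.arr 0 (v : ℕ) = mv v := by
  apply Runs.haltsWithin
  -- The initial position makes `n` positive, so a multiple of `n` absorbs all additive constants.
  have hn0 : 0 < n := Γ.init.pos
  refine Runs.seq (runs_sccProg (n := n) (m := l.length) (B := 3000 * (n + l.length)) rfl rfl
    (fun a ha => encode_zero ha) encode_bound (by omega)) ?_
  rintro s₁ r₁ hf₁ ⟨⟨hscc, s₀, hL, hs₀⟩, hr₁⟩
  have z28 : s₁.arr 28 = fun _ => 0 := by rw [hf₁.arr 28 (by decide), encode_zero (by omega)]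
  have hna : ∀ a ≠ 28, a ∉ (forLoop 0 lb).arrs := fun a ha' h => ha' (ha a (by
    simpa [forLoop, Prog.arrs] using h))
  have hnr : ∀ r ≠ 16, r ∉ (forLoop 0 lb).regs := fun r hr' h => hr' (by
    simpa [forLoop, Prog.regs, hr] using h)
  refine Runs.seq (runs_forLoop (fun i s' => ∀ v : Fin n, (v : ℕ) < i →
    s'.arr 28 v = playerCode (lab v) + 1) 50 (N := n) (B := 2000 * (n + l.length))
    (hf₁.reg 0 (by decide)) hs (by simp [hr]) (by simp [hr]) hb (fun v hv => by omega) ?_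
    (by omega)) ?_
  · intro i hi s' hf h16 h v hv
    have h3 : s'.reg 3 = c := by
      rw [hf.reg 3 (hnr 3 (by decide)), hf₁.reg 3 (by decide)]; rfl
    have ha3 : s'.arr 3 = (Γ.encode l c label).arr 3 := by
      rw [hf.arr 3 (hna 3 (by decide)), hf₁.arr 3 (by decide)]
    have h25 : s'.arr 25 i = 0 ↔ (⟨i, hi⟩ : Fin n) ∈ Γ.VT := by
      rw [hf.arr 25 (hna 25 (by decide)), hs₀ 25 (by decide), hL.deg, Finset.card_eq_zero,
        ← not_iff_not, ← encode_source (c := c) (label := label) hl, Finset.filter_eq_empty_iff]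
      simp
    have e := hlb ⟨i, hi⟩ s' h3 h16 ha3 h25
    change (lb.eval s').arr 28 v = _
    rw [e]
    by_cases hvi : (v : ℕ) = i
    · subst hvi; rw [Function.update_self]
    · rw [Function.update_of_ne hvi]; exact h v (by omega)
  rintro s₂ r₂ hf₂ ⟨h₂, hr₂⟩
  have e₂ : ∀ a, a ≠ 28 → s₂.arr a = s₁.arr a := fun a ha' => hf₂.arr a (hna a ha')
  have e₁ : ∀ a, a ∉ sccProg.arrs → a ≠ 28 → s₂.arr a = (Γ.encode l c label).arr a :=
    fun a ha' h28 => (e₂ a h28).trans (hf₁.arr a ha')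
  have hA : ∀ j < l.length, _ := encode_bound (Γ := Γ) (l := l) (c := c) (label := label)
  refine Runs.frame (runs_solveProg (n := n) (m := l.length) (O := s₂.arr 22) (lw := s₂.arr 28)
    (s₀ := s₀) ?_ ?_ hA ?_ ?_ ?_ ?_ hL ?_ rfl (e₁ 1 (by decide) (by decide))
    (e₁ 2 (by decide) (by decide)) (e₁ 0 (by decide) (by decide)) rfl ?_ (by omega)) ?_
  · rw [hf₂.reg 0 (hnr 0 (by decide)), hf₁.reg 0 (by decide)]; rfl
  · rw [hf₂.reg 1 (hnr 1 (by decide)), hf₁.reg 1 (by decide)]; rfl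
  · rw [e₂ 22 (by decide)]; exact hscc.enum
  · intro v hv
    exact (encode_owner (⟨v, hv⟩ : Fin n)).trans_le (playerCode_le _)
  · intro v hv
    have := h₂ ⟨v, hv⟩ hv
    have h1 := playerCode_le (lab ⟨v, hv⟩)
    simp only at this
    omega
  · rw [e₂ 22 (by decide)]
    intro x y hxy hy harc z hxz hzy
    -- An arc that goes back in the order squeezes the component numbers of all positions between
    -- its ends to a single value, so they lie in one component and share the label.
    have h1 := hscc.mono _ _ harc
    have h2 := hscc.F_mono x z hxz (by omega)
    have h3 := hscc.F_mono z y hzy hy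
    have hz := hscc.enum.1 z (by omega)
    have hy' := hscc.enum.1 y hy
    obtain ⟨r1, r2⟩ := (hscc.eq_iff _ hz _ hy').1 (by omega)
    have := hlab ⟨_, hz⟩ ⟨_, hy'⟩ ((encode_reach hl).1 r1) ((encode_reach hl).1 r2)
    rw [h₂ ⟨_, hz⟩ hz, h₂ ⟨_, hy'⟩ hy', this]
  · intro a ha'
    rw [e₂ a (by rintro rfl; revert ha'; decide), hs₀ a ha']
  · rw [e₁ 24 (by decide) (by decide), encode_zero (by omega)]
  · rintro s₃ r₃ hf₃ ⟨W, M, rk, hsol, h0, hM⟩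
    obtain ⟨win, mv, rk', hc, hw, hmv⟩ := cert_of_solved hl (fun v => h₂ v v.2) hsol
    refine ⟨win, mv, rk', hc, ?_, fun v hv => (hM v v.2).trans (hmv v hv)⟩
    have : s₂.reg 2 = Γ.init := by
      rw [hf₂.reg 2 (hnr 2 (by decide)), hf₁.reg 2 (by decide)]; rfl
    rw [h0, this, hw]; rfl

/-- Writes into array `28` the winner that the value of `e` tells. -/
def labelBody (e : Expr) : Prog :=
  .ite (.eq e (.const 1)) (.write 28 (.reg 16) (.const 1)) (.write 28 (.reg 16) (.const 2))

def msLabelBody : Prog := labelBody (.read 3 (.reg 16))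

/-- The counters in array `25` are still the out-degrees at this stage, so the value `0` identifies
the terminals. -/
def dggsLabelBody : Prog :=
  .ite (.eq (.read 25 (.reg 16)) (.const 0)) (labelBody (.read 3 (.reg 16))) (labelBody (.reg 3))

/-- Stated for any labelling that is constant on components, not just for `msLabel`, so that it also
supplies the certificates in `exists_cert`. -/
theorem halts_solver_ms (hl : Γ.IsArcList l) {lab : Fin n → Player}
    (hlab : ∀ v w, Relation.ReflTransGen Γ.Adj v w → Relation.ReflTransGen Γ.Adj w v →
      lab v = lab w)
    (hlabel : ∀ v, label v = 1 ↔ lab v = .alice) :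
    HaltsWithin (solver msLabelBody) (Γ.encode l c label) (5000 * (n + l.length)) fun s' =>
      ∃ win mv rk, Γ.Cert lab win mv rk ∧ s'.reg 0 = playerCode (win Γ.init) ∧
        ∀ v ∉ Γ.VT, s'.arr 0 (v : ℕ) = mv v := by
  refine runs_solver hl hlab rfl rfl (by simp [msLabelBody, labelBody, Prog.arrs]) ?_ ?_
  · simp [msLabelBody, labelBody, Prog.bound, Expr.cost, Test.cost]
  · intro v s _ h16 h3 _
    have e : (Γ.encode l c label).arr 3 v = label v := by simp [encode]
    cases hv : lab v with
    | alice =>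
      simp [msLabelBody, labelBody, Prog.eval, Test.holds, Expr.eval, h16, h3, e, (hlabel v).2 hv,
        playerCode]
    | bob =>
      have : label v ≠ 1 := fun h => by
        have := hv.symm.trans ((hlabel v).1 h)
        exact Player.noConfusion this
      simp [msLabelBody, labelBody, Prog.eval, Test.holds, Expr.eval, h16, h3, e, this, playerCode]

open Classical in
theorem halts_solver_dggs (hl : Γ.IsArcList l) {lab : Fin n → Player}
    (hlab : ∀ v w, Relation.ReflTransGen Γ.Adj v w → Relation.ReflTransGen Γ.Adj w v →
      lab v = lab w)
    (hlabel : ∀ v, (if v ∈ Γ.VT then label v else c) = 1 ↔ lab v = .alice) :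
    HaltsWithin (solver dggsLabelBody) (Γ.encode l c label) (5000 * (n + l.length)) fun s' =>
      ∃ win mv rk, Γ.Cert lab win mv rk ∧ s'.reg 0 = playerCode (win Γ.init) ∧
        ∀ v ∉ Γ.VT, s'.arr 0 (v : ℕ) = mv v := by
  refine runs_solver hl hlab rfl rfl (by simp [dggsLabelBody, labelBody, Prog.arrs]) ?_ ?_
  · simp [dggsLabelBody, labelBody, Prog.bound, Expr.cost, Test.cost]
  · intro v s hc h16 h3 h25
    have e : (Γ.encode l c label).arr 3 v = label v := by simp [encode]
    have h := hlabel v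
    by_cases hT : v ∈ Γ.VT <;> simp only [hT, if_true, if_false] at h <;>
      simp only [hT, iff_true, iff_false] at h25 <;> cases hv : lab v <;>
      simp only [hv, iff_true, reduceCtorEq, iff_false] at h <;>
      simp [dggsLabelBody, labelBody, Prog.eval, Test.holds, Expr.eval, h16, h3, e, h, h25, hc,
        playerCode]

end Solver

/-! ### Determinacy -/

/-- Every finite game structure whose labels are constant on the strongly connected components has a
certificate. -/
theorem exists_cert {V : Type u} [Finite V] (Γ : GameStructure V) {lab : V → Player}
    (hlab : ∀ v w, Relation.ReflTransGen Γ.Adj v w → Relation.ReflTransGen Γ.Adj w v →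
      lab v = lab w) : ∃ win mv rk, Γ.Cert lab win mv rk := by
  classical
  obtain ⟨n, ⟨e⟩⟩ := Finite.exists_equiv_fin V
  let Γ' : GameStructure (Fin n) :=
    { Adj := fun i j => Γ.Adj (e.symm i) (e.symm j)
      owner := fun i => Γ.owner (e.symm i)
      init := e Γ.init
      init_move := by
        obtain ⟨w, hw⟩ := Γ.init_move
        exact ⟨e w, by simpa using hw⟩ }
  have hA : ∀ i j, Γ'.Adj i j = Γ.Adj (e.symm i) (e.symm j) := fun _ _ => rfl
  have hr : ∀ i j, Relation.ReflTransGen Γ'.Adj i j →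
      Relation.ReflTransGen Γ.Adj (e.symm i) (e.symm j) := fun i j h =>
    Relation.ReflTransGen.lift e.symm (fun _ _ h => h) _ _ h
  let l : List (Fin n × Fin n) := (Finset.univ.filter fun p : Fin n × Fin n => Γ'.Adj p.1 p.2).toList
  have hl : Γ'.IsArcList l := ⟨Finset.nodup_toList _, fun v w => by simp [l]⟩
  -- The run itself is discarded; only the certificate in its postcondition is kept and carried back
  -- to `V`.
  obtain ⟨s, t, -, -, win, mv, rk, hc, -⟩ := halts_solver_ms (c := 0) hl
    (lab := fun i => lab (e.symm i))
    (label := fun i => if lab (e.symm i) = .alice then 1 else 0)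
    (fun v w h h' => hlab _ _ (hr _ _ h) (hr _ _ h')) (fun v => by simp)
  have hT : ∀ v, v ∈ Γ.VT ↔ e v ∈ Γ'.VT := by
    intro v
    rw [← not_iff_not, not_mem_VT, not_mem_VT]
    simp only [hA, Equiv.symm_apply_apply]
    exact ⟨fun ⟨w, hw⟩ => ⟨e w, by simpa using hw⟩, fun ⟨w, hw⟩ => ⟨_, hw⟩⟩
  refine ⟨fun v => win (e v), fun v => e.symm (mv (e v)), fun v => rk (e v), ⟨?_, ?_, ?_, ?_⟩⟩
  · intro v hv
    simpa [hA] using hc.adj (e v) (by rwa [← hT])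
  · intro v hv
    simpa using hc.term (e v) (by rwa [← hT])
  · intro v hv ho
    simpa using hc.self (e v) (by rwa [← hT]) (by simpa [Γ'] using ho)
  · intro v ho w hw
    simpa using hc.opp (e v) (by simpa [Γ'] using ho) (e w) (by simpa [hA] using hw)

theorem isTight_dggsForm {V : Type u} [Finite V] (Γ : GameStructure V) : IsTight Γ.dggsForm :=
  isTight_of_determined _ fun ΩA =>
    let ⟨_, _, _, h⟩ := Γ.exists_cert fun _ _ => dggsLabel_eq ΩA
    h.winsAlice_or_winsBob (isLabelling_dggs ΩA)

theorem isTight_msForm {V : Type u} [Finite V] (Γ : GameStructure V) : IsTight Γ.msForm :=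
  isTight_of_determined _ fun ΩA =>
    let ⟨_, _, _, h⟩ := Γ.exists_cert fun _ _ => msLabel_eq ΩA
    h.winsAlice_or_winsBob (isLabelling_ms ΩA)

theorem solves_dggs {n : ℕ} (Γ : GameStructure (Fin n)) {l : List (Fin n × Fin n)}
    (hl : Γ.IsArcList l) (ΩA : Set Γ.DggsOutcome) :
    HaltsWithin (solver dggsLabelBody) (Γ.encodeDggsGame l ΩA) (5000 * (n + l.length))
      (Γ.HoldsSolution Γ.dggsForm ΩA) := by
  classical
  obtain ⟨s, t, he, ht, win, mv, rk, hc, h0, hm⟩ := halts_solver_dggs hl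
    (fun _ _ => dggsLabel_eq ΩA) (c := if none ∈ ΩA then 1 else 0)
    (label := fun v => if ∃ h : v ∈ Γ.VT, some ⟨v, h⟩ ∈ ΩA then 1 else 0) (fun v => by
      by_cases hv : v ∈ Γ.VT <;> simp [dggsLabel, hv])
  refine ⟨s, t, ?_, ht, hc.holdsSolution (isLabelling_dggs ΩA) h0 hm⟩
  unfold encodeDggsGame
  convert he

theorem solves_ms {n : ℕ} (Γ : GameStructure (Fin n)) {l : List (Fin n × Fin n)}
    (hl : Γ.IsArcList l) (ΩA : Set Γ.MsOutcome) :
    HaltsWithin (solver msLabelBody) (Γ.encodeMsGame l ΩA) (5000 * (n + l.length))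
      (Γ.HoldsSolution Γ.msForm ΩA) := by
  classical
  obtain ⟨s, t, he, ht, win, mv, rk, hc, h0, hm⟩ := halts_solver_ms hl
    (fun _ _ => msLabel_eq ΩA) (c := 0)
    (label := fun v => if ∃ ω ∈ ΩA, v ∈ ω.1 then 1 else 0) (fun v => by simp [msLabel])
  refine ⟨s, t, ?_, ht, hc.holdsSolution (isLabelling_ms ΩA) h0 hm⟩
  unfold encodeMsGame
  convert he

end GameStructure

/-! ### Generation of the outcomes -/

/-- Programs list numbers, not outcomes. A repetition-free list of numbers with the same range as an
injective code enumerates the coded objects. -/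
theorem exists_equiv_of_codes {α : Type*} {N : ℕ} {a : Fin N → ℕ} (ha : Function.Injective a)
    {code : α → ℕ} (hc : Function.Injective code) (h₁ : ∀ i, ∃ x, code x = a i)
    (h₂ : ∀ x, ∃ i, a i = code x) : ∃ f : Fin N ≃ α, ∀ i, a i = code (f i) := by
  choose f hf using h₁
  refine ⟨Equiv.ofBijective f ⟨fun i j e => ha ?_, fun x => ?_⟩, fun i => (hf i).symm⟩
  · rw [← hf i, ← hf j, e]
  · obtain ⟨i, hi⟩ := h₂ x
    exact ⟨i, hc ((hf i).trans hi)⟩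

namespace GameStructure

open Ram

section Listing

variable {n : ℕ} {Γ : GameStructure (Fin n)} {l : List (Fin n × Fin n)}

/-- Lists the terminals and, at the end, the number of positions. -/
def dggsLister : Prog :=
  .seq (forLoop 1 (.write 4 (.read 1 (.reg 16)) (.const 1)))
  (.seq (forLoop 0 (.ite (.eq (.read 4 (.reg 16)) (.const 0))
    (.seq (.write 0 (.reg 20) (.reg 16)) (.assign 20 (.succ (.reg 20)))) .skip))
  (.seq (.write 0 (.reg 20) (.reg 0)) (.assign 0 (.succ (.reg 20)))))

/-- `a 0 < ⋯ < a (k - 1)` are the numbers below `i` with property `p`. -/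
structure ListsBelow (p : ℕ → Prop) (i k : ℕ) (a : ℕ → ℕ) : Prop where
  mem : ∀ q < k, a q < i ∧ p (a q)
  surj : ∀ v < i, p v → ∃ q < k, a q = v
  inj : ∀ q < k, ∀ r < k, a q = a r → q = r

theorem ListsBelow.push {p : ℕ → Prop} {i k : ℕ} {a : ℕ → ℕ} (h : ListsBelow p i k a) (hp : p i) :
    ListsBelow p (i + 1) (k + 1) (Function.update a k i) := by
  have ha : ∀ q < k, Function.update a k i q = a q := fun q hq =>
    Function.update_of_ne (by omega) _ _
  have hlt : ∀ q < k + 1, q < k ∨ q = k := fun q hq => by omega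
  refine ⟨fun q hq => ?_, fun v hv hpv => ?_, fun q hq r hr e => ?_⟩
  · rcases hlt q hq with hq | rfl
    · rw [ha q hq]; exact ⟨by have := (h.mem q hq).1; omega, (h.mem q hq).2⟩
    · rw [Function.update_self]; exact ⟨by omega, hp⟩
  · by_cases hvi : v = i
    · exact ⟨k, by omega, by rw [Function.update_self, hvi]⟩
    · obtain ⟨q, hq, e⟩ := h.surj v (by omega) hpv
      exact ⟨q, by omega, by rw [ha q hq, e]⟩
  · rcases hlt q hq with hq | rfl <;> rcases hlt r hr with hr | rfl
    · rw [ha q hq, ha r hr] at e; exact h.inj q hq r hr e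
    · rw [ha q hq, Function.update_self] at e; have := (h.mem q hq).1; omega
    · rw [ha r hr, Function.update_self] at e; have := (h.mem r hr).1; omega
    · rfl

theorem ListsBelow.skip {p : ℕ → Prop} {i k : ℕ} {a : ℕ → ℕ} (h : ListsBelow p i k a) (hp : ¬ p i) :
    ListsBelow p (i + 1) k a := by
  refine ⟨fun q hq => ⟨by have := (h.mem q hq).1; omega, (h.mem q hq).2⟩, fun v hv hpv => ?_, h.inj⟩
  exact h.surj v (by have : v ≠ i := by { rintro rfl; exact hp hpv }
                     omega) hpv

theorem listsDggsOutcomes_of {k : ℕ} {s : Memory} (hk : s.reg 0 = k + 1) {a : ℕ → ℕ}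
    (ha : ListsBelow (fun v => ∃ h : v < n, (⟨v, h⟩ : Fin n) ∈ Γ.VT) n k a)
    (hs : s.arr 0 = Function.update a k n) : Γ.ListsDggsOutcomes s := by
  have hlt : ∀ i : Fin (s.reg 0), (i : ℕ) < k ∨ (i : ℕ) = k := fun i => by have := i.2; omega
  have hau : ∀ q < k, Function.update a k n q = a q := fun q hq =>
    Function.update_of_ne (by omega) _ _
  refine exists_equiv_of_codes (a := fun i : Fin (s.reg 0) => s.arr 0 i)
    (code := fun ω : Γ.DggsOutcome => ω.elim n (fun v => (v.1 : ℕ))) ?_ ?_ ?_ ?_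
  · intro i j e
    simp only [hs] at e
    apply Fin.ext
    rcases hlt i with hi | hi <;> rcases hlt j with hj | hj
    · rw [hau _ hi, hau _ hj] at e; exact ha.inj _ hi _ hj e
    · rw [hau _ hi, hj, Function.update_self] at e; have := (ha.mem _ hi).1; omega
    · rw [hau _ hj, hi, Function.update_self] at e; have := (ha.mem _ hj).1; omega
    · omega
  · intro ω ω' e
    rcases ω with _ | v <;> rcases ω' with _ | w
    · rfl
    · have := w.1.2; simp only [Option.elim_none, Option.elim_some] at e; omega
    · have := v.1.2; simp only [Option.elim_none, Option.elim_some] at e; omega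
    · simp only [Option.elim_some] at e
      exact congrArg some (Subtype.ext (Fin.ext e))
  · intro i
    rcases hlt i with hi | hi
    · obtain ⟨h1, h2⟩ := (ha.mem _ hi).2
      exact ⟨some ⟨_, h2⟩, by simp [hs, hau _ hi]⟩
    · exact ⟨none, by simp [hs, hi]⟩
  · rintro (_ | v)
    · exact ⟨⟨k, by omega⟩, by simp [hs]⟩
    · obtain ⟨q, hq, e⟩ := ha.surj v.1 v.1.2 ⟨v.1.2, v.2⟩
      exact ⟨⟨q, by omega⟩, by simp [hs, hau q hq, e]⟩

theorem lists_dggs (hl : Γ.IsArcList l) :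
    HaltsWithin dggsLister (Γ.encodeStructure l) (1000 * (n + l.length)) Γ.ListsDggsOutcomes := by
  apply Runs.haltsWithin
  have hn0 : 0 < n := Γ.init.pos
  -- Array `4` marks the tails of arcs; the terminals are the positions left unmarked.
  refine Runs.seq (runs_forLoop (fun i s' => ∀ v, s'.arr 4 v ≠ 0 ↔
    ∃ j < i, (Γ.encodeStructure l).arr 1 j = v) 20 (N := l.length) (B := 500 * (n + l.length))
    rfl rfl (by decide) (by decide) (by simp [Prog.bound, Expr.cost]) ?_ ?_ (by omega)) ?_
  · intro v
    simp only [encodeStructure, encode_zero (le_refl 4), ne_eq, not_true_eq_false, false_iff]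
    rintro ⟨j, hj, -⟩; omega
  · intro i _ s' hf h16 h v
    have e1 : s'.arr 1 = (Γ.encodeStructure l).arr 1 := hf.arr 1 (by decide)
    by_cases hv : v = (Γ.encodeStructure l).arr 1 i
    · simp only [Prog.eval, Expr.eval, h16, e1, hv, Function.update_self]
      simp only [ne_eq, one_ne_zero, not_false_iff, true_iff]
      exact ⟨i, by omega, rfl⟩
    · simp only [Prog.eval, Expr.eval, h16, e1, Function.update_self, Function.update_of_ne hv]
      rw [h]
      constructor
      · rintro ⟨j, hj, e⟩; exact ⟨j, by omega, e⟩
      · rintro ⟨j, hj, e⟩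
        have : j ≠ i := by rintro rfl; exact hv e.symm
        exact ⟨j, by omega, e⟩
  rintro s₁ r₁ hf₁ ⟨h₁, hr₁⟩
  have hT : ∀ v (hv : v < n), s₁.arr 4 v = 0 ↔ ∃ h : v < n, (⟨v, h⟩ : Fin n) ∈ Γ.VT := by
    intro v hv
    rw [← not_iff_not, ← ne_eq, h₁]
    exact (encode_source (v := ⟨v, hv⟩) hl).trans ⟨fun h ⟨_, h'⟩ => h h', fun h h' => h ⟨hv, h'⟩⟩
  refine Runs.seq (runs_forLoop (fun i s' =>
    ListsBelow (fun v => ∃ h : v < n, (⟨v, h⟩ : Fin n) ∈ Γ.VT) i (s'.reg 20) (s'.arr 0)) 30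
    (N := n) (B := 50 * (n + l.length)) (hf₁.reg 0 (by decide)) rfl (by decide) (by decide)
    (by simp [Prog.bound, Expr.cost, Test.cost]) ?_ ?_ (by omega)) ?_
  · have e : s₁.reg 20 = 0 := hf₁.reg 20 (by decide)
    simp only [ne_eq, Nat.reduceEqDiff, not_false_eq_true,
      Function.update_of_ne, e]
    exact ⟨fun q hq => by omega, fun v hv => by omega, fun q hq => by omega⟩
  · intro i hi s' hf h16 h
    have e4 : s'.arr 4 = s₁.arr 4 := hf.arr 4 (by decide)
    by_cases hv : s₁.arr 4 i = 0
    · simpa [Prog.eval, Test.holds, Expr.eval, h16, e4, hv] using h.push ((hT i hi).1 hv)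
    · simpa [Prog.eval, Test.holds, Expr.eval, h16, e4, hv] using
        h.skip (fun hp => hv ((hT i hi).2 hp))
  rintro s₂ r₂ hf₂ ⟨h₂, hr₂⟩
  refine Runs.straight rfl (by simp [Prog.bound, Expr.cost]; omega) ?_
  refine listsDggsOutcomes_of (k := s₂.reg 20) (by simp [Prog.eval, Expr.eval]) h₂ ?_
  have : s₂.reg 0 = n := (hf₂.reg 0 (by decide)).trans (hf₁.reg 0 (by decide))
  simp [Prog.eval, Expr.eval, this]

/-- In a strongly connected set the end of any inner arc leads back to its start, so one inner arc
already gives a dicycle. Transience is thus decided by a single pass over arcs and positions. -/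
theorem not_isTransient_scc {V : Type u} {Γ : GameStructure V} {v : V} :
    ¬ Γ.IsTransient (Γ.scc v) ↔
      (∃ a ∈ Γ.scc v, ∃ b ∈ Γ.scc v, Γ.Adj a b) ∨ ∃ w ∈ Γ.scc v, w ∈ Γ.VT := by
  rw [IsTransient, not_and_or, not_not, not_not, or_comm]
  refine or_congr ⟨?_, ?_⟩ ⟨?_, ?_⟩
  · rintro ⟨a, -, h⟩
    obtain ⟨b, hb, -⟩ := Relation.TransGen.head'_iff.1 h
    exact ⟨a, hb.1, b, hb.2.1, hb.2.2⟩
  · rintro ⟨a, ha, b, hb, hab⟩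
    exact ⟨a, ha, Relation.TransGen.head' ⟨ha, hb, hab⟩ ((Γ.isSCC_scc v).1.2 b hb a ha)⟩
  · rintro ⟨w, hw, e⟩
    exact ⟨w, by rw [e]; rfl, hw⟩
  · rintro ⟨w, hw, hT⟩
    refine ⟨w, hT, ?_⟩
    rw [(Γ.isSCC_scc v).eq_scc hw]
    ext a
    constructor
    · rintro ⟨h, -⟩
      rcases h.cases_head with h | ⟨b, hb, -⟩
      · exact h.symm
      · exact absurd hb (hT b)
    · rintro rfl; exact ⟨.refl, .refl⟩

/-- Numbers the strongly connected components that are not transient. -/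
def msLister : Prog :=
  .seq sccProg
  (.seq (forLoop 1 (.ite (.eq (.read 20 (.read 1 (.reg 16))) (.read 20 (.read 2 (.reg 16))))
    (.write 29 (.read 20 (.read 1 (.reg 16))) (.const 1)) .skip))
  (.seq (forLoop 0 (.ite (.eq (.read 25 (.reg 16)) (.const 0))
    (.write 29 (.read 20 (.reg 16)) (.const 1)) .skip))
  (.seq (forLoop 0 (.ite (.eq (.read 29 (.read 20 (.reg 16))) (.const 0))
    (.write 0 (.reg 16) (.const 0))
    (.seq (.ite (.eq (.read 30 (.read 20 (.reg 16))) (.const 0))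
      (.seq (.assign 20 (.succ (.reg 20))) (.write 30 (.read 20 (.reg 16)) (.reg 20))) .skip)
      (.write 0 (.reg 16) (.read 30 (.read 20 (.reg 16)))))))
    (.assign 0 (.reg 20)))))

/-- The classes `K v` of the positions `v < i` with `fl (K v) ≠ 0` have the numbers `1, …, k`. -/
structure Numbered (fl K : ℕ → ℕ) (i k : ℕ) (num out : ℕ → ℕ) : Prop where
  zero : ∀ v < i, fl (K v) = 0 → out v = 0
  pos : ∀ v < i, fl (K v) ≠ 0 → out v = num (K v) ∧ num (K v) ≠ 0
  inj : ∀ a b, num a ≠ 0 → num a = num b → a = b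
  le : ∀ a, num a ≤ k
  surj : ∀ t, 1 ≤ t → t ≤ k → ∃ v < i, fl (K v) ≠ 0 ∧ num (K v) = t

theorem Numbered.skip {fl K num out : ℕ → ℕ} {i k : ℕ} (h : Numbered fl K i k num out)
    (hi : fl (K i) = 0) : Numbered fl K (i + 1) k num (Function.update out i 0) := by
  refine ⟨fun v hv h0 => ?_, fun v hv h0 => ?_, h.inj, h.le, fun t h1 h2 => ?_⟩
  · by_cases hvi : v = i
    · rw [hvi, Function.update_self]
    · rw [Function.update_of_ne hvi]; exact h.zero v (by omega) h0
  · have hvi : v ≠ i := by rintro rfl; exact h0 hi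
    rw [Function.update_of_ne hvi]; exact h.pos v (by omega) h0
  · obtain ⟨v, hv, h'⟩ := h.surj t h1 h2
    exact ⟨v, by omega, h'⟩

theorem Numbered.known {fl K num out : ℕ → ℕ} {i k : ℕ} (h : Numbered fl K i k num out)
    (hi : fl (K i) ≠ 0) (hn : num (K i) ≠ 0) :
    Numbered fl K (i + 1) k num (Function.update out i (num (K i))) := by
  refine ⟨fun v hv h0 => ?_, fun v hv h0 => ?_, h.inj, h.le, fun t h1 h2 => ?_⟩
  · have hvi : v ≠ i := by rintro rfl; exact hi h0
    rw [Function.update_of_ne hvi]; exact h.zero v (by omega) h0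
  · by_cases hvi : v = i
    · rw [hvi, Function.update_self]; exact ⟨rfl, hn⟩
    · rw [Function.update_of_ne hvi]; exact h.pos v (by omega) h0
  · obtain ⟨v, hv, h'⟩ := h.surj t h1 h2
    exact ⟨v, by omega, h'⟩

theorem Numbered.new {fl K num out : ℕ → ℕ} {i k : ℕ} (h : Numbered fl K i k num out)
    (hi : fl (K i) ≠ 0) (hn : num (K i) = 0) :
    Numbered fl K (i + 1) (k + 1) (Function.update num (K i) (k + 1))
      (Function.update out i (k + 1)) := by
  have hne : ∀ a, num a ≠ 0 → a ≠ K i := fun a ha e => ha (e ▸ hn)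
  refine ⟨fun v hv h0 => ?_, fun v hv h0 => ?_, fun a b ha hab => ?_, fun a => ?_,
    fun t h1 h2 => ?_⟩
  · have hvi : v ≠ i := by rintro rfl; exact hi h0
    rw [Function.update_of_ne hvi]; exact h.zero v (by omega) h0
  · by_cases hvi : v = i
    · rw [hvi, Function.update_self, Function.update_self]; omega
    · have := h.pos v (by omega) h0
      rw [Function.update_of_ne hvi, Function.update_of_ne (hne _ this.2)]; exact this
  · have ka := h.le a
    have kb := h.le b
    by_cases hai : a = K i <;> by_cases hbi : b = K i
    · rw [hai, hbi]
    · rw [hai, Function.update_self, Function.update_of_ne hbi] at hab; omega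
    · rw [hbi, Function.update_self, Function.update_of_ne hai] at hab; omega
    · rw [Function.update_of_ne hai] at ha
      rw [Function.update_of_ne hai, Function.update_of_ne hbi] at hab
      exact h.inj a b ha hab
  · by_cases hai : a = K i
    · rw [hai, Function.update_self]
    · rw [Function.update_of_ne hai]; have := h.le a; omega
  · by_cases htk : t = k + 1
    · exact ⟨i, by omega, hi, by rw [Function.update_self, htk]⟩
    · obtain ⟨v, hv, h3, h4⟩ := h.surj t h1 (by omega)
      exact ⟨v, by omega, h3, by rw [Function.update_of_ne (hne _ (by omega)), h4]⟩

/-- An outcome is coded by the number written at one of its positions; all its positions share that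
number because they share the value of `K`. -/
theorem listsMsOutcomes_of {fl K num : ℕ → ℕ} {s : Memory}
    (hK : ∀ v w : Fin n, K v = K w ↔ w ∈ Γ.scc v)
    (hfl : ∀ v : Fin n, fl (K v) ≠ 0 ↔ ¬ Γ.IsTransient (Γ.scc v))
    (h : Numbered fl K n (s.reg 0) num (s.arr 0)) : Γ.ListsMsOutcomes s := by
  choose rep hrep using fun ω : Γ.MsOutcome => ω.2.1.1.1
  have hω : ∀ ω : Γ.MsOutcome, ∀ v ∈ ω.1, fl (K v) ≠ 0 ∧ K v = K (rep ω) := by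
    intro ω v hv
    refine ⟨(hfl v).2 ?_, (hK _ _).2 ?_⟩
    · rw [← ω.2.1.eq_scc hv]; exact ω.2.2
    · rw [← ω.2.1.eq_scc hv]; exact hrep ω
  have hcode : ∀ ω : Γ.MsOutcome, s.arr 0 (rep ω) = num (K (rep ω)) ∧ num (K (rep ω)) ≠ 0 :=
    fun ω => h.pos _ (rep ω).2 (hω ω _ (hrep ω)).1
  have hinj : ∀ ω ω' : Γ.MsOutcome, s.arr 0 (rep ω) = s.arr 0 (rep ω') → ω = ω' := by
    intro ω ω' e
    rw [(hcode ω).1, (hcode ω').1] at e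
    have := (hK _ _).1 (h.inj _ _ (hcode ω).2 e)
    apply Subtype.ext
    rw [ω.2.1.eq_scc (hrep ω), ω'.2.1.eq_scc (hrep ω')]
    exact (Γ.isSCC_scc (rep ω)).eq_scc this
  obtain ⟨f, hf⟩ := exists_equiv_of_codes (a := fun i : Fin (s.reg 0) => (i : ℕ) + 1)
    (code := fun ω : Γ.MsOutcome => s.arr 0 (rep ω))
    (fun i j e => Fin.ext (by simpa using e)) (fun ω ω' => hinj ω ω') (fun i => by
      obtain ⟨v, hv, h1, h2⟩ := h.surj (i + 1) (by omega) (by have := i.2; omega)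
      let ω : Γ.MsOutcome := ⟨Γ.scc ⟨v, hv⟩, Γ.isSCC_scc _, (hfl ⟨v, hv⟩).1 h1⟩
      refine ⟨ω, ?_⟩
      have := (hω ω ⟨v, hv⟩ ⟨.refl, .refl⟩).2
      simp only [] at this
      rw [(hcode ω).1, ← this, h2]) (fun ω => by
      have h1 := (hcode ω).1
      have h2 := (hcode ω).2
      have h3 := h.le (K (rep ω))
      exact ⟨⟨num (K (rep ω)) - 1, by omega⟩, by simp only []; omega⟩)
  refine ⟨f, fun v => ⟨fun i hv => ?_, fun hv => ?_⟩⟩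
  · obtain ⟨h1, h2⟩ := hω _ v hv
    rw [(h.pos v v.2 h1).1, h2, ← (hcode _).1]
    exact (hf i).symm
  · refine h.zero v v.2 ?_
    by_contra hne
    exact hv ⟨Γ.scc v, Γ.isSCC_scc v, (hfl v).1 hne⟩ ⟨.refl, .refl⟩

theorem lists_ms (hl : Γ.IsArcList l) :
    HaltsWithin msLister (Γ.encodeStructure l) (5000 * (n + l.length)) Γ.ListsMsOutcomes := by
  apply Runs.haltsWithin
  have hn0 : 0 < n := Γ.init.pos
  refine Runs.seq (runs_sccProg (n := n) (m := l.length) (B := 3000 * (n + l.length)) rfl rfl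
    (fun a ha => encode_zero ha) encode_bound (by omega)) ?_
  rintro s₁ r₁ hf₁ ⟨⟨hscc, s₀, hL, hs₀⟩, hr₁⟩
  obtain ⟨K, hKe⟩ : ∃ K, s₁.arr 20 = K := ⟨_, rfl⟩
  obtain ⟨src, hsrc⟩ : ∃ src, (Γ.encodeStructure l).arr 1 = src := ⟨_, rfl⟩
  obtain ⟨tgt, htgt⟩ : ∃ tgt, (Γ.encodeStructure l).arr 2 = tgt := ⟨_, rfl⟩
  rw [hKe, hsrc, htgt] at hscc
  rw [hsrc, htgt] at hL
  have e1 : s₁.arr 1 = src := by rw [hf₁.arr 1 (by decide), hsrc]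
  have e2 : s₁.arr 2 = tgt := by rw [hf₁.arr 2 (by decide), htgt]
  have z : ∀ a, a ∉ sccProg.arrs → 4 ≤ a → s₁.arr a = fun _ => 0 := fun a ha h4 => by
    rw [hf₁.arr a ha]; exact encode_zero h4
  -- Array `29` is indexed by component numbers. This loop flags components with an inner arc, and
  -- the next one those of terminals.
  refine Runs.seq (runs_forLoop (fun i s' => ∀ x, s'.arr 29 x ≠ 0 ↔
    ∃ j < i, K (src j) = x ∧ K (tgt j) = x) 40 (N := l.length) (B := 2000 * (n + l.length))
    (hf₁.reg 1 (by decide)) rfl (by decide) (by decide)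
    (by simp [Prog.bound, Expr.cost, Test.cost]) ?_ ?_ (by omega)) ?_
  · intro x
    simp [z 29 (by decide) (by omega)]
  · intro i _ s' hf h16 h x
    have e1' : s'.arr 1 = src := (hf.arr 1 (by decide)).trans e1
    have e2' : s'.arr 2 = tgt := (hf.arr 2 (by decide)).trans e2
    have e3' : s'.arr 20 = K := (hf.arr 20 (by decide)).trans hKe
    have hsplit : (∃ j < i + 1, K (src j) = x ∧ K (tgt j) = x) ↔
        (K (src i) = x ∧ K (tgt i) = x) ∨ ∃ j < i, K (src j) = x ∧ K (tgt j) = x :=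
      Nat.exists_lt_succ_right.trans or_comm
    rw [hsplit, ← h x]
    by_cases hc : K (src i) = K (tgt i)
    · by_cases hx : x = K (tgt i)
      · simp [Prog.eval, Test.holds, Expr.eval, h16, e1', e2', e3', hc, hx]
      · simp [Prog.eval, Test.holds, Expr.eval, h16, e1', e2', e3', hc, hx, Ne.symm hx]
    · have : ¬ (K (src i) = x ∧ K (tgt i) = x) := fun h => hc (h.1.trans h.2.symm)
      simp [Prog.eval, Test.holds, Expr.eval, h16, e1', e2', e3', hc, this]
  rintro s₂ r₂ hf₂ ⟨h₂, hr₂⟩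
  have e₂ : ∀ a, a ≠ 29 → s₂.arr a = s₁.arr a := fun a ha => hf₂.arr a (by
    simpa [forLoop, Prog.arrs] using ha)
  have hdeg : ∀ v, s₂.arr 25 v = 0 ↔ ∀ j < l.length, src j ≠ v := by
    intro v
    rw [e₂ 25 (by decide), hs₀ 25 (by decide), hL.deg, Finset.card_eq_zero,
      Finset.filter_eq_empty_iff]
    simp
  refine Runs.seq (runs_forLoop (fun i s' => ∀ x, s'.arr 29 x ≠ 0 ↔
    (∃ v < i, K v = x ∧ s₂.arr 25 v = 0) ∨ s₂.arr 29 x ≠ 0) 40 (N := n)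
    (B := 1000 * (n + l.length))
    ((hf₂.reg 0 (by decide)).trans (hf₁.reg 0 (by decide))) rfl (by decide) (by decide)
    (by simp [Prog.bound, Expr.cost, Test.cost]) ?_ ?_ (by omega)) ?_
  · intro x
    simp
  · intro i _ s' hf h16 h x
    have e1' : s'.arr 25 = s₂.arr 25 := hf.arr 25 (by decide)
    have e3' : s'.arr 20 = K := by rw [hf.arr 20 (by decide), e₂ 20 (by decide), hKe]
    have hsplit : (∃ v < i + 1, K v = x ∧ s₂.arr 25 v = 0) ↔
        (K i = x ∧ s₂.arr 25 i = 0) ∨ ∃ v < i, K v = x ∧ s₂.arr 25 v = 0 :=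
      Nat.exists_lt_succ_right.trans or_comm
    rw [hsplit, or_assoc, ← h x]
    by_cases hc : s₂.arr 25 i = 0
    · by_cases hx : x = K i
      · simp [Prog.eval, Test.holds, Expr.eval, h16, e1', e3', hc, hx]
      · simp [Prog.eval, Test.holds, Expr.eval, h16, e1', e3', hc, hx, Ne.symm hx]
    · simp [Prog.eval, Test.holds, Expr.eval, h16, e1', hc]
  rintro s₃ r₃ hf₃ ⟨h₃, hr₃⟩
  have e₃ : ∀ a, a ≠ 29 → s₃.arr a = s₁.arr a := fun a ha =>
    (hf₃.arr a (by simpa [forLoop, Prog.arrs] using ha)).trans (e₂ a ha)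
  refine Runs.seq (runs_forLoop (fun i s' => Numbered (s₃.arr 29) K i (s'.reg 20) (s'.arr 30)
    (s'.arr 0)) 60 (N := n) (B := 100)
    (by rw [hf₃.reg 0 (by decide), hf₂.reg 0 (by decide), hf₁.reg 0 (by decide)]; rfl) rfl
    (by decide) (by decide) (by simp [Prog.bound, Expr.cost, Test.cost]) ?_ ?_ (by omega)) ?_
  · have e : s₃.reg 20 = 0 := by
      rw [hf₃.reg 20 (by decide), hf₂.reg 20 (by decide), hf₁.reg 20 (by decide)]; rfl
    simp only [ne_eq, Nat.reduceEqDiff, not_false_eq_true,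
      Function.update_of_ne, e, e₃ 30 (by decide), z 30 (by decide) (by omega)]
    exact ⟨fun v hv => by omega, fun v hv => by omega, fun a b h => absurd rfl h,
      fun a => le_rfl, fun t h1 h2 => by omega⟩
  · intro i _ s' hf h16 h
    have e1' : s'.arr 29 = s₃.arr 29 := hf.arr 29 (by decide)
    have e3' : s'.arr 20 = K := by rw [hf.arr 20 (by decide), e₃ 20 (by decide), hKe]
    by_cases hfl : s₃.arr 29 (K i) = 0
    · simpa [Prog.eval, Test.holds, Expr.eval, h16, e1', e3', hfl] using h.skip hfl
    · by_cases hnum : s'.arr 30 (K i) = 0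
      · simpa [Prog.eval, Test.holds, Expr.eval, h16, e1', e3', hfl, hnum] using h.new hfl hnum
      · simpa [Prog.eval, Test.holds, Expr.eval, h16, e1', e3', hfl, hnum] using h.known hfl hnum
  rintro s₄ r₄ hf₄ ⟨h₄, hr₄⟩
  refine Runs.straight rfl (by simp [Prog.bound, Expr.cost]; omega) ?_
  have hK : ∀ v w : Fin n, K v = K w ↔ w ∈ Γ.scc v := by
    intro v w
    rw [hscc.eq_iff v v.2 w w.2, ← hsrc, ← htgt]
    exact and_congr (encode_reach hl) (encode_reach hl)
  refine listsMsOutcomes_of (fl := s₃.arr 29) (K := K) (num := s₄.arr 30) hK ?_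
    (by simpa [Prog.eval, Expr.eval] using h₄)
  intro v
  rw [h₃, not_isTransient_scc, or_comm, h₂]
  refine or_congr ⟨?_, ?_⟩ ⟨?_, ?_⟩
  · rintro ⟨j, hj, h1, h2⟩
    obtain ⟨ha, hb, hab⟩ := (encode_arc (c := 0) (label := fun _ => 0) hl).1
      ⟨j, hj, congrFun hsrc j, congrFun htgt j⟩
    exact ⟨⟨_, ha⟩, (hK _ _).1 h1.symm, ⟨_, hb⟩, (hK _ _).1 h2.symm, hab⟩
  · rintro ⟨a, ha, b, hb, hab⟩
    obtain ⟨j, hj, e1, e2⟩ := (encode_arc_fin (c := 0) (label := fun _ => 0) hl).2 hab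
    refine ⟨j, hj, ?_, ?_⟩
    · rw [← hsrc, (hK v a).2 ha]; exact congrArg K e1
    · rw [← htgt, (hK v b).2 hb]; exact congrArg K e2
  · rintro ⟨w, hw, h1, h2⟩
    refine ⟨⟨w, hw⟩, (hK _ _).1 h1.symm, ?_⟩
    by_contra hT
    obtain ⟨j, hj, e⟩ := (encode_source (c := 0) (label := fun _ => 0) hl).2 hT
    exact (hdeg w).1 h2 j hj ((congrFun hsrc j).symm.trans e)
  · rintro ⟨w, hw, hT⟩
    refine ⟨w, w.2, ((hK _ _).2 hw).symm, (hdeg w).2 fun j hj e => ?_⟩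
    exact (encode_source (c := 0) (label := fun _ => 0) hl).1
      ⟨j, hj, (congrFun hsrc j).trans e⟩ hT

end Listing

end GameStructure

open GameStructure Ram in
/-- The three requirements for the DGGS oracle and for the multi-stage DGGS oracle: the outcomes are
generated in linear time, the game form is tight, and every `±1` game is solved in linear time. -/
theorem mainTheorem8 :
    -- DGGS
    ((∃ (P : Prog) (C : ℕ), ∀ (n : ℕ) (Γ : GameStructure (Fin n)) (l : List (Fin n × Fin n)),
        Γ.IsArcList l →
        HaltsWithin P (Γ.encodeStructure l) (C * (n + l.length)) Γ.ListsDggsOutcomes) ∧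
      (∀ (V : Type u) [Finite V] (Γ : GameStructure V), IsTight Γ.dggsForm) ∧
      (∃ (P : Prog) (C : ℕ), ∀ (n : ℕ) (Γ : GameStructure (Fin n)) (l : List (Fin n × Fin n)),
        Γ.IsArcList l → ∀ ΩA : Set Γ.DggsOutcome,
        HaltsWithin P (Γ.encodeDggsGame l ΩA) (C * (n + l.length))
          (Γ.HoldsSolution Γ.dggsForm ΩA))) ∧
    -- multi-stage DGGS
    ((∃ (P : Prog) (C : ℕ), ∀ (n : ℕ) (Γ : GameStructure (Fin n)) (l : List (Fin n × Fin n)),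
        Γ.IsArcList l →
        HaltsWithin P (Γ.encodeStructure l) (C * (n + l.length)) Γ.ListsMsOutcomes) ∧
      (∀ (V : Type u) [Finite V] (Γ : GameStructure V), IsTight Γ.msForm) ∧
      (∃ (P : Prog) (C : ℕ), ∀ (n : ℕ) (Γ : GameStructure (Fin n)) (l : List (Fin n × Fin n)),
        Γ.IsArcList l → ∀ ΩA : Set Γ.MsOutcome,
        HaltsWithin P (Γ.encodeMsGame l ΩA) (C * (n + l.length))
          (Γ.HoldsSolution Γ.msForm ΩA))) := by
  exact ⟨⟨⟨dggsLister, 1000, fun _ _ _ hl => lists_dggs hl⟩, fun _ _ Γ => Γ.isTight_dggsForm,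
      solver dggsLabelBody, 5000, fun _ Γ _ hl ΩA => Γ.solves_dggs hl ΩA⟩,
    ⟨msLister, 5000, fun _ _ _ hl => lists_ms hl⟩, fun _ _ Γ => Γ.isTight_msForm,
      solver msLabelBody, 5000, fun _ Γ _ hl ΩA => Γ.solves_ms hl ΩA⟩
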